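/- Let $f\colon\mathbb N\to\mathbb N$ be nondecreasing with $f(n)\ge\log n$ for all $n\ge 1$. Then $$\mathrm U_f\text{-}\mathrm{AC}^0_{\mathbb R}\;=\;\mathrm{FO}_{\mathbb R}[\mathrm{FTIME}_{\mathbb R}(f(n))]+\mathrm{SUM}_{\mathbb R}+\mathrm{PROD}_{\mathbb R},$$ as classes of subsets of $\mathbb R^\infty=\bigcup_{n\ge1}\mathbb R^n$, where the notions are as follows. *Machines.* An $\mathbb R$-machine is a Blum–Shub–Smale machine on the bi-infinite tape $\mathbb R_\infty$ (real sequences indexed by $\mathbb Z$ with finitely many nonzero entries). It has an input node, an output node and finitely many computation nodes (which apply a rational map with real coefficients to finitely many coordinates), branch nodes (which test $x_0\ge0$) and shift nodes (left or right); each visit to a node counts one step. On input $(x_1,\dots,x_n)$ the tape holds $n$ in coordinate $0$, $x_i$ in coordinate $i$ for $1\le i\le n$, and $0$ elsewhere; an output in $\mathbb R^k$ is read off the coordinates $1,\dots,k$. *Circuits.* An arithmetic circuit with $n$ inputs is a finite directed acyclic graph of gates without multiple edges. Its gates are exactly one input gate for each of the $n$ inputs (type 1, indegree 0), constant gates holding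 a real number (type 2, indegree 0), $+$ gates and $\times$ gates of arbitrary indegree (types 3 and 4), sign gates of indegree 1 (type 5, computing $\operatorname{sign}(x)\in\{-1,0,1\}$), and one output gate of indegree 1 (type 6). Its size is its number of gates; its depth is the length of a longest directed path that ends in the output gate (such a path starts in a gate without predecessors). A family $(C_n)_{n\ge1}$ of such circuits decides $S\subseteq\mathbb R^\infty$ if $C_{|x|}(x)$ is $1$ for $x\in S$ and $0$ for $x\notin S$. *The class $\mathrm U_f\text{-}\mathrm{AC}^0_{\mathbb R}$.* It consists of the sets decided by a family $(C_n)_{n\ge1}$ of polynomial size and constant depth for which the gates of each $C_n$ can be numbered $1,\dots,\mathrm{size}(C_n)$ and the predecessors of each gate can be ordered such that some $\mathbb R$-machine, given any natural numbers $(n,v,p)$ with $n,p\ge1$, outputs in time $O(f(n))$ (in time $O(1)$ for those $n$ with $f(n)=0$) the triple $(t,q,c)$, where $t$ is the type of gate number $v$ of $C_n$, $q$ is the number of its $p$-th predecessor ($0$ if it has fewer than $p$ predecessors), and $c$ is the value of the gate if it is a constant gate, $i$ if it is the $i$-th input gate, and $0$ otherwise; if $C_n$ has no gate with number $v$, the output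 is $(0,0,0)$. *Structures.* An $\mathbb R$-structure of signature $(L_s,L_f)$, two finite ordered vocabularies of function symbols, consists of a finite nonempty universe $A$, a function $A^k\to A$ for each $k$-ary symbol of $L_s$, and a function $A^k\to\mathbb R$ for each $k$-ary symbol of $L_f$. Given a ranking, i.e. a bijection $r\colon A\to\{0,\dots,|A|-1\}$, its encoding is the concatenation of the value tables of the functions $r\circ g$ (for $g$ interpreting a symbol of $L_s$), followed by those of the functions interpreting $L_f$, in the order of the vocabularies; each table lists the arguments lexicographically with respect to $r$, and functions of arity $0$ are treated as if they had arity $1$. *$\mathrm{FTIME}_{\mathbb R}(f(n))$.* It consists of the families of functions $F_n\colon\{0,\dots,n-1\}^k\to\{0,\dots,n-1\}$ or $F_n\colon\{0,\dots,n-1\}^k\to\mathbb R$ ($n\ge1$, $k$ fixed) for which one $\mathbb R$-machine computes $F_n(a_1,\dots,a_k)$ from $(n,a_1,\dots,a_k)$ for all $n$ in time $O(f(n))$ (in time $O(1)$ for those $n$ with $f(n)=0$). *The logic.* There is a further finite vocabulary $L_a$ of function symbols; each is interpreted by one of these families, on a universe of size $n$ by $F_n$, elements being identified with their ranks. Index terms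 are built from variables ranging over $A$ by the symbols of $L_s$ and the index-valued symbols of $L_a$. Number terms are built from real constants, the symbols of $L_f$ and the real-valued symbols of $L_a$ applied to index terms, $+$, $\times$, $\operatorname{sign}$, and the sum and product rules: if $t$ is a number term, then so are $\sum_{i\in A}t(i,\bar w)$ and $\prod_{i\in A}t(i,\bar w)$. Formulas are built from equalities of index terms and equalities and strict inequalities of number terms by $\neg,\wedge,\vee,\to,\leftrightarrow$ and the quantifiers $\exists,\forall$ over $A$. A set $S\subseteq\mathbb R^\infty$ belongs to $\mathrm{FO}_{\mathbb R}[\mathrm{FTIME}_{\mathbb R}(f(n))]+\mathrm{SUM}_{\mathbb R}+\mathrm{PROD}_{\mathbb R}$ if there are a signature, interpretations of $L_a$ in $\mathrm{FTIME}_{\mathbb R}(f(n))$ and a sentence $\varphi$ such that the elements of $S$ are exactly the encodings of the ranked structures of that signature that satisfy $\varphi$. -/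

import Mathlib

noncomputable section

namespace RealAC0

/-- The space of inputs: real vectors `(x₁, …, xₙ)` of arbitrary length `n ≥ 1`. -/
abbrev RInf : Type := Σ n : ℕ+, (Fin n → ℝ)

/-! ### Machines over the reals -/

/-- The bi-infinite direct sum: sequences `(…, x₋₁, x₀, x₁, …)` with finitely many nonzero entries. -/
abbrev Tape : Type := ℤ →₀ ℝ

/-- The shift left: coordinate `i` receives the entry of coordinate `i + 1`. -/
def shiftLeft (T : Tape) : Tape := T.equivMapDomain (Equiv.subRight 1)

/-- The shift right: coordinate `i` receives the entry of coordinate `i - 1`. -/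
def shiftRight (T : Tape) : Tape := T.equivMapDomain (Equiv.addRight 1)

@[simp] theorem shiftLeft_apply (T : Tape) (i : ℤ) : shiftLeft T i = T (i + 1) := rfl

@[simp] theorem shiftRight_apply (T : Tape) (i : ℤ) : shiftRight T i = T (i - 1) := rfl

/-- The map of a computation node: each coordinate `i ∈ U` is replaced by the value of the rational
function `num i / den i` on the old tape, all others are kept.  (A polynomial involves finitely
many coordinates; `den i = 1` gives polynomial maps.) -/
def rationalMap (U : Finset ℤ) (num den : ℤ → MvPolynomial ℤ ℝ) (T : Tape) : Tape :=
  Finsupp.onFinset (T.support ∪ U)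
    (fun i => if i ∈ U then MvPolynomial.eval T (num i) / MvPolynomial.eval T (den i) else T i)
    (by
      intro i hi
      by_cases h : i ∈ U
      · exact Finset.mem_union_right _ h
      · rw [if_neg h] at hi
        exact Finset.mem_union_left _ (Finsupp.mem_support_iff.2 hi))

@[simp] theorem rationalMap_apply (U : Finset ℤ) (num den : ℤ → MvPolynomial ℤ ℝ) (T : Tape)
    (i : ℤ) : rationalMap U num den T i =
      if i ∈ U then MvPolynomial.eval T (num i) / MvPolynomial.eval T (den i) else T i := rfl

/-- The nodes of a machine other than the input node and the output node.  A next node `some q` is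
such a node, the next node `none` is the output node. -/
inductive Node (N : ℕ) : Type
  | computation (U : Finset ℤ) (num den : ℤ → MvPolynomial ℤ ℝ) (next : Option (Fin N))
  | branch (nextPos nextNeg : Option (Fin N))
  | shiftL (next : Option (Fin N))
  | shiftR (next : Option (Fin N))

/-- A machine over `ℝ`: an input node, whose next node is `start`, finitely many computation,
branch and shift nodes, and an output node (`none`). -/
structure Machine where
  N : ℕ
  node : Fin N → Node N
  start : Option (Fin N)

/-- `M.Run t q T T'`: started at node `q` with tape `T`, the machine reaches its output node after
exactly `t` steps, with tape `T'`.  A computation node can only be passed where none of its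
denominators vanishes. -/
inductive Machine.Run (M : Machine) : ℕ → Option (Fin M.N) → Tape → Tape → Prop
  | output (T : Tape) : Machine.Run M 0 none T T
  | computation {t : ℕ} {q : Fin M.N} {T T' : Tape} {U : Finset ℤ}
      {num den : ℤ → MvPolynomial ℤ ℝ} {r : Option (Fin M.N)}
      (hq : M.node q = Node.computation U num den r)
      (hden : ∀ i ∈ U, MvPolynomial.eval T (den i) ≠ 0)
      (h : Machine.Run M t r (rationalMap U num den T) T') : Machine.Run M (t + 1) (some q) T T'
  | branchPos {t : ℕ} {q : Fin M.N} {T T' : Tape} {r s : Option (Fin M.N)}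
      (hq : M.node q = Node.branch r s) (h0 : 0 ≤ T 0)
      (h : Machine.Run M t r T T') : Machine.Run M (t + 1) (some q) T T'
  | branchNeg {t : ℕ} {q : Fin M.N} {T T' : Tape} {r s : Option (Fin M.N)}
      (hq : M.node q = Node.branch r s) (h0 : T 0 < 0)
      (h : Machine.Run M t s T T') : Machine.Run M (t + 1) (some q) T T'
  | shiftL {t : ℕ} {q : Fin M.N} {T T' : Tape} {r : Option (Fin M.N)}
      (hq : M.node q = Node.shiftL r)
      (h : Machine.Run M t r (shiftLeft T) T') : Machine.Run M (t + 1) (some q) T T'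
  | shiftR {t : ℕ} {q : Fin M.N} {T T' : Tape} {r : Option (Fin M.N)}
      (hq : M.node q = Node.shiftR r)
      (h : Machine.Run M t r (shiftRight T) T') : Machine.Run M (t + 1) (some q) T T'

/-- The input map: `(x₁, …, xₙ)` is placed in the coordinates `1, …, n`, its length `n` in
coordinate `0`, and all other coordinates are `0`. -/
def inputTape {n : ℕ} (x : Fin n → ℝ) : Tape :=
  Finsupp.onFinset (Finset.Icc 0 (n : ℤ))
    (fun i => if i = 0 then (n : ℝ) else
      if h : 1 ≤ i ∧ i ≤ (n : ℤ) then x ⟨(i - 1).toNat, by omega⟩ else 0)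
    (by
      intro i hi
      rw [Finset.mem_Icc]
      by_cases h0 : i = 0
      · omega
      · rw [if_neg h0] at hi
        by_cases h : 1 ≤ i ∧ i ≤ (n : ℤ)
        · omega
        · rw [dif_neg h] at hi
          exact absurd rfl hi)

/-- On input `x`, the machine reaches its output node within `b` steps (the step leaving the input
node included) and then its output in `ℝᵏ`, read off the coordinates `1, …, k`, is `y`. -/
def Machine.ComputesWithin (M : Machine) {n k : ℕ} (x : Fin n → ℝ) (y : Fin k → ℝ) (b : ℕ) :
    Prop :=
  ∃ t T, t + 1 ≤ b ∧ M.Run t M.start (inputTape x) T ∧ ∀ i : Fin k, T ((i : ℤ) + 1) = y i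

/-! ### Arithmetic circuits over the reals -/

/-- The labels of the gates of a circuit with `n` inputs; `input i` is the `(i+1)`-st input. -/
inductive GateKind (n : ℕ) : Type
  | input (i : Fin n)
  | const (c : ℝ)
  | add
  | mul
  | sign
  | output

/-- The number `1, …, 6` of a gate type. -/
def GateKind.code {n : ℕ} : GateKind n → ℕ
  | input _ => 1
  | const _ => 2
  | add => 3
  | mul => 4
  | sign => 5
  | output => 6

/-- The value of a constant gate, the index (counted from `1`) of an input gate, `0` otherwise. -/
def GateKind.label {n : ℕ} : GateKind n → ℝ
  | input i => (i : ℝ) + 1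
  | const c => c
  | _ => 0

/-- The indegrees allowed for a gate type. -/
def GateKind.IndegreeOK {n : ℕ} : GateKind n → ℕ → Prop
  | input _, d => d = 0
  | const _, d => d = 0
  | add, _ => True
  | mul, _ => True
  | sign, d => d = 1
  | output, d => d = 1

/-- An arithmetic circuit with `n` input gates and one output gate, of unbounded fan-in, whose
gates are numbered and the predecessors of each of whose gates are ordered. -/
structure Circuit (n : ℕ) where
  /-- the number of gates -/
  size : ℕ
  kind : Fin size → GateKind n
  /-- the predecessors of a gate, in their order -/
  pred : Fin size → List (Fin size)
  pred_nodup : ∀ v, (pred v).Nodup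
  indegree : ∀ v, (kind v).IndegreeOK (pred v).length
  acyclic : WellFounded (fun u v => u ∈ pred v)
  input_unique : ∀ i : Fin n, ∃! v, kind v = GateKind.input i
  /-- the output gate -/
  out : Fin size
  kind_eq_output : ∀ v, kind v = GateKind.output ↔ v = out

/-- The value of a gate from the list of the values of its predecessors.  Sign and output gates have
exactly one predecessor, and then the sum of the list is the value of that predecessor. -/
def GateKind.apply {n : ℕ} (x : Fin n → ℝ) : GateKind n → List ℝ → ℝ
  | input i, _ => x i
  | const c, _ => c
  | add, l => l.sum
  | mul, l => l.prod
  | sign, l => Real.sign l.sum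
  | output, l => l.sum

/-- The values of the gates of a circuit on input `x`. -/
def Circuit.val {n : ℕ} (C : Circuit n) (x : Fin n → ℝ) : Fin C.size → ℝ :=
  C.acyclic.fix fun v ih => (C.kind v).apply x ((C.pred v).attach.map fun u => ih u.1 u.2)

theorem Circuit.val_eq {n : ℕ} (C : Circuit n) (x : Fin n → ℝ) (v : Fin C.size) :
    C.val x v = (C.kind v).apply x ((C.pred v).map (C.val x)) := by
  rw [Circuit.val, C.acyclic.fix_eq]
  congr 1
  exact List.attach_map_val (l := C.pred v) (f := C.val x)

/-- The output of the circuit. -/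
def Circuit.eval {n : ℕ} (C : Circuit n) (x : Fin n → ℝ) : ℝ := C.val x C.out

/-- `C.Path l u v`: there is a directed path with `l` edges from gate `u` to gate `v`. -/
inductive Circuit.Path {n : ℕ} (C : Circuit n) : ℕ → Fin C.size → Fin C.size → Prop
  | nil (v : Fin C.size) : Circuit.Path C 0 v v
  | cons {l : ℕ} {u w v : Fin C.size} (h : u ∈ C.pred w) (hw : Circuit.Path C l w v) :
      Circuit.Path C (l + 1) u v

/-- The depth of the circuit, that is the length of a longest path ending in the output gate
(it then starts in a gate without predecessors), is at most `d`. -/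
def Circuit.DepthLE {n : ℕ} (C : Circuit n) (d : ℕ) : Prop :=
  ∀ l u, C.Path l u C.out → l ≤ d

/-- A circuit family: one circuit for each input length `n ≥ 1`. -/
abbrev CircuitFamily : Type := (n : ℕ+) → Circuit n

/-- The family computes the characteristic function of `S`. -/
def CircuitFamily.Decides (C : CircuitFamily) (S : Set RInf) : Prop :=
  ∀ x : RInf, (x ∈ S → (C x.1).eval x.2 = 1) ∧ (x ∉ S → (C x.1).eval x.2 = 0)

/-- Polynomial size. -/
def CircuitFamily.PolySize (C : CircuitFamily) : Prop :=
  ∃ p : Polynomial ℕ, ∀ n, (C n).size ≤ p.eval (n : ℕ)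

/-- Constant depth. -/
def CircuitFamily.ConstDepth (C : CircuitFamily) : Prop :=
  ∃ d, ∀ n, (C n).DepthLE d

/-- The answer `(t, p_nr, c)` to the query `(v, p)` about the circuit `C`.  The gates have the
numbers `1, …, size`, and `p ≥ 1` counts predecessors from `1`.  `t` is the type of the gate with
number `v`, `p_nr` is the number of its `p`-th predecessor (`0` if there is none), and `c` is its
label; the answer is `(0, 0, 0)` if no gate has number `v`. -/
def Circuit.answer {n : ℕ} (C : Circuit n) (v p : ℕ) : Fin 3 → ℝ :=
  if h : 1 ≤ v ∧ v ≤ C.size then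
    let g : Fin C.size := ⟨v - 1, by omega⟩
    ![((C.kind g).code : ℝ),
      match (C.pred g)[p - 1]? with
        | some w => ((w : ℕ) : ℝ) + 1
        | none => 0,
      (C.kind g).label]
  else 0

/-- The family is constructed in time `O(f(n))`: some machine answers every query `(n, v, p)` within
that time.  (As `f(n) = 0` is possible for `n = 1`, the bound is written `c * (f n + 1)`.) -/
def CircuitFamily.ConstructibleIn (C : CircuitFamily) (f : ℕ → ℕ) : Prop :=
  ∃ (M : Machine) (c : ℕ), ∀ (n : ℕ+) (v p : ℕ), 1 ≤ p →
    M.ComputesWithin ![((n : ℕ) : ℝ), (v : ℝ), (p : ℝ)] ((C n).answer v p) (c * (f n + 1))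

/-- The class `U_f-AC⁰_ℝ`. -/
def UniformAC0 (f : ℕ → ℕ) : Set (Set RInf) :=
  {S | ∃ C : CircuitFamily,
    C.PolySize ∧ C.ConstDepth ∧ C.ConstructibleIn f ∧ C.Decides S}

/-! ### First-order logic over real structures -/

/-- A signature `(L_s, L_f, L_a)` without predicate symbols; each vocabulary is finite and ordered,
and is given by the list of the arities of its symbols.  `L_a` consists of the symbols of `extIdx`,
with values in the universe, and those of `extNum`, with real values. -/
structure Signature where
  /-- the function symbols of the skeleton, `L_s` -/
  idx : List ℕ
  /-- the symbols for real-valued functions, `L_f` -/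
  num : List ℕ
  extIdx : List ℕ
  extNum : List ℕ

/-- A real structure with a finite nonempty universe `A` together with a ranking of `A`.  The
vocabulary `L_a` has no effect on it. -/
structure RStructure (σ : Signature) where
  A : Type
  /-- the number of elements of the universe -/
  card : ℕ+
  rank : A ≃ Fin card
  idxFun : (i : Fin σ.idx.length) → (Fin (σ.idx.get i) → A) → A
  numFun : (i : Fin σ.num.length) → (Fin (σ.num.get i) → A) → ℝ

/-- All `k`-tuples over `{0, …, u-1}`, in lexicographic order. -/
def tuples (u : ℕ) : (k : ℕ) → List (Fin k → Fin u)
  | 0 => [fun i => i.elim0]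
  | k + 1 => (List.finRange u).flatMap fun a =>
      (tuples u k).map fun t => (Fin.cons a t : Fin (k + 1) → Fin u)

/-- The list of the values of a `k`-ary function, in the lexicographic order of its arguments with
respect to the ranking; a function of arity `0` is treated as if it had arity `1`. -/
def RStructure.table {σ : Signature} (D : RStructure σ) {k : ℕ} (g : (Fin k → D.A) → ℝ) :
    List ℝ :=
  (tuples D.card (max k 1)).map fun t =>
    g fun j => D.rank.symm (t (Fin.castLE (le_max_left k 1) j))

/-- The encoding of a ranked structure. -/
def RStructure.enc {σ : Signature} (D : RStructure σ) : List ℝ :=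
  ((List.finRange σ.idx.length).flatMap fun i =>
    D.table fun a => ((D.rank (D.idxFun i a) : ℕ) : ℝ)) ++
  ((List.finRange σ.num.length).flatMap fun i => D.table (D.numFun i))

/-- Index terms with free variables among `v₀, …, v₍ₘ₋₁₎`. -/
inductive IdxTerm (σ : Signature) (m : ℕ) : Type
  | var (i : Fin m)
  | app (i : Fin σ.idx.length) (h : Fin (σ.idx.get i) → IdxTerm σ m)
  | ext (i : Fin σ.extIdx.length) (h : Fin (σ.extIdx.get i) → IdxTerm σ m)

/-- Number terms with free variables among `v₀, …, v₍ₘ₋₁₎`, including the sum and product rules,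
which bind the variable `vₘ`. -/
inductive NumTerm (σ : Signature) : ℕ → Type
  | const {m : ℕ} (c : ℝ) : NumTerm σ m
  | app {m : ℕ} (i : Fin σ.num.length) (h : Fin (σ.num.get i) → IdxTerm σ m) : NumTerm σ m
  | ext {m : ℕ} (i : Fin σ.extNum.length) (h : Fin (σ.extNum.get i) → IdxTerm σ m) : NumTerm σ m
  | add {m : ℕ} (t₁ t₂ : NumTerm σ m) : NumTerm σ m
  | mul {m : ℕ} (t₁ t₂ : NumTerm σ m) : NumTerm σ m
  | sign {m : ℕ} (t : NumTerm σ m) : NumTerm σ m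
  | sum {m : ℕ} (t : NumTerm σ (m + 1)) : NumTerm σ m
  | prod {m : ℕ} (t : NumTerm σ (m + 1)) : NumTerm σ m

/-- Formulas with free variables among `v₀, …, v₍ₘ₋₁₎`; quantifiers bind the variable `vₘ`. -/
inductive Formula (σ : Signature) : ℕ → Type
  | idxEq {m : ℕ} (h₁ h₂ : IdxTerm σ m) : Formula σ m
  | numEq {m : ℕ} (t₁ t₂ : NumTerm σ m) : Formula σ m
  | numLt {m : ℕ} (t₁ t₂ : NumTerm σ m) : Formula σ m
  | and {m : ℕ} (φ ψ : Formula σ m) : Formula σ m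
  | or {m : ℕ} (φ ψ : Formula σ m) : Formula σ m
  | not {m : ℕ} (φ : Formula σ m) : Formula σ m
  | imp {m : ℕ} (φ ψ : Formula σ m) : Formula σ m
  | iff {m : ℕ} (φ ψ : Formula σ m) : Formula σ m
  | ex {m : ℕ} (φ : Formula σ (m + 1)) : Formula σ m
  | all {m : ℕ} (φ : Formula σ (m + 1)) : Formula σ m

/-- A family of functions `Sᵏ → S`, one for each finite set `S = {0, …, n-1}`, `n ≥ 1`. -/
abbrev IdxFamily (k : ℕ) : Type := (n : ℕ+) → (Fin k → Fin n) → Fin n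

/-- A family of functions `Sᵏ → ℝ`, one for each finite set `S = {0, …, n-1}`, `n ≥ 1`. -/
abbrev NumFamily (k : ℕ) : Type := (n : ℕ+) → (Fin k → Fin n) → ℝ

/-- An interpretation of the symbols of `L_a`, on the universes of all sizes. -/
structure Interpretation (σ : Signature) where
  idx : (i : Fin σ.extIdx.length) → IdxFamily (σ.extIdx.get i)
  num : (i : Fin σ.extNum.length) → NumFamily (σ.extNum.get i)

section Semantics

variable {σ : Signature} (I : Interpretation σ) (D : RStructure σ)

def IdxTerm.eval {m : ℕ} (s : Fin m → D.A) : IdxTerm σ m → D.A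
  | var i => s i
  | app i h => D.idxFun i fun j => IdxTerm.eval s (h j)
  | ext i h => D.rank.symm (I.idx i D.card fun j => D.rank (IdxTerm.eval s (h j)))

def NumTerm.eval : {m : ℕ} → NumTerm σ m → (Fin m → D.A) → ℝ
  | _, const c, _ => c
  | _, app i h, s => D.numFun i fun j => (h j).eval I D s
  | _, ext i h, s => I.num i D.card fun j => D.rank ((h j).eval I D s)
  | _, add t₁ t₂, s => NumTerm.eval t₁ s + NumTerm.eval t₂ s
  | _, mul t₁ t₂, s => NumTerm.eval t₁ s * NumTerm.eval t₂ s
  | _, sign t, s => Real.sign (NumTerm.eval t s)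
  | m, sum t, s => ∑ a : Fin D.card,
      NumTerm.eval t (Fin.snoc s (D.rank.symm a) : Fin (m + 1) → D.A)
  | m, prod t, s => ∏ a : Fin D.card,
      NumTerm.eval t (Fin.snoc s (D.rank.symm a) : Fin (m + 1) → D.A)

def Formula.Holds : {m : ℕ} → Formula σ m → (Fin m → D.A) → Prop
  | _, idxEq h₁ h₂, s => h₁.eval I D s = h₂.eval I D s
  | _, numEq t₁ t₂, s => t₁.eval I D s = t₂.eval I D s
  | _, numLt t₁ t₂, s => t₁.eval I D s < t₂.eval I D s
  | _, and φ ψ, s => Formula.Holds φ s ∧ Formula.Holds ψ s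
  | _, or φ ψ, s => Formula.Holds φ s ∨ Formula.Holds ψ s
  | _, not φ, s => ¬ Formula.Holds φ s
  | _, imp φ ψ, s => Formula.Holds φ s → Formula.Holds ψ s
  | _, iff φ ψ, s => (Formula.Holds φ s ↔ Formula.Holds ψ s)
  | m, ex φ, s => ∃ a : D.A, Formula.Holds φ (Fin.snoc s a : Fin (m + 1) → D.A)
  | m, all φ, s => ∀ a : D.A, Formula.Holds φ (Fin.snoc s a : Fin (m + 1) → D.A)

/-- The truth of a sentence in a structure. -/
def Formula.Satisfied (φ : Formula σ 0) : Prop := φ.Holds I D (fun i => i.elim0)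

end Semantics

/-- A set `R` of (families of) finite functions. -/
structure FunctionClass where
  idx : (k : ℕ) → Set (IdxFamily k)
  num : (k : ℕ) → Set (NumFamily k)

/-- `FTIME_ℝ(f(n))`: the functions `F : Sᵏ → S` or `F : Sᵏ → ℝ` that some machine, which is the same
for all finite sets `S = {0, …, n-1}` and is given `(n, a₁, …, aₖ)`, computes in time `O(f(n))`. -/
def FTIME (f : ℕ → ℕ) : FunctionClass where
  idx k := {F | ∃ (M : Machine) (c : ℕ), ∀ (n : ℕ+) (a : Fin k → Fin n),
    M.ComputesWithin (Fin.cons ((n : ℕ) : ℝ) (fun j => ((a j : ℕ) : ℝ)) : Fin (k + 1) → ℝ)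
      ![((F n a : ℕ) : ℝ)] (c * (f n + 1))}
  num k := {F | ∃ (M : Machine) (c : ℕ), ∀ (n : ℕ+) (a : Fin k → Fin n),
    M.ComputesWithin (Fin.cons ((n : ℕ) : ℝ) (fun j => ((a j : ℕ) : ℝ)) : Fin (k + 1) → ℝ)
      ![F n a] (c * (f n + 1))}

/-- The class `FO_ℝ[R] + SUM_ℝ + PROD_ℝ`: the sets whose elements are exactly the encodings of the
ranked structures that satisfy some sentence, with the symbols of `L_a` interpreted in `R`. -/
def FOSumProd (R : FunctionClass) : Set (Set RInf) :=
  {S | ∃ (σ : Signature) (φ : Formula σ 0) (I : Interpretation σ),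
    (∀ i, I.idx i ∈ R.idx (σ.extIdx.get i)) ∧ (∀ i, I.num i ∈ R.num (σ.extNum.get i)) ∧
    ∀ x : RInf, x ∈ S ↔ ∃ D : RStructure σ, D.enc = List.ofFn x.2 ∧ φ.Satisfied I D}

end RealAC0

end

noncomputable section

namespace RealAC0

/-! ### Composition of machines -/

/-- Renaming of the next nodes of a node. -/
def Node.map {N N' : ℕ} (g : Option (Fin N) → Option (Fin N')) : Node N → Node N'
  | computation U num den r => computation U num den (g r)
  | branch r s => branch (g r) (g s)
  | shiftL r => shiftL (g r)
  | shiftR r => shiftR (g r)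

/-- A run of a machine that sits inside a larger one can be continued there. -/
theorem Machine.Run.embed {M M' : Machine} (g : Option (Fin M.N) → Option (Fin M'.N))
    (e : Fin M.N → Fin M'.N) (he : ∀ q, g (some q) = some (e q))
    (hn : ∀ q, M'.node (e q) = (M.node q).map g) {t t₂ : ℕ} {q : Option (Fin M.N)}
    {T T' T'' : Tape} (h : M.Run t q T T') (h' : M'.Run t₂ (g none) T' T'') :
    M'.Run (t + t₂) (g q) T T'' := by
  induction h with
  | output T => simpa using h'
  | @computation t q _ _ _ _ _ _ hq hden _ ih =>
    have := hn q
    rw [hq] at this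
    rw [he, Nat.add_right_comm]
    exact .computation this hden (ih h')
  | @branchPos t q _ _ _ _ hq h0 _ ih =>
    have := hn q
    rw [hq] at this
    rw [he, Nat.add_right_comm]
    exact .branchPos this h0 (ih h')
  | @branchNeg t q _ _ _ _ hq h0 _ ih =>
    have := hn q
    rw [hq] at this
    rw [he, Nat.add_right_comm]
    exact .branchNeg this h0 (ih h')
  | @shiftL t q _ _ _ hq _ ih =>
    have := hn q
    rw [hq] at this
    rw [he, Nat.add_right_comm]
    exact .shiftL this (ih h')
  | @shiftR t q _ _ _ hq _ ih =>
    have := hn q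
    rw [hq] at this
    rw [he, Nat.add_right_comm]
    exact .shiftR this (ih h')

/-- The machine leads from tape `T` to tape `T'` within `b` steps. -/
def Machine.Runs (M : Machine) (T : Tape) (b : ℕ) (T' : Tape) : Prop :=
  ∃ t ≤ b, M.Run t M.start T T'

theorem Machine.Runs.mono {M : Machine} {T T' : Tape} {b b' : ℕ} (h : M.Runs T b T')
    (hb : b ≤ b') : M.Runs T b' T' :=
  let ⟨t, ht, h⟩ := h
  ⟨t, ht.trans hb, h⟩

/-- Sequential composition. -/
def Machine.seq (M₁ M₂ : Machine) : Machine where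
  N := M₁.N + M₂.N
  node := Fin.addCases
    (fun q => (M₁.node q).map fun r =>
      r.elim (M₂.start.map (Fin.natAdd M₁.N)) fun r => some (Fin.castAdd M₂.N r))
    (fun q => (M₂.node q).map (Option.map (Fin.natAdd M₁.N)))
  start := M₁.start.elim (M₂.start.map (Fin.natAdd M₁.N)) fun r => some (Fin.castAdd M₂.N r)

theorem Machine.Runs.seq {M₁ M₂ : Machine} {T T' T'' : Tape} {b₁ b₂ : ℕ}
    (h₁ : M₁.Runs T b₁ T') (h₂ : M₂.Runs T' b₂ T'') : (M₁.seq M₂).Runs T (b₁ + b₂) T'' := by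
  obtain ⟨t₁, ht₁, h₁⟩ := h₁
  obtain ⟨t₂, ht₂, h₂⟩ := h₂
  refine ⟨t₁ + t₂, by omega, ?_⟩
  refine h₁.embed (M' := M₁.seq M₂)
    (fun r => r.elim (M₂.start.map (Fin.natAdd M₁.N)) fun r => some (Fin.castAdd M₂.N r))
    (Fin.castAdd M₂.N) (fun q => rfl) (fun q => ?_) ?_
  · simp [Machine.seq]
  · have := h₂.embed (M' := M₁.seq M₂) (Option.map (Fin.natAdd M₁.N)) (Fin.natAdd M₁.N)
      (fun q => rfl) (fun q => by simp [Machine.seq]) (t₂ := 0) (.output _)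
    simpa using this

/-- Branching on the sign of the coordinate `0`. -/
def Machine.ite (M₁ M₂ : Machine) : Machine where
  N := (M₁.N + M₂.N) + 1
  node := Fin.cons
    (.branch (M₁.start.map fun q => (Fin.castAdd M₂.N q).succ)
      (M₂.start.map fun q => (Fin.natAdd M₁.N q).succ))
    (Fin.addCases
      (fun q => (M₁.node q).map (Option.map fun q => (Fin.castAdd M₂.N q).succ))
      (fun q => (M₂.node q).map (Option.map fun q => (Fin.natAdd M₁.N q).succ)))
  start := some 0

theorem Machine.Runs.ite_pos {M₁ M₂ : Machine} {T T' : Tape} {b : ℕ} (h0 : 0 ≤ T 0)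
    (h : M₁.Runs T b T') : (M₁.ite M₂).Runs T (b + 1) T' := by
  obtain ⟨t, ht, h⟩ := h
  refine ⟨t + 1, by omega, .branchPos rfl h0 ?_⟩
  exact h.embed (M' := M₁.ite M₂) (Option.map fun q => (Fin.castAdd M₂.N q).succ)
    (fun q => (Fin.castAdd M₂.N q).succ) (fun q => rfl)
    (fun q => by simp [Machine.ite, Fin.cons_succ]) (t₂ := 0) (.output _)

theorem Machine.Runs.ite_neg {M₁ M₂ : Machine} {T T' : Tape} {b : ℕ} (h0 : T 0 < 0)
    (h : M₂.Runs T b T') : (M₁.ite M₂).Runs T (b + 1) T' := by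
  obtain ⟨t, ht, h⟩ := h
  refine ⟨t + 1, by omega, .branchNeg rfl h0 ?_⟩
  exact h.embed (M' := M₁.ite M₂) (Option.map fun q => (Fin.natAdd M₁.N q).succ)
    (fun q => (Fin.natAdd M₁.N q).succ) (fun q => rfl)
    (fun q => by simp [Machine.ite, Fin.cons_succ]) (t₂ := 0) (.output _)

/-- Repetition as long as the coordinate `0` is nonnegative. -/
def Machine.loop (M : Machine) : Machine where
  N := M.N + 1
  node := Fin.cons
    (.branch (M.start.elim (some 0) fun q => some q.succ) none)
    (fun q => (M.node q).map fun r => r.elim (some 0) fun q => some q.succ)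
  start := some 0

theorem Machine.Runs.loop_neg {M : Machine} {T : Tape} (h0 : T 0 < 0) : M.loop.Runs T 1 T :=
  ⟨1, le_rfl, .branchNeg rfl h0 (.output _)⟩

theorem Machine.Runs.loop_pos {M : Machine} {T T' T'' : Tape} {b₁ b₂ : ℕ} (h0 : 0 ≤ T 0)
    (h₁ : M.Runs T b₁ T') (h₂ : M.loop.Runs T' b₂ T'') :
    M.loop.Runs T (b₁ + b₂ + 1) T'' := by
  obtain ⟨t₁, ht₁, h₁⟩ := h₁
  obtain ⟨t₂, ht₂, h₂⟩ := h₂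
  refine ⟨t₁ + t₂ + 1, by omega, .branchPos rfl h0 ?_⟩
  exact h₁.embed (M' := M.loop)
    (fun r => r.elim (some (0 : Fin (M.N + 1))) fun q => some q.succ)
    Fin.succ (fun q => rfl) (fun q => by simp [Machine.loop, Fin.cons_succ]) h₂

/-- The machine with a single computation node without division. -/
def Machine.comp (U : Finset ℤ) (num : ℤ → MvPolynomial ℤ ℝ) : Machine where
  N := 1
  node _ := .computation U num (fun _ => 1) none
  start := some 0

theorem Machine.runs_comp (U : Finset ℤ) (num : ℤ → MvPolynomial ℤ ℝ) (T : Tape) :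
    (Machine.comp U num).Runs T 1 (rationalMap U num (fun _ => 1) T) :=
  ⟨1, le_rfl, .computation rfl (fun _ _ => by simp) (.output _)⟩

/-! ### Tapes that hold a list -/

/-- The tape with `z` in coordinate `0` and the entries of `l` in the coordinates `1, 2, …`. -/
def tp (z : ℝ) (l : List ℝ) : Tape :=
  Finsupp.onFinset (Finset.Icc 0 (l.length : ℤ))
    (fun i => if i = 0 then z else if 1 ≤ i then l.getD (i - 1).toNat 0 else 0)
    (by
      intro i hi
      rw [Finset.mem_Icc]
      by_cases h0 : i = 0
      · omega
      · rw [if_neg h0] at hi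
        by_cases h : 1 ≤ i
        · rw [if_pos h] at hi
          by_contra hc
          exact hi (List.getD_eq_default _ _ (by omega))
        · simp [h] at hi)

theorem tp_apply (z : ℝ) (l : List ℝ) (i : ℤ) :
    tp z l i = if i = 0 then z else if 1 ≤ i then l.getD (i - 1).toNat 0 else 0 := rfl

@[simp] theorem tp_zero (z : ℝ) (l : List ℝ) : tp z l 0 = z := rfl

@[simp] theorem tp_succ (z : ℝ) (l : List ℝ) (i : ℕ) : tp z l ((i : ℤ) + 1) = l.getD i 0 := by
  rw [tp_apply, if_neg (by omega), if_pos (by omega)]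
  simp

theorem inputTape_eq_tp {n : ℕ} (x : Fin n → ℝ) : inputTape x = tp n (List.ofFn x) := by
  ext i
  rw [tp_apply]
  change (if i = 0 then (n : ℝ) else if h : 1 ≤ i ∧ i ≤ (n : ℤ) then
    x ⟨(i - 1).toNat, by omega⟩ else 0) = _
  by_cases h0 : i = 0
  · simp [h0]
  rw [if_neg h0, if_neg h0]
  by_cases h1 : 1 ≤ i
  · rw [if_pos h1]
    by_cases h2 : i ≤ n
    · rw [dif_pos ⟨h1, h2⟩, List.getD_eq_getElem _ _ (by simp; omega)]
      simp
    · rw [dif_neg (by tauto), List.getD_eq_default _ _ (by simp; omega)]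
  · rw [if_neg h1, dif_neg (by tauto)]

/-- The machine that rewrites a tape holding a list of length at most `L` to a tape
holding the values of the polynomials `ps`. -/
def Machine.rewrite (L : ℕ) (z : MvPolynomial ℤ ℝ) (ps : List (MvPolynomial ℤ ℝ)) : Machine :=
  .comp (Finset.Icc 0 ((L + ps.length : ℕ) : ℤ))
    (fun i => if i = 0 then z else ps.getD (i - 1).toNat 0)

theorem Machine.runs_rewrite (L : ℕ) (z : MvPolynomial ℤ ℝ) (ps : List (MvPolynomial ℤ ℝ))
    (y : ℝ) (l : List ℝ) (hl : l.length ≤ L) :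
    (Machine.rewrite L z ps).Runs (tp y l) 1
      (tp (MvPolynomial.eval (tp y l) z) (ps.map (MvPolynomial.eval (tp y l)))) := by
  have key : tp (MvPolynomial.eval (tp y l) z) (ps.map (MvPolynomial.eval (tp y l))) =
      rationalMap (Finset.Icc 0 ((L + ps.length : ℕ) : ℤ))
        (fun i => if i = 0 then z else ps.getD (i - 1).toNat 0) (fun _ => 1) (tp y l) := by
    ext i
    rw [rationalMap_apply, tp_apply]
    simp only [map_one, div_one]
    by_cases h0 : i = 0
    · subst h0
      simp only [if_true]
      rw [if_pos (Finset.mem_Icc.2 ⟨le_rfl, by omega⟩)]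
    rw [if_neg h0]
    by_cases h1 : 1 ≤ i
    · rw [if_pos h1, if_neg h0]
      by_cases h2 : i ≤ ((L + ps.length : ℕ) : ℤ)
      · rw [if_pos (Finset.mem_Icc.2 ⟨by omega, h2⟩), ← List.getD_map (MvPolynomial.eval (tp y l)) (l := ps) (d := 0), map_zero]
      · rw [if_neg (by simp; omega), List.getD_eq_default _ _ (by simp; omega), tp_apply, if_neg h0,
          if_pos h1, List.getD_eq_default _ _ (by omega)]
    · rw [if_neg h1, if_neg (by simp; omega), tp_apply, if_neg h0, if_neg h1]
  rw [key]
  exact Machine.runs_comp _ _ _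

/-- The machine whose node overwrites the coordinates `1, …, k` by the values of polynomials, on
arbitrary tapes. -/
theorem Machine.exists_runs_outputs {k : ℕ} (ps : Fin k → MvPolynomial ℤ ℝ) :
    ∃ M : Machine, ∀ T : Tape, ∃ T', M.Runs T 1 T' ∧
      ∀ i : Fin k, T' ((i : ℤ) + 1) = MvPolynomial.eval T (ps i) := by
  refine ⟨.comp (Finset.Icc 1 (k : ℤ))
    (fun i => if h : (i - 1).toNat < k then ps ⟨(i - 1).toNat, h⟩ else 0), fun T =>
    ⟨_, Machine.runs_comp _ _ _, fun i => ?_⟩⟩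
  have := i.2
  rw [rationalMap_apply, if_pos (Finset.mem_Icc.2 ⟨by omega, by omega⟩)]
  simp

/-! ### Transformations of families of tapes -/

section Reach

variable {ι : Type}

/-- The values of a list of functions. -/
def vals (l : List (ι → ℝ)) (x : ι) : List ℝ := l.map fun g => g x

@[simp] theorem vals_append (l l' : List (ι → ℝ)) (x : ι) :
    vals (l ++ l') x = vals l x ++ vals l' x := List.map_append

@[simp] theorem vals_cons (g : ι → ℝ) (l : List (ι → ℝ)) (x : ι) :
    vals (g :: l) x = g x :: vals l x := rfl

@[simp] theorem vals_nil (x : ι) : vals ([] : List (ι → ℝ)) x = [] := rfl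

@[simp] theorem length_vals (l : List (ι → ℝ)) (x : ι) : (vals l x).length = l.length :=
  List.length_map _

/-- The variables assignment given by a list. -/
def listEnv (l : List ℝ) (i : ℕ) : ℝ := l.getD i 0

/-- Some machine transforms the tapes `S x` to the tapes `T x` in time `O(b x + 1)`. -/
def Reach (b : ι → ℕ) (S T : ι → Tape) : Prop :=
  ∃ (M : Machine) (c : ℕ), ∀ x, M.Runs (S x) (c * (b x + 1)) (T x)

/-- Some machine transforms the tapes `S x` in time `O(b x + 1)` to tapes holding the output
`out x`. -/
def ReachOut (b : ι → ℕ) (S : ι → Tape) {k : ℕ} (out : ι → Fin k → ℝ) : Prop :=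
  ∃ (M : Machine) (c : ℕ), ∀ x, ∃ T, M.Runs (S x) (c * (b x + 1)) T ∧
    ∀ i : Fin k, T ((i : ℤ) + 1) = out x i

theorem Reach.trans {b : ι → ℕ} {S T V : ι → Tape} (h₁ : Reach b S T) (h₂ : Reach b T V) :
    Reach b S V := by
  obtain ⟨M₁, c₁, h₁⟩ := h₁
  obtain ⟨M₂, c₂, h₂⟩ := h₂
  exact ⟨M₁.seq M₂, c₁ + c₂, fun x => by rw [add_mul]; exact (h₁ x).seq (h₂ x)⟩

theorem Reach.trans_out {b : ι → ℕ} {S T : ι → Tape} {k : ℕ} {out : ι → Fin k → ℝ}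
    (h₁ : Reach b S T) (h₂ : ReachOut b T out) : ReachOut b S out := by
  obtain ⟨M₁, c₁, h₁⟩ := h₁
  obtain ⟨M₂, c₂, h₂⟩ := h₂
  refine ⟨M₁.seq M₂, c₁ + c₂, fun x => ?_⟩
  obtain ⟨T', hT, ho⟩ := h₂ x
  exact ⟨T', by rw [add_mul]; exact (h₁ x).seq hT, ho⟩

theorem Reach.out {b : ι → ℕ} {S T : ι → Tape} {k : ℕ} {out : ι → Fin k → ℝ}
    (h : Reach b S T) (ho : ∀ x (i : Fin k), T x ((i : ℤ) + 1) = out x i) : ReachOut b S out :=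
  let ⟨M, c, h⟩ := h
  ⟨M, c, fun x => ⟨T x, h x, ho x⟩⟩

theorem Reach.ite {b : ι → ℕ} {S T₁ T₂ : ι → Tape} (h₁ : Reach b S T₁) (h₂ : Reach b S T₂) :
    Reach b S (fun x => if 0 ≤ S x 0 then T₁ x else T₂ x) := by
  obtain ⟨M₁, c₁, h₁⟩ := h₁
  obtain ⟨M₂, c₂, h₂⟩ := h₂
  refine ⟨M₁.ite M₂, c₁ + c₂ + 1, fun x => ?_⟩
  dsimp only
  split_ifs with h
  · exact ((h₁ x).ite_pos h).mono (by nlinarith [Nat.zero_le (c₂ * (b x + 1))])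
  · exact ((h₂ x).ite_neg (not_le.1 h)).mono (by nlinarith [Nat.zero_le (c₁ * (b x + 1))])

theorem ReachOut.ite {b : ι → ℕ} {S : ι → Tape} {k : ℕ} {o₁ o₂ : ι → Fin k → ℝ}
    (h₁ : ReachOut b S o₁) (h₂ : ReachOut b S o₂) :
    ReachOut b S (fun x => if 0 ≤ S x 0 then o₁ x else o₂ x) := by
  obtain ⟨M₁, c₁, h₁⟩ := h₁
  obtain ⟨M₂, c₂, h₂⟩ := h₂
  refine ⟨M₁.ite M₂, c₁ + c₂ + 1, fun x => ?_⟩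
  dsimp only
  split_ifs with h
  · obtain ⟨T, hT, ho⟩ := h₁ x
    exact ⟨T, (hT.ite_pos h).mono (by nlinarith [Nat.zero_le (c₂ * (b x + 1))]), ho⟩
  · obtain ⟨T, hT, ho⟩ := h₂ x
    exact ⟨T, (hT.ite_neg (not_le.1 h)).mono (by nlinarith [Nat.zero_le (c₁ * (b x + 1))]), ho⟩

/-- One computation step that changes the end of the list on the tape and coordinate `0`. -/
theorem Reach.tail (b : ι → ℕ) (pre post post' : List (ι → ℝ)) (y y' : ι → ℝ)
    (z : MvPolynomial ℕ ℝ) (qs : List (MvPolynomial ℕ ℝ))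
    (hz : ∀ x, MvPolynomial.eval (listEnv (vals post x)) z = y' x)
    (hqs : ∀ x, qs.map (MvPolynomial.eval (listEnv (vals post x))) = vals post' x) :
    Reach b (fun x => tp (y x) (vals (pre ++ post) x))
      (fun x => tp (y' x) (vals (pre ++ post') x)) := by
  let ρ : ℕ → ℤ := fun i => ((pre.length + i : ℕ) : ℤ) + 1
  refine ⟨.rewrite (pre ++ post).length (MvPolynomial.rename ρ z)
    ((List.range pre.length).map (fun i : ℕ => MvPolynomial.X ((i : ℤ) + 1)) ++
      qs.map (MvPolynomial.rename ρ)), 1, fun x => ?_⟩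
  have hρ : ∀ q, MvPolynomial.eval (tp (y x) (vals (pre ++ post) x)) (MvPolynomial.rename ρ q) =
      MvPolynomial.eval (listEnv (vals post x)) q := by
    intro q
    rw [MvPolynomial.eval_rename]
    congr 2
    funext i
    simp only [ρ, Function.comp_apply, tp_succ, vals_append, listEnv]
    rw [List.getD_append_right _ _ _ _ (by simp)]
    simp
  have := Machine.runs_rewrite (pre ++ post).length (MvPolynomial.rename ρ z)
    ((List.range pre.length).map (fun i : ℕ => MvPolynomial.X ((i : ℤ) + 1)) ++
      qs.map (MvPolynomial.rename ρ)) (y x) (vals (pre ++ post) x) (by simp)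
  rw [hρ, hz, List.map_append, List.map_map, List.map_map] at this
  refine Machine.Runs.mono ?_ (show 1 ≤ 1 * (b x + 1) by omega)
  convert this using 2
  rw [vals_append]
  congr 1
  · refine List.ext_getElem (by simp) fun i h₁ h₂ => ?_
    have h₃ : i < pre.length := by simpa using h₁
    simp only [List.getElem_map, List.getElem_range, Function.comp_apply, MvPolynomial.eval_X,
      tp_succ, vals_append]
    rw [List.getD_append _ _ _ _ (by simpa using h₃), List.getD_eq_getElem _ _ (by simpa using h₃)]
  · rw [← hqs]
    exact List.map_congr_left fun q _ => (hρ q).symm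

/-- Copies of the variables `X_a, …, X_{a+n-1}`. -/
def copyVars (a n : ℕ) : List (MvPolynomial ℕ ℝ) :=
  (List.range n).map fun i => MvPolynomial.X (a + i)

theorem map_eval_copyVars (l m r : List ℝ) :
    (copyVars l.length m.length).map (MvPolynomial.eval (listEnv (l ++ m ++ r))) = m := by
  refine List.ext_getElem (by simp [copyVars]) fun i h₁ h₂ => ?_
  simp [copyVars, listEnv, List.getElem?_append, h₂]

/-- Moving a block of the list on the tape. -/
theorem Reach.swap (b : ι → ℕ) (pre l m : List (ι → ℝ)) :
    Reach b (fun x => tp 0 (vals (pre ++ (l ++ m)) x)) (fun x => tp 0 (vals (pre ++ (m ++ l)) x)) := by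
  refine Reach.tail b pre (l ++ m) (m ++ l) (fun _ => 0) (fun _ => 0) 0
    (copyVars l.length m.length ++ copyVars 0 l.length) (fun x => by simp) fun x => ?_
  have h₁ := map_eval_copyVars (vals l x) (vals m x) []
  have h₂ := map_eval_copyVars [] (vals l x) (vals m x)
  simp only [length_vals, List.append_nil, List.nil_append, List.length_nil] at h₁ h₂
  rw [List.map_append, vals_append, vals_append, h₁, h₂]

theorem Machine.Runs.loop_iterate {κ : Type} {M : Machine} {S : κ → Tape} {step : κ → κ} {c : ℕ}
    (h : ∀ y, M.Runs (S y) c (S (step y))) (N : ℕ) (y : κ)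
    (hpos : ∀ i < N, 0 ≤ S (step^[i] y) 0) (hneg : S (step^[N] y) 0 < 0) :
    M.loop.Runs (S y) (N * (c + 1) + 1) (S (step^[N] y)) := by
  induction N generalizing y with
  | zero => simpa using Machine.Runs.loop_neg hneg
  | succ N ih =>
    have := Machine.Runs.loop_pos (hpos 0 N.succ_pos) (h y) (ih (step y)
      (fun i hi => hpos (i + 1) (by omega)) hneg)
    exact this.mono (by rw [Nat.succ_mul]; omega)

theorem Reach.loop {κ : Type} {b : ι → ℕ} {S : κ → Tape} {step : κ → κ}
    (h : Reach (fun _ => 0) S (fun y => S (step y))) (e : ι → κ) (N : ι → ℕ)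
    (hpos : ∀ x, ∀ i < N x, 0 ≤ S (step^[i] (e x)) 0) (hneg : ∀ x, S (step^[N x] (e x)) 0 < 0)
    (c : ℕ) (hN : ∀ x, N x ≤ c * (b x + 1)) :
    Reach b (fun x => S (e x)) (fun x => S (step^[N x] (e x))) := by
  obtain ⟨M, d, h⟩ := h
  refine ⟨M.loop, c * (d + 1) + 1, fun x => ?_⟩
  refine (Machine.Runs.loop_iterate (c := d) (fun y => (h y).mono (by simp)) (N x) (e x) (hpos x)
    (hneg x)).mono ?_
  calc N x * (d + 1) + 1 ≤ c * (b x + 1) * (d + 1) + 1 * (b x + 1) := by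
        gcongr
        · exact hN x
        · omega
    _ = _ := by ring

end Reach

/-! ### Functions computable on lists of registers -/

section Cmp

variable {ι : Type} {base : List (ι → ℝ)} {b : ι → ℕ}

/-- Some machine appends the value of `g` to a list of registers that starts with the values of
`base`, in time `O(b x + 1)`. -/
def Cmp (base : List (ι → ℝ)) (b : ι → ℕ) (g : ι → ℝ) : Prop :=
  ∀ rest : List (ι → ℝ), Reach b (fun x => tp 0 (vals (base ++ rest) x))
    (fun x => tp 0 (vals (base ++ rest ++ [g]) x))

/-- Some machine computes the output `out x` from a list of registers that starts with the
values of `base`, in time `O(b x + 1)`. -/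
def CmpOut (base : List (ι → ℝ)) (b : ι → ℕ) {k : ℕ} (out : ι → Fin k → ℝ) : Prop :=
  ∀ rest : List (ι → ℝ), ReachOut b (fun x => tp 0 (vals (base ++ rest) x)) out

theorem Cmp.list {gs : List (ι → ℝ)} (h : ∀ g ∈ gs, Cmp base b g) (rest : List (ι → ℝ)) :
    Reach b (fun x => tp 0 (vals (base ++ rest) x))
      (fun x => tp 0 (vals (base ++ rest ++ gs) x)) := by
  induction gs generalizing rest with
  | nil =>
    simpa using Reach.tail b (base ++ rest) [] [] (fun _ => 0) (fun _ => 0) 0 [] (by simp) (by simp)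
  | cons g gs ih =>
    have h₁ := h g (by simp) rest
    have h₂ := ih (fun g' hg' => h g' (by simp [hg'])) (rest ++ [g])
    simp only [List.append_assoc, List.cons_append, List.nil_append] at h₁ h₂ ⊢
    exact h₁.trans h₂

theorem Cmp.congr {g g' : ι → ℝ} (h : Cmp base b g) (e : ∀ x, g x = g' x) : Cmp base b g' := by
  rwa [← funext e]

theorem Cmp.weaken {g : ι → ℝ} (h : Cmp base b g) (l : List (ι → ℝ)) : Cmp (base ++ l) b g := by
  intro rest
  simpa only [List.append_assoc] using h (l ++ rest)

theorem Cmp.poly (gs : List (ι → ℝ)) (h : ∀ g ∈ gs, Cmp base b g) (q : MvPolynomial ℕ ℝ) :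
    Cmp base b (fun x => MvPolynomial.eval (listEnv (vals gs x)) q) := by
  intro rest
  exact (Cmp.list h rest).trans (Reach.tail b (base ++ rest) gs [_] (fun _ => 0) (fun _ => 0) 0 [q]
    (by simp) (by simp))

theorem Cmp.const (r : ℝ) : Cmp base b (fun _ => r) :=
  (Cmp.poly [] (by simp) (MvPolynomial.C r)).congr (by simp)

theorem Cmp.add {g h : ι → ℝ} (hg : Cmp base b g) (hh : Cmp base b h) :
    Cmp base b (fun x => g x + h x) :=
  (Cmp.poly [g, h] (by simp [hg, hh]) (.X 0 + .X 1)).congr (by simp [listEnv])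

theorem Cmp.mul {g h : ι → ℝ} (hg : Cmp base b g) (hh : Cmp base b h) :
    Cmp base b (fun x => g x * h x) :=
  (Cmp.poly [g, h] (by simp [hg, hh]) (.X 0 * .X 1)).congr (by simp [listEnv])

theorem Cmp.sub {g h : ι → ℝ} (hg : Cmp base b g) (hh : Cmp base b h) :
    Cmp base b (fun x => g x - h x) :=
  (Cmp.poly [g, h] (by simp [hg, hh]) (.X 0 - .X 1)).congr (by simp [listEnv])

theorem Cmp.pow {g : ι → ℝ} (hg : Cmp base b g) (k : ℕ) : Cmp base b (fun x => g x ^ k) :=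
  (Cmp.poly [g] (by simp [hg]) (.X 0 ^ k)).congr (by simp [listEnv])

theorem Cmp.sum {α : Type} (s : Finset α) {g : α → ι → ℝ} (hg : ∀ a ∈ s, Cmp base b (g a)) :
    Cmp base b (fun x => ∑ a ∈ s, g a x) := by
  classical
  induction s using Finset.induction_on with
  | empty => simpa using Cmp.const 0
  | insert a s ha ih =>
    refine (Cmp.add (hg a (by simp)) (ih fun c hc => hg c (by simp [hc]))).congr fun x => ?_
    rw [Finset.sum_insert ha]

theorem Cmp.of_mem {g : ι → ℝ} (hg : g ∈ base) : Cmp base b g := by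
  obtain ⟨l, r, rfl⟩ := List.append_of_mem hg
  intro rest
  have h := Reach.tail b l (g :: (r ++ rest)) (g :: (r ++ rest) ++ [g]) (fun _ => 0) (fun _ => 0) 0
    (copyVars 0 (g :: (r ++ rest)).length ++ [.X 0]) (fun x => by simp) (fun x => by
      have h₂ := map_eval_copyVars [] (vals (g :: (r ++ rest)) x) []
      rw [length_vals, List.nil_append, List.append_nil] at h₂
      rw [List.map_append, vals_append]
      rw [List.length_nil] at h₂
      rw [h₂]
      simp [listEnv])
  simpa using h

/-- Intermediate results can be used as additional registers. -/
theorem Cmp.let {g h : ι → ℝ} (hh : Cmp base b h) (hg : Cmp (base ++ [h]) b g) :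
    Cmp base b g := by
  intro rest
  have h₁ := hh rest
  have h₂ := Reach.swap b base rest [h]
  have h₃ := hg rest
  have h₄ := Reach.tail b base ([h] ++ rest ++ [g]) (rest ++ [g]) (fun _ => 0) (fun _ => 0) 0
    (copyVars 1 (rest ++ [g]).length) (fun x => by simp) (fun x => by
      have h₂ := map_eval_copyVars (vals [h] x) (vals (rest ++ [g]) x) []
      simpa only [length_vals, List.append_nil, ← vals_append, List.append_assoc,
        List.length_singleton] using h₂)
  simp only [List.append_assoc] at h₁ h₂ h₃ h₄ ⊢
  exact ((h₁.trans h₂).trans h₃).trans h₄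

theorem Reach.test {g : ι → ℝ} (hg : Cmp base b g) (rest : List (ι → ℝ)) :
    Reach b (fun x => tp 0 (vals (base ++ rest) x)) (fun x => tp (g x) (vals (base ++ rest) x)) := by
  have := (hg rest).trans (Reach.tail b (base ++ rest) [g] [] (fun _ => 0) g (.X 0) []
    (by simp [listEnv]) (by simp))
  simpa only [List.append_nil] using this

theorem Reach.clear (l : List (ι → ℝ)) (y : ι → ℝ) :
    Reach b (fun x => tp (y x) (vals l x)) (fun x => tp 0 (vals l x)) := by
  have := Reach.tail b l [] [] y (fun _ => 0) 0 [] (by simp) (by simp)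
  simpa only [List.append_nil] using this

theorem Cmp.ite {h g₁ g₂ : ι → ℝ} (hh : Cmp base b h) (h₁ : Cmp base b g₁) (h₂ : Cmp base b g₂) :
    Cmp base b (fun x => if 0 ≤ h x then g₁ x else g₂ x) := by
  intro rest
  have := (Reach.test hh rest).trans
    (((Reach.clear _ h).trans (h₁ rest)).ite ((Reach.clear _ h).trans (h₂ rest)))
  convert this using 2 with x
  simp only [tp_zero]
  split_ifs <;> simp [*]

theorem CmpOut.ite {k : ℕ} {h : ι → ℝ} {g₁ g₂ : ι → Fin k → ℝ} (hh : Cmp base b h)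
    (h₁ : CmpOut base b g₁) (h₂ : CmpOut base b g₂) :
    CmpOut base b (fun x => if 0 ≤ h x then g₁ x else g₂ x) := fun rest =>
  (Reach.test hh rest).trans_out
    (((Reach.clear _ h).trans_out (h₁ rest)).ite ((Reach.clear _ h).trans_out (h₂ rest)))

theorem CmpOut.congr {k : ℕ} {g g' : ι → Fin k → ℝ} (h : CmpOut base b g)
    (e : ∀ x, g x = g' x) : CmpOut base b g' := by
  rwa [← funext e]

/-- Outputs with computable components. -/
theorem Cmp.out {k : ℕ} {out : ι → Fin k → ℝ} (h : ∀ i, Cmp base b (fun x => out x i)) :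
    CmpOut base b out := by
  intro rest
  let gs : List (ι → ℝ) := List.ofFn fun i x => out x i
  have h₁ := Cmp.list (b := b) (gs := gs) (fun g hg => by
    obtain ⟨i, rfl⟩ := (List.mem_ofFn' _ _).1 hg
    exact h i) rest
  have h₂ := Reach.tail b [] (base ++ rest ++ gs) gs (fun _ => 0) (fun _ => 0) 0
    (copyVars (base ++ rest).length gs.length) (fun x => by simp) (fun x => by
      have h₂ := map_eval_copyVars (vals (base ++ rest) x) (vals gs x) []
      simpa only [length_vals, List.append_nil, ← vals_append] using h₂)
  refine (h₁.trans h₂).out fun x i => ?_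
  simp [gs, vals]

/-- The machine computes `y x` from `args x`, and `out x` is a polynomial function of `y x`. -/
theorem Cmp.call {k l m : ℕ} {args : ι → Fin k → ℝ} (h : ∀ i, Cmp base b (fun x => args x i))
    {y : ι → Fin l → ℝ} (M : Machine) (c : ℕ)
    (hM : ∀ x, M.ComputesWithin (args x) (y x) (c * (b x + 1)))
    (ps : Fin m → MvPolynomial (Fin l) ℝ) :
    CmpOut base b (fun x i => MvPolynomial.eval (y x) (ps i)) := by
  intro rest
  let gs : List (ι → ℝ) := List.ofFn fun i x => args x i
  have h₁ := Cmp.list (b := b) (gs := gs) (fun g hg => by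
    obtain ⟨i, rfl⟩ := (List.mem_ofFn' _ _).1 hg
    exact h i) rest
  have h₂ := Reach.tail b [] (base ++ rest ++ gs) gs (fun _ => 0) (fun _ => (k : ℝ))
    (MvPolynomial.C (k : ℝ))
    (copyVars (base ++ rest).length gs.length) (fun x => by simp) (fun x => by
      have h₂ := map_eval_copyVars (vals (base ++ rest) x) (vals gs x) []
      simpa only [length_vals, List.append_nil, ← vals_append] using h₂)
  have h₃ : ∀ x, tp k (vals ([] ++ gs) x) = inputTape (args x) := fun x => by
    rw [inputTape_eq_tp, List.nil_append]
    congr 1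
    simp only [gs, vals, List.map_ofFn]
    rfl
  obtain ⟨P, hP⟩ := Machine.exists_runs_outputs
    (fun i => MvPolynomial.rename (fun j : Fin l => ((j : ℤ) + 1)) (ps i))
  refine (h₁.trans h₂).trans_out ⟨M.seq P, c + 1, fun x => ?_⟩
  obtain ⟨t, T, ht, hr, hy⟩ := hM x
  obtain ⟨T', hT', ho⟩ := hP T
  refine ⟨T', ?_, fun i => ?_⟩
  · dsimp only
    rw [h₃]
    exact (Machine.Runs.seq ⟨t, le_rfl, hr⟩ hT').mono (by rw [add_mul]; omega)
  · rw [ho, MvPolynomial.eval_rename]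
    congr 2
    funext j
    exact hy j

/-- The input map provides the registers. -/
theorem CmpOut.computesWithin {k l : ℕ} {inp : ι → Fin k → ℝ} {out : ι → Fin l → ℝ}
    (h : CmpOut (List.ofFn fun i x => inp x i) b out) :
    ∃ (M : Machine) (c : ℕ), ∀ x, M.ComputesWithin (inp x) (out x) (c * (b x + 1)) := by
  obtain ⟨M, c, h⟩ := (Reach.clear (b := b) (List.ofFn fun i x => inp x i)
    (fun _ => (k : ℝ))).trans_out (by simpa only [List.append_nil] using h [])
  refine ⟨M, c + 1, fun x => ?_⟩
  obtain ⟨T, ⟨t, ht, hr⟩, ho⟩ := h x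
  refine ⟨t, T, by rw [add_mul]; omega, ?_, ho⟩
  convert hr
  rw [inputTape_eq_tp]
  congr 1
  simp only [vals, List.map_ofFn]
  rfl

/-! ### Loops -/

theorem Reach.comp {κ : Type} {S T : κ → Tape} (h : Reach (fun _ => 0) S T) (e : ι → κ) :
    Reach b (fun x => S (e x)) (fun x => T (e x)) :=
  let ⟨M, c, h⟩ := h
  ⟨M, c, fun x => (h (e x)).mono (Nat.mul_le_mul_left c (by simp))⟩

/-- The registers of the body of a loop that uses two variables. -/
def loopBase (base : List (ι → ℝ)) : List (ι × ℝ × ℝ → ℝ) :=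
  base.map (fun g y => g y.1) ++ [fun y => y.2.1, fun y => y.2.2]

theorem vals_map_fst (l : List (ι → ℝ)) (y : ι × ℝ × ℝ) :
    vals (l.map fun g (y : ι × ℝ × ℝ) => g y.1) y = vals l y.1 := by
  simp [vals, Function.comp_def]

theorem Cmp.iterate {r₀ s₀ : ι → ℝ} (hr₀ : Cmp base b r₀) (hs₀ : Cmp base b s₀)
    {r s t : ι × ℝ × ℝ → ℝ} (hr : Cmp (loopBase base) (fun _ => 0) r)
    (hs : Cmp (loopBase base) (fun _ => 0) s) (ht : Cmp (loopBase base) (fun _ => 0) t)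
    (N : ι → ℕ) (c : ℕ) (hN : ∀ x, N x ≤ c * (b x + 1))
    (hpos : ∀ x, ∀ i < N x, 0 ≤ t ((fun y => (y.1, r y, s y))^[i] (x, r₀ x, s₀ x)))
    (hneg : ∀ x, t ((fun y => (y.1, r y, s y))^[N x] (x, r₀ x, s₀ x)) < 0) :
    Cmp base b (fun x => ((fun y => (y.1, r y, s y))^[N x] (x, r₀ x, s₀ x)).2.1) := by
  intro rest
  set step : ι × ℝ × ℝ → ι × ℝ × ℝ := fun y => (y.1, r y, s y) with hstep
  let rest' : List (ι × ℝ × ℝ → ℝ) := rest.map fun g y => g y.1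
  let L := loopBase base ++ rest'
  have hL : ∀ y, vals L y = vals base y.1 ++ ([y.2.1, y.2.2] ++ vals rest y.1) := by
    intro y
    simp only [L, loopBase, rest', vals_append, vals_map_fst, List.append_assoc]
    rfl
  have htest := Reach.test ht rest'
  have hbody : Reach (fun _ => 0) (fun y => tp (t y) (vals L y))
      (fun y => tp (t (step y)) (vals L (step y))) := by
    have h₁ := Cmp.list (base := loopBase base) (b := fun _ => 0) (gs := [r, s])
      (by simp [hr, hs]) rest'
    have h₂ := Reach.tail (fun _ => 0) (base.map fun g (y : ι × ℝ × ℝ) => g y.1)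
      ([fun y => y.2.1, fun y => y.2.2] ++ rest' ++ [r, s]) ([r, s] ++ rest')
      (fun _ => 0) (fun _ => 0) 0 (copyVars (2 + rest'.length) 2 ++ copyVars 2 rest'.length)
      (fun y => by simp) (fun y => by
        have h₁ := map_eval_copyVars (vals ([fun y => y.2.1, fun y => y.2.2] ++ rest') y)
          (vals [r, s] y) []
        have h₂ := map_eval_copyVars (vals [fun y => y.2.1, fun y => y.2.2] y)
          (vals rest' y) (vals [r, s] y)
        rw [List.map_append, vals_append]
        simp only [vals_append, length_vals, List.length_append, List.append_nil,
          List.length_cons, List.length_nil, zero_add, Nat.reduceAdd] at h₁ h₂ ⊢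
        rw [h₁, h₂])
    have h₃ : ∀ y, vals ((base.map fun g (y : ι × ℝ × ℝ) => g y.1) ++ ([r, s] ++ rest')) y =
        vals L (step y) := fun y => by
      rw [hL]
      simp only [vals_append, vals_map_fst, rest']
      rfl
    simp only [h₃] at h₂
    have h₄ := htest.comp (b := fun _ => 0) step
    refine (Reach.clear L t).trans (h₁.trans ?_)
    refine Reach.trans ?_ h₄
    simpa only [L, loopBase, List.append_assoc] using h₂
  have hloop := Reach.loop (b := b) (S := fun y => tp (t y) (vals L y)) hbody
    (fun x => (x, r₀ x, s₀ x)) N hpos hneg c hN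
  have h₁ := Cmp.list (base := base) (b := b) (gs := [r₀, s₀]) (by simp [hr₀, hs₀]) rest
  have h₂ := Reach.swap b base rest [r₀, s₀]
  have h₃ : ∀ x, vals (base ++ ([r₀, s₀] ++ rest)) x = vals L (x, r₀ x, s₀ x) := fun x => by
    rw [hL, vals_append, vals_append]
    rfl
  have h₄ := htest.comp (b := b) (fun x => (x, r₀ x, s₀ x))
  have hfst : ∀ n y, (step^[n] y).1 = y.1 := by
    intro n
    induction n with
    | zero => intro y; rfl
    | succ n ih => intro y; rw [Function.iterate_succ_apply, ih]
  let rN : ι → ℝ := fun x => (step^[N x] (x, r₀ x, s₀ x)).2.1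
  let sN : ι → ℝ := fun x => (step^[N x] (x, r₀ x, s₀ x)).2.2
  have h₅ : ∀ x, vals L (step^[N x] (x, r₀ x, s₀ x)) = vals (base ++ ([rN, sN] ++ rest)) x := by
    intro x
    rw [hL, hfst, vals_append, vals_append]
    rfl
  have h₆ := Reach.tail b base ([rN, sN] ++ rest) (rest ++ [rN])
    (fun x => t (step^[N x] (x, r₀ x, s₀ x))) (fun _ => 0) 0
    (copyVars 2 rest.length ++ [.X 0]) (fun x => by simp) (fun x => by
        have h₂ := map_eval_copyVars (vals [rN, sN] x) (vals rest x) []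
        rw [List.map_append, vals_append]
        simp only [vals_append, length_vals, List.append_nil,
          List.length_cons, List.length_nil, zero_add, Nat.reduceAdd] at h₂ ⊢
        rw [h₂]
        simp [listEnv])
  simp only [h₃] at h₂
  simp only [h₅] at hloop
  simp only [List.append_assoc] at h₁ h₂ h₄ h₆ ⊢
  exact (((h₁.trans h₂).trans h₄).trans hloop).trans h₆

/-- The largest natural number at which a test computable in constant time succeeds, if these
numbers form an initial segment. -/
theorem Cmp.search (Q : ι → ℝ → ℝ)
    (hQ : ∀ e : ι × ℝ × ℝ → ℝ, Cmp (loopBase base) (fun _ => 0) e →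
      Cmp (loopBase base) (fun _ => 0) (fun y => Q y.1 (e y)))
    (g : ι → ℕ) (hg : ∀ x (w : ℕ), 0 ≤ Q x w ↔ w ≤ g x)
    (c : ℕ) (hc : ∀ x, g x < 2 ^ (c * (b x + 1))) : Cmp base b (fun x => (g x : ℝ)) := by
  have v1 : Cmp (loopBase base) (fun _ => 0) (fun y => y.2.1) := Cmp.of_mem (by simp [loopBase])
  have v2 : Cmp (loopBase base) (fun _ => 0) (fun y => y.2.2) := Cmp.of_mem (by simp [loopBase])
  let J : ι → ℕ := fun x => Nat.size (g x)
  have hJ : ∀ x, J x ≤ c * (b x + 1) := fun x => Nat.size_le.2 (hc x)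
  have hdouble : ∀ x i, ((fun y : ι × ℝ × ℝ => (y.1, y.2.1 + y.2.1, (0 : ℝ)))^[i] (x, 1, 0)) =
      (x, ((2 ^ i : ℕ) : ℝ), 0) := by
    intro x i
    induction i with
    | zero => simp
    | succ i ih =>
      rw [Function.iterate_succ_apply', ih]
      push_cast
      ring_nf
  have hp : Cmp base b (fun x => ((2 ^ J x : ℕ) : ℝ)) := by
    refine (Cmp.iterate (Cmp.const 1) (Cmp.const 0) (v1.add v1) (Cmp.const 0) (hQ _ v1) J c hJ
      (fun x i hi => ?_) (fun x => ?_)).congr fun x => ?_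
    · rw [hdouble]
      exact (hg _ _).2 (Nat.lt_size.1 hi)
    · rw [hdouble]
      exact not_le.1 (mt (hg x _).1 (Nat.not_le.2 (Nat.lt_size_self _)))
    · rw [hdouble]
  have half : Cmp (loopBase base) (fun _ => 0) (fun y => y.2.2 * (1 / 2)) :=
    v2.mul (Cmp.const _)
  have hrec : ∀ x i, i ≤ J x → ∃ w : ℕ,
      ((fun y : ι × ℝ × ℝ => (y.1, if 0 ≤ Q y.1 (y.2.1 + y.2.2 * (1 / 2)) then
        y.2.1 + y.2.2 * (1 / 2) else y.2.1, y.2.2 * (1 / 2)))^[i] (x, 0, ((2 ^ J x : ℕ) : ℝ))) =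
      (x, (w : ℝ), ((2 ^ (J x - i) : ℕ) : ℝ)) ∧ w ≤ g x ∧ g x < w + 2 ^ (J x - i) := by
    intro x i
    induction i with
    | zero => exact fun _ => ⟨0, by simp, Nat.zero_le _, by simpa using Nat.lt_size_self _⟩
    | succ i ih =>
      intro hi
      obtain ⟨w, hw, h₁, h₂⟩ := ih (by omega)
      have hs : J x - i = (J x - (i + 1)) + 1 := by omega
      have hs' : ((2 ^ (J x - i) : ℕ) : ℝ) * (1 / 2) = ((2 ^ (J x - (i + 1)) : ℕ) : ℝ) := by
        rw [hs]
        push_cast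
        ring
      rw [Function.iterate_succ_apply', hw]
      dsimp only
      rw [hs', ← Nat.cast_add]
      have h2 : 2 ^ (J x - i) = 2 * 2 ^ (J x - (i + 1)) := by rw [hs, pow_succ]; ring
      by_cases h : w + 2 ^ (J x - (i + 1)) ≤ g x
      · exact ⟨_, by rw [if_pos ((hg x _).2 h)], h, by omega⟩
      · exact ⟨_, by rw [if_neg (mt (hg x _).1 h)], h₁, by omega⟩
  refine (Cmp.iterate (Cmp.const 0) hp ((hQ _ (v1.add half)).ite (v1.add half) v1) half
    (v2.sub (Cmp.const (3 / 2))) J c hJ (fun x i hi => ?_) (fun x => ?_)).congr fun x => ?_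
  · obtain ⟨w, hw, -⟩ := hrec x i hi.le
    rw [hw]
    have : (2 : ℕ) ≤ 2 ^ (J x - i) := by
      calc 2 = 2 ^ 1 := rfl
        _ ≤ _ := Nat.pow_le_pow_right (by omega) (by omega)
    have : (2 : ℝ) ≤ ((2 ^ (J x - i) : ℕ) : ℝ) := by exact_mod_cast this
    dsimp only
    linarith
  · obtain ⟨w, hw, -⟩ := hrec x (J x) le_rfl
    rw [hw]
    norm_num
  · obtain ⟨w, hw, h₁, h₂⟩ := hrec x (J x) le_rfl
    rw [hw]
    have : w = g x := by
      rw [Nat.sub_self, pow_zero] at h₂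
      omega
    simp [this]

theorem Cmp.div {g h : ι → ℕ} (hg : Cmp base b (fun x => (g x : ℝ)))
    (hh : Cmp base b (fun x => (h x : ℝ))) (h0 : ∀ x, 0 < h x) (c : ℕ)
    (hc : ∀ x, g x / h x < 2 ^ (c * (b x + 1))) : Cmp base b (fun x => ((g x / h x : ℕ) : ℝ)) := by
  refine Cmp.let hg (Cmp.let (hh.weaken _) (Cmp.search (fun x w => g x - w * h x)
    (fun e he => ?_) _ (fun x w => ?_) c hc))
  · exact (Cmp.of_mem (by simp [loopBase])).sub (he.mul (Cmp.of_mem (by simp [loopBase])))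
  · rw [Nat.le_div_iff_mul_le (h0 x), sub_nonneg]
    exact_mod_cast Iff.rfl

end Cmp

/-! ### Circuits on arbitrary finite types of gates -/

section OfEquiv

variable {n size : ℕ} {V : Type} (e : V ≃ Fin size) (kind : V → GateKind n) (pred : V → List V)
  (rank : V → ℕ) (out : V)

/-- A circuit whose gates are numbered by a bijection. -/
def Circuit.ofEquiv (nodup : ∀ v, (pred v).Nodup)
    (indegree : ∀ v, (kind v).IndegreeOK (pred v).length)
    (hrank : ∀ v, ∀ w ∈ pred v, rank w < rank v)
    (input_unique : ∀ i : Fin n, ∃! v, kind v = GateKind.input i)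
    (hout : ∀ v, kind v = GateKind.output ↔ v = out) : Circuit n where
  size := size
  kind v := kind (e.symm v)
  pred v := (pred (e.symm v)).map e
  pred_nodup v := (nodup _).map e.injective
  indegree v := by rw [List.length_map]; exact indegree _
  acyclic := by
    refine Subrelation.wf (r := InvImage (· < ·) fun v => rank (e.symm v)) ?_
      (InvImage.wf _ wellFounded_lt)
    intro v w h
    obtain ⟨v', hv, rfl⟩ := List.mem_map.1 h
    have := hrank _ _ hv
    simpa [InvImage] using this
  input_unique i := by
    obtain ⟨v, hv, hu⟩ := input_unique i
    refine ⟨e v, by simpa using hv, fun w hw => ?_⟩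
    rw [← hu _ hw, e.apply_symm_apply]
  out := e out
  kind_eq_output v := by rw [hout, e.symm_apply_eq]

variable (nodup : ∀ v, (pred v).Nodup) (indegree : ∀ v, (kind v).IndegreeOK (pred v).length)
    (hrank : ∀ v, ∀ w ∈ pred v, rank w < rank v)
    (input_unique : ∀ i : Fin n, ∃! v, kind v = GateKind.input i)
    (hout : ∀ v, kind v = GateKind.output ↔ v = out)

theorem Circuit.ofEquiv_val (x : Fin n → ℝ) (F : V → ℝ)
    (hF : ∀ v, F v = (kind v).apply x ((pred v).map F)) (v : V) :
    (Circuit.ofEquiv e kind pred rank out nodup indegree hrank input_unique hout).val x (e v) =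
      F v := by
  induction h : rank v using Nat.strong_induction_on generalizing v with
  | _ m ih =>
    subst h
    refine (Circuit.val_eq (Circuit.ofEquiv e kind pred rank out nodup indegree hrank input_unique
      hout) x (e v)).trans ?_
    change (kind (e.symm (e v))).apply x (((pred (e.symm (e v))).map e).map _) = _
    rw [hF, e.symm_apply_apply]
    congr 1
    refine List.map_map.trans (List.map_congr_left fun w hw => ?_)
    exact ih _ (hrank _ _ hw) w rfl

theorem Circuit.ofEquiv_depthLE :
    (Circuit.ofEquiv e kind pred rank out nodup indegree hrank input_unique hout).DepthLE
      (rank out) := by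
  intro l u h
  have key : ∀ l u v, (Circuit.ofEquiv e kind pred rank out nodup indegree hrank input_unique
      hout).Path l u v → l + rank (e.symm u) ≤ rank (e.symm v) := by
    intro l u v h
    induction h with
    | nil v => simp
    | @cons l u w v h _ ih =>
      obtain ⟨v', hv, rfl⟩ := List.mem_map.1 h
      have := hrank _ _ hv
      rw [e.symm_apply_apply]
      omega
  have := key l u _ h
  rw [show (Circuit.ofEquiv e kind pred rank out nodup indegree hrank input_unique hout).out =
    e out from rfl, e.symm_apply_apply] at this
  omega

theorem Circuit.answer_succ (C : Circuit n) (g : Fin C.size) (p : ℕ) :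
    C.answer ((g : ℕ) + 1) (p + 1) = ![((C.kind g).code : ℝ),
      ((C.pred g)[p]?).elim 0 fun w => ((w : ℕ) : ℝ) + 1, (C.kind g).label] := by
  rw [Circuit.answer, dif_pos ⟨by omega, g.2⟩]
  simp only [Nat.add_sub_cancel, Fin.eta]
  cases (C.pred g)[p]? <;> rfl

theorem Circuit.ofEquiv_answer (v : V) (p : ℕ) :
    (Circuit.ofEquiv e kind pred rank out nodup indegree hrank input_unique hout).answer
      ((e v : ℕ) + 1) (p + 1) = ![((kind v).code : ℝ),
        ((pred v)[p]?).elim 0 fun w => ((e w : ℕ) : ℝ) + 1, (kind v).label] := by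
  refine (Circuit.answer_succ (Circuit.ofEquiv e kind pred rank out nodup indegree hrank
    input_unique hout) (e v) p).trans ?_
  change ![((kind (e.symm (e v))).code : ℝ),
    ((((pred (e.symm (e v))).map e)[p]?).elim 0 fun w => ((w : ℕ) : ℝ) + 1),
    (kind (e.symm (e v))).label] = _
  rw [e.symm_apply_apply, List.getElem?_map, Option.elim_map]
  rfl

theorem Circuit.answer_of_lt {C : Circuit n} {v p : ℕ} (h : v = 0 ∨ C.size < v) :
    C.answer v p = 0 := dif_neg (by omega)

end OfEquiv

/-! ### Templates of circuit families -/

/-- The queries `(n, v, p)`, the last component being `p - 1`. -/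
abbrev Query : Type := ℕ+ × ℕ × ℕ

def Query.inp (x : Query) : Fin 3 → ℝ := ![((x.1 : ℕ) : ℝ), (x.2.1 : ℝ), ((x.2.2 + 1 : ℕ) : ℝ)]

def queryBase : List (Query → ℝ) := List.ofFn fun i x => Query.inp x i

/-- The functions computable from a query in time `O(f(n))`. -/
abbrev QCmp (f : ℕ → ℕ) (g : Query → ℝ) : Prop := Cmp queryBase (fun x => f x.1) g

/-- The answers computable from a query in time `O(f(n))`. -/
abbrev QOut (f : ℕ → ℕ) (g : Query → Fin 3 → ℝ) : Prop := CmpOut queryBase (fun x => f x.1) g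

/-- The instructions of a template. The operation of `bin` and `big` is multiplication or
addition. -/
inductive Instr : Type
  | const (c : ℕ+ → (ℕ → ℕ) → ℝ)
  | inp (pos : (n : ℕ+) → (ℕ → ℕ) → Fin n)
  | sign (j : ℕ)
  | bin (m : Bool) (j₁ j₂ : ℕ)
  | big (m : Bool) (k j : ℕ)

/-- Families of functions of an input and an assignment of ranks to variables. -/
abbrev Fam : Type := (n : ℕ+) → (Fin n → ℝ) → (ℕ → ℕ) → ℝ

def opList (m : Bool) (l : List ℝ) : ℝ := if m then l.prod else l.sum

def opKind {n : ℕ} (m : Bool) : GateKind n := if m then .mul else .add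

theorem opKind_apply {n : ℕ} (m : Bool) (x : Fin n → ℝ) (l : List ℝ) :
    (opKind m).apply x l = opList m l := by cases m <;> rfl

/-- Assignments computable from a query. -/
def CmpAssign (f : ℕ → ℕ) (u : ℕ+ → ℕ) (s : Query → ℕ → ℕ) : Prop :=
  (∀ i, QCmp f fun x => (s x i : ℝ)) ∧ ∀ x i, s x i < u x.1

def ConstOk (f : ℕ → ℕ) (u : ℕ+ → ℕ) (c : ℕ+ → (ℕ → ℕ) → ℝ) : Prop :=
  ∀ s, CmpAssign f u s → QOut f fun x => ![2, 0, c x.1 (s x)]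

def PosOk (f : ℕ → ℕ) (u : ℕ+ → ℕ) (pos : (n : ℕ+) → (ℕ → ℕ) → Fin n) : Prop :=
  ∀ s, CmpAssign f u s → QCmp f fun x => ((pos x.1 (s x) : ℕ) : ℝ)

/-- The instruction number `τ` computes `val τ` from the earlier values. -/
def Instr.Ok (f : ℕ → ℕ) (u : ℕ+ → ℕ) (K : ℕ) (val : ℕ → Fam) (τ : ℕ) : Instr → Prop
  | const c => ConstOk f u c ∧ val τ = fun n _ s => c n s
  | inp pos => PosOk f u pos ∧ val τ = fun n x s => x (pos n s)
  | sign j => j < τ ∧ val τ = fun n x s => Real.sign (val j n x s)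
  | bin m j₁ j₂ => j₁ < τ ∧ j₂ < τ ∧ j₁ ≠ j₂ ∧
      val τ = fun n x s => opList m [val j₁ n x s, val j₂ n x s]
  | big m k j => j < τ ∧ k < K ∧ val τ = fun n x s =>
      opList m ((List.range (u n)).map fun i => val j n x (Function.update s k i))

/-- A straight-line program for a constant number of families of functions of an input and of the
ranks of `K` variables. -/
structure Template (f : ℕ → ℕ) (u : ℕ+ → ℕ) (K : ℕ) where
  G : ℕ
  ins : ℕ → Instr
  val : ℕ → Fam
  ok : ∀ τ < G, (ins τ).Ok f u K val τ

section Gates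

variable {n G K u : ℕ}

/-- The gates of the circuit given by a template: the inputs, the output and, for each instruction,
one gate for each assignment. -/
abbrev Gate (n G K u : ℕ) : Type := Fin n ⊕ (Fin 1 ⊕ (Fin G × (Fin K → Fin u)))

def gateEquiv (n G K u : ℕ) : Gate n G K u ≃ Fin (n + (1 + G * u ^ K)) :=
  (Equiv.sumCongr (Equiv.refl _) ((Equiv.sumCongr (Equiv.refl _)
    ((Equiv.prodCongr (Equiv.refl _) finFunctionFinEquiv).trans finProdFinEquiv)).trans
      finSumFinEquiv)).trans finSumFinEquiv

theorem gateEquiv_inl (i : Fin n) : (gateEquiv n G K u (.inl i) : ℕ) = i := rfl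

theorem gateEquiv_out (i : Fin 1) : (gateEquiv n G K u (.inr (.inl i)) : ℕ) = n := by
  simp [gateEquiv]

theorem gateEquiv_node (τ : Fin G) (a : Fin K → Fin u) :
    (gateEquiv n G K u (.inr (.inr (τ, a))) : ℕ) =
      n + (1 + ((finFunctionFinEquiv a : ℕ) + u ^ K * τ)) := by
  simp [gateEquiv]

/-- The extension of a `K`-tuple to an assignment. -/
def extend (a : Fin K → Fin u) (i : ℕ) : ℕ := if h : i < K then a ⟨i, h⟩ else 0

def setVar (a : Fin K → Fin u) (k : ℕ) (i : Fin u) : Fin K → Fin u :=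
  fun l => if (l : ℕ) = k then i else a l

theorem extend_setVar (a : Fin K → Fin u) {k : ℕ} (hk : k < K) (i : Fin u) :
    extend (setVar a k i) = Function.update (extend a) k i := by
  funext l
  by_cases h : l < K
  · by_cases h' : l = k <;> simp [extend, setVar, h, h', hk]
  · have : l ≠ k := by omega
    simp [extend, h, this]

theorem finFunctionFinEquiv_setVar (a : Fin K → Fin u) {k : ℕ} (hk : k < K) (i : Fin u) :
    (finFunctionFinEquiv (setVar a k i) : ℕ) + extend a k * u ^ k =
      (finFunctionFinEquiv a : ℕ) + i * u ^ k := by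
  simp only [finFunctionFinEquiv_apply]
  rw [← Finset.add_sum_erase _ _ (Finset.mem_univ (⟨k, hk⟩ : Fin K)),
    ← Finset.add_sum_erase _ (fun l : Fin K => (a l : ℕ) * u ^ (l : ℕ))
      (Finset.mem_univ (⟨k, hk⟩ : Fin K))]
  have : ∑ x ∈ Finset.univ.erase (⟨k, hk⟩ : Fin K), (setVar a k i x : ℕ) * u ^ (x : ℕ) =
      ∑ x ∈ Finset.univ.erase (⟨k, hk⟩ : Fin K), (a x : ℕ) * u ^ (x : ℕ) := by
    refine Finset.sum_congr rfl fun x hx => ?_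
    have : (x : ℕ) ≠ k := fun h => (Finset.mem_erase.1 hx).1 (Fin.ext h)
    simp [setVar, this]
  rw [this]
  simp only [setVar, extend, hk, if_true, dif_pos]
  ring

end Gates

/-- The number `j` of an instruction before the instruction `τ`. -/
def earlier {G : ℕ} (τ : Fin G) (j : ℕ) : Fin G := ⟨min j τ, (min_le_right _ _).trans_lt τ.2⟩

theorem earlier_val {G : ℕ} {τ : Fin G} {j : ℕ} (h : j < τ) : (earlier τ j : ℕ) = j :=
  min_eq_left h.le

namespace Template

variable {f : ℕ → ℕ} {u : ℕ+ → ℕ} {K : ℕ} (T : Template f u K) (root : Fin T.G)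
  (hu : ∀ n, 0 < u n) (n : ℕ+)

/-- The kind of a gate. -/
def kind : Gate n T.G K (u n) → GateKind n
  | .inl i => .input i
  | .inr (.inl _) => .output
  | .inr (.inr (τ, a)) => match T.ins τ with
    | .const c => .const (c n (extend a))
    | .inp _ => .add
    | .sign _ => .sign
    | .bin m _ _ => opKind m
    | .big m _ _ => opKind m

/-- The predecessors of a gate. -/
def pred : Gate n T.G K (u n) → List (Gate n T.G K (u n))
  | .inl _ => []
  | .inr (.inl _) => [.inr (.inr (root, fun _ => ⟨0, hu n⟩))]
  | .inr (.inr (τ, a)) =>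
    match T.ins τ with
    | .const _ => []
    | .inp pos => [.inl (pos n (extend a))]
    | .sign j => [.inr (.inr (earlier τ j, a))]
    | .bin _ j₁ j₂ => [.inr (.inr (earlier τ j₁, a)), .inr (.inr (earlier τ j₂, a))]
    | .big _ k j => (List.finRange (u n)).map fun i =>
        .inr (.inr (earlier τ j, setVar a k i))

def rank : Gate n T.G K (u n) → ℕ
  | .inl _ => 0
  | .inr (.inl _) => T.G + 1
  | .inr (.inr (τ, _)) => τ + 1

theorem pred_nodup (v : Gate n T.G K (u n)) : (T.pred root hu n v).Nodup := by
  rcases v with i | i | ⟨τ, a⟩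
  · exact List.nodup_nil
  · exact List.nodup_singleton _
  · have hok := T.ok τ τ.2
    have := τ.2
    simp only [pred]
    cases h : T.ins τ with
    | const c => exact List.nodup_nil
    | inp pos => exact List.nodup_singleton _
    | sign j => exact List.nodup_singleton _
    | bin m j₁ j₂ =>
      rw [h] at hok
      obtain ⟨h₁, h₂, h₃, -⟩ := hok
      simp only [List.nodup_cons, List.mem_singleton, Sum.inr.injEq, Prod.mk.injEq, and_true,
        List.not_mem_nil, not_false_eq_true, List.nodup_nil, Fin.ext_iff]
      rwa [earlier_val (by omega), earlier_val (by omega)]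
    | big m k j =>
      rw [h] at hok
      obtain ⟨h₁, h₂, -⟩ := hok
      refine (List.nodup_finRange _).map fun i i' h => ?_
      simp only [Sum.inr.injEq, Prod.mk.injEq, true_and] at h
      simpa [setVar] using congrFun h ⟨k, h₂⟩

theorem indegreeOK (v : Gate n T.G K (u n)) :
    (T.kind n v).IndegreeOK (T.pred root hu n v).length := by
  rcases v with i | i | ⟨τ, a⟩
  · rfl
  · rfl
  · simp only [pred, kind]
    cases h : T.ins τ with
    | bin m j₁ j₂ => cases m <;> trivial
    | big m k j => cases m <;> trivial
    | _ => trivial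

theorem rank_pred (v w : Gate n T.G K (u n)) (hw : w ∈ T.pred root hu n v) :
    T.rank n w < T.rank n v := by
  rcases v with i | i | ⟨τ, a⟩
  · simp [pred] at hw
  · simp only [pred, List.mem_singleton] at hw
    subst hw
    simp [rank]
  · have hok := T.ok τ τ.2
    have := τ.2
    simp only [pred] at hw
    cases h : T.ins τ with
    | const c => simp [h] at hw
    | inp pos =>
      simp only [h, List.mem_singleton] at hw
      subst hw
      simp [rank]
    | sign j =>
      rw [h] at hok
      have := hok.1
      simp only [h, List.mem_singleton] at hw
      subst hw
      simp only [rank]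
      rw [earlier_val (by omega)]
      omega
    | bin m j₁ j₂ =>
      rw [h] at hok
      obtain ⟨h₁, h₂, -⟩ := hok
      simp only [h, List.mem_cons, List.not_mem_nil, or_false] at hw
      rcases hw with rfl | rfl
      all_goals
        simp only [rank]
        rw [earlier_val (by omega)]
        omega
    | big m k j =>
      rw [h] at hok
      have := hok.1
      simp only [h, List.mem_map] at hw
      obtain ⟨i, -, rfl⟩ := hw
      simp only [rank]
      rw [earlier_val (by omega)]
      omega

theorem kind_node_ne (τ : Fin T.G) (a : Fin K → Fin (u n)) :
    T.kind n (.inr (.inr (τ, a))) ≠ .output ∧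
      ∀ i, T.kind n (.inr (.inr (τ, a))) ≠ .input i := by
  simp only [kind]
  cases h : T.ins τ with
  | bin m j₁ j₂ => cases m <;> simp [opKind]
  | big m k j => cases m <;> simp [opKind]
  | _ => simp

theorem input_unique (i : Fin n) : ∃! v, T.kind n v = .input i := by
  refine ⟨.inl i, rfl, fun v hv => ?_⟩
  rcases v with i' | i' | ⟨τ, a⟩
  · simp only [kind, GateKind.input.injEq] at hv
    rw [hv]
  · simp [kind] at hv
  · exact absurd hv ((T.kind_node_ne n τ a).2 i)

theorem kind_output (v : Gate n T.G K (u n)) : T.kind n v = .output ↔ v = .inr (.inl 0) := by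
  rcases v with i' | i' | ⟨τ, a⟩
  · simp [kind]
  · simp [kind, Subsingleton.elim i' 0]
  · simp [(T.kind_node_ne n τ a).1]

/-- The circuit family given by a template. -/
def circuit (n : ℕ+) : Circuit n :=
  .ofEquiv (gateEquiv n T.G K (u n)) (T.kind n) (T.pred root hu n) (T.rank n) (.inr (.inl 0))
    (T.pred_nodup root hu n) (T.indegreeOK root hu n) (T.rank_pred root hu n) (T.input_unique n)
    (T.kind_output n)

theorem circuit_eval (x : Fin n → ℝ) :
    (T.circuit root hu n).eval x = T.val root n x fun _ => 0 := by
  let F : Gate n T.G K (u n) → ℝ := Sum.elim x (Sum.elim (fun _ => T.val root n x fun _ => 0)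
    fun v => T.val v.1 n x (extend v.2))
  refine Circuit.ofEquiv_val _ _ _ _ _ _ _ _ _ _ x F (fun v => ?_) (.inr (.inl 0))
  rcases v with i | i | ⟨τ, a⟩
  · rfl
  · simp only [kind, pred, List.map_cons, List.map_nil, GateKind.apply, List.sum_cons,
      List.sum_nil, add_zero, F, Sum.elim_inr, Sum.elim_inl]
    congr 1
    funext i
    simp [extend]
  · have hok := T.ok τ τ.2
    have := τ.2
    change T.val τ n x (extend a) = _
    simp only [pred, kind]
    cases h : T.ins τ with
    | const c =>
      rw [h] at hok
      rw [hok.2]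
      rfl
    | inp pos =>
      rw [h] at hok
      rw [hok.2]
      simp [GateKind.apply, F]
    | sign j =>
      rw [h] at hok
      obtain ⟨h₁, h₂⟩ := hok
      rw [h₂]
      simp only [GateKind.apply, F, List.map_cons, List.map_nil, List.sum_cons,
        List.sum_nil, add_zero, Sum.elim_inr]
      rw [earlier_val (by omega)]
    | bin m j₁ j₂ =>
      rw [h] at hok
      obtain ⟨h₁, h₂, -, h₃⟩ := hok
      rw [h₃]
      simp only [opKind_apply, F, List.map_cons, List.map_nil, Sum.elim_inr]
      rw [earlier_val (by omega), earlier_val (by omega)]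
    | big m k j =>
      rw [h] at hok
      obtain ⟨h₁, h₂, h₃⟩ := hok
      rw [h₃]
      simp only [opKind_apply, F, List.map_map, Function.comp_def, Sum.elim_inr]
      rw [earlier_val (by omega)]
      congr 1
      simp only [extend_setVar a h₂]
      rw [← List.map_coe_finRange_eq_range, List.map_map]
      rfl

theorem circuit_depthLE : (T.circuit root hu n).DepthLE (T.G + 1) :=
  Circuit.ofEquiv_depthLE _ _ _ _ _ _ _ _ _ _

end Template

section Nat

variable {ι : Type} {base : List (ι → ℝ)} {b : ι → ℕ}

theorem Cmp.ite_le {g h : ι → ℕ} {r s : ι → ℝ} (hg : Cmp base b fun x => (g x : ℝ))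
    (hh : Cmp base b fun x => (h x : ℝ)) (hr : Cmp base b r) (hs : Cmp base b s) :
    Cmp base b (fun x => if g x ≤ h x then r x else s x) :=
  ((hh.sub hg).ite hr hs).congr fun x => by simp only [sub_nonneg, Nat.cast_le]

theorem CmpOut.ite_le {k : ℕ} {g h : ι → ℕ} {r s : ι → Fin k → ℝ}
    (hg : Cmp base b fun x => (g x : ℝ)) (hh : Cmp base b fun x => (h x : ℝ))
    (hr : CmpOut base b r) (hs : CmpOut base b s) :
    CmpOut base b (fun x => if g x ≤ h x then r x else s x) :=
  (CmpOut.ite (hh.sub hg) hr hs).congr fun x => by simp only [sub_nonneg, Nat.cast_le]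

theorem Cmp.natAdd {g h : ι → ℕ} (hg : Cmp base b fun x => (g x : ℝ))
    (hh : Cmp base b fun x => (h x : ℝ)) : Cmp base b fun x => ((g x + h x : ℕ) : ℝ) :=
  (hg.add hh).congr fun x => by push_cast; rfl

theorem Cmp.natMul {g h : ι → ℕ} (hg : Cmp base b fun x => (g x : ℝ))
    (hh : Cmp base b fun x => (h x : ℝ)) : Cmp base b fun x => ((g x * h x : ℕ) : ℝ) :=
  (hg.mul hh).congr fun x => by push_cast; rfl

theorem Cmp.natPow {g : ι → ℕ} (hg : Cmp base b fun x => (g x : ℝ)) (k : ℕ) :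
    Cmp base b fun x => ((g x ^ k : ℕ) : ℝ) :=
  (hg.pow k).congr fun x => by push_cast; rfl

theorem Cmp.natSub {g h : ι → ℕ} (hg : Cmp base b fun x => (g x : ℝ))
    (hh : Cmp base b fun x => (h x : ℝ)) : Cmp base b fun x => ((g x - h x : ℕ) : ℝ) :=
  (Cmp.ite_le hg hh (Cmp.const 0) (hg.sub hh)).congr fun x => by
    split_ifs with h
    · simp [Nat.sub_eq_zero_of_le h]
    · rw [Nat.cast_sub (by omega)]

theorem Cmp.mod {g h : ι → ℕ} (hg : Cmp base b fun x => (g x : ℝ))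
    (hh : Cmp base b fun x => (h x : ℝ)) (h0 : ∀ x, 0 < h x) (c : ℕ)
    (hc : ∀ x, g x / h x < 2 ^ (c * (b x + 1))) : Cmp base b fun x => ((g x % h x : ℕ) : ℝ) :=
  (Cmp.natSub hg (Cmp.natMul hh (Cmp.div hg hh h0 c hc))).congr fun x => by
    rw [← Nat.mod_eq_sub]

end Nat

theorem lt_two_pow_of_log_le {n m : ℕ} (h : Real.log n ≤ m) : n < 2 ^ (2 * (m + 1)) := by
  rcases Nat.eq_zero_or_pos n with rfl | hn
  · positivity
  have h₁ : (n : ℝ) < (4 : ℝ) ^ (m + 1) := by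
    calc (n : ℝ) = Real.exp (Real.log n) := (Real.exp_log (by exact_mod_cast hn)).symm
      _ ≤ Real.exp (m * 1) := Real.exp_le_exp.2 (by simpa using h)
      _ = Real.exp 1 ^ m := Real.exp_nat_mul _ _
      _ ≤ 4 ^ m := by gcongr; linarith [Real.exp_one_lt_d9]
      _ < 4 ^ (m + 1) := pow_lt_pow_right₀ (by norm_num) (by omega)
  rw [pow_mul]
  exact_mod_cast h₁

theorem QCmp.n {f : ℕ → ℕ} : QCmp f fun x => ((x.1 : ℕ) : ℝ) :=
  Cmp.of_mem ((List.mem_ofFn' _ _).2 ⟨0, rfl⟩)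

theorem QCmp.v {f : ℕ → ℕ} : QCmp f fun x => ((x.2.1 : ℕ) : ℝ) :=
  Cmp.of_mem ((List.mem_ofFn' _ _).2 ⟨1, rfl⟩)

theorem QCmp.p {f : ℕ → ℕ} : QCmp f fun x => ((x.2.2 : ℕ) : ℝ) :=
  (Cmp.sub (Cmp.of_mem ((List.mem_ofFn' _ _).2 ⟨2, rfl⟩)) (Cmp.const 1)).congr fun x => by
    simp [Query.inp]

theorem digit_finFunctionFinEquiv {K u : ℕ} (a : Fin K → Fin u) (i : ℕ) :
    (finFunctionFinEquiv a : ℕ) / u ^ i % u = extend a i := by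
  by_cases h : i < K
  · rw [extend, dif_pos h]
    conv_rhs => rw [← finFunctionFinEquiv.symm_apply_apply a]
    rfl
  · rw [extend, dif_neg h]
    rcases Nat.eq_zero_or_pos u with rfl | hu
    · have : K = 0 := by
        by_contra hK
        exact (a ⟨0, by omega⟩).elim0
      subst this
      simp
    rw [Nat.div_eq_of_lt ((finFunctionFinEquiv a).2.trans_le (Nat.pow_le_pow_right hu (by omega))),
      Nat.zero_mod]

namespace Template

variable {f : ℕ → ℕ} {u : ℕ+ → ℕ} {K : ℕ} (T : Template f u K) (root : Fin T.G)
  (hu : ∀ n, 0 < u n)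

/-- The number of the gate in the queries about nodes, `0` for other queries. -/
def nodeNumber (x : Query) : ℕ :=
  if x.2.1 ≤ x.1 + (1 + T.G * u x.1 ^ K) then x.2.1 - (x.1 + 2) else 0

def nodeIndex (x : Query) : ℕ := T.nodeNumber x / u x.1 ^ K

def nodeCode (x : Query) : ℕ := T.nodeNumber x % u x.1 ^ K

def nodeAssign (x : Query) (i : ℕ) : ℕ := T.nodeCode x / u x.1 ^ i % u x.1

/-- The number of the gate of another instruction with the same assignment. -/
def nodeGate (j : ℕ) (x : Query) : ℕ := x.1 + 2 + (T.nodeCode x + u x.1 ^ K * j)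

def opCode (m : Bool) : ℝ := if m then 4 else 3

/-- The answer to a query about a gate of the instruction `τ`. -/
def nodeAnswer (τ : ℕ) (x : Query) : Fin 3 → ℝ :=
  match T.ins τ with
  | .const c => ![2, 0, c x.1 (T.nodeAssign x)]
  | .inp pos => ![3, if x.2.2 ≤ 0 then ((pos x.1 (T.nodeAssign x) : ℕ) : ℝ) + 1 else 0, 0]
  | .sign j => ![5, if x.2.2 ≤ 0 then (T.nodeGate j x : ℝ) else 0, 0]
  | .bin m j₁ j₂ => ![opCode m, if x.2.2 ≤ 0 then (T.nodeGate j₁ x : ℝ) else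
      if x.2.2 ≤ 1 then (T.nodeGate j₂ x : ℝ) else 0, 0]
  | .big m k j => ![opCode m, if x.2.2 + 1 ≤ u x.1 then
      (T.nodeGate j x : ℝ) + x.2.2 * (u x.1 ^ k : ℕ) - T.nodeAssign x k * (u x.1 ^ k : ℕ)
      else 0, 0]

def queryAnswer (x : Query) : Fin 3 → ℝ :=
  if x.2.1 ≤ 0 then 0 else if x.2.1 ≤ x.1 then ![1, 0, x.2.1] else
    if x.2.1 ≤ x.1 + 1 then
      ![6, if x.2.2 ≤ 0 then ((x.1 + 2 + u x.1 ^ K * root : ℕ) : ℝ) else 0, 0]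
    else if x.2.1 ≤ x.1 + (1 + T.G * u x.1 ^ K) then T.nodeAnswer (T.nodeIndex x) x else 0

theorem node_query {n : ℕ+} {p : ℕ} (τ : Fin T.G) (a : Fin K → Fin (u n)) (x : Query)
    (hx : x = (n, n + (1 + ((finFunctionFinEquiv a : ℕ) + u n ^ K * τ)) + 1, p)) :
    T.nodeIndex x = τ ∧ T.nodeCode x = finFunctionFinEquiv a ∧ T.nodeAssign x = extend a := by
  have ha := (finFunctionFinEquiv a).2
  have hs : (finFunctionFinEquiv a : ℕ) + u n ^ K * τ < T.G * u n ^ K := by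
    calc (finFunctionFinEquiv a : ℕ) + u n ^ K * τ < u n ^ K * (τ + 1) := by
          rw [mul_add, mul_one]; omega
      _ ≤ u n ^ K * T.G := Nat.mul_le_mul_left _ τ.2
      _ = _ := mul_comm _ _
  have hN : T.nodeNumber x = (finFunctionFinEquiv a : ℕ) + u n ^ K * τ := by
    subst hx
    dsimp only [nodeNumber]
    rw [if_pos (by omega)]
    omega
  have h₁ : x.1 = n := by rw [hx]
  have h₂ : T.nodeCode x = finFunctionFinEquiv a := by
    rw [nodeCode, hN, h₁, Nat.add_mul_mod_self_left, Nat.mod_eq_of_lt ha]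
  refine ⟨?_, h₂, ?_⟩
  · rw [nodeIndex, hN, h₁, Nat.add_mul_div_left _ _ (by omega), Nat.div_eq_of_lt ha, zero_add]
  · funext i
    rw [nodeAssign, h₂, h₁, digit_finFunctionFinEquiv]

theorem answer_eq (x : Query) :
    (T.circuit root hu x.1).answer x.2.1 (x.2.2 + 1) = T.queryAnswer root x := by
  obtain ⟨n, v, p⟩ := x
  dsimp only
  have hsize : (T.circuit root hu n).size = n + (1 + T.G * u n ^ K) := rfl
  rcases Nat.eq_zero_or_pos v with rfl | hv
  · rw [Circuit.answer_of_lt (Or.inl rfl)]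
    simp [queryAnswer]
  by_cases hv' : n + (1 + T.G * u n ^ K) < v
  · rw [Circuit.answer_of_lt (Or.inr hv')]
    dsimp only [queryAnswer]
    rw [if_neg (by omega), if_neg (by omega), if_neg (by omega), if_neg (by omega)]
  obtain ⟨g, hg⟩ : ∃ g, v = (gateEquiv n T.G K (u n) g : ℕ) + 1 :=
    ⟨(gateEquiv n T.G K (u n)).symm ⟨v - 1, by omega⟩, by rw [Equiv.apply_symm_apply]; simp; omega⟩
  rw [hg, circuit, Circuit.ofEquiv_answer]
  rcases g with i | i | ⟨τ, a⟩
  · rw [gateEquiv_inl] at hg ⊢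
    have := i.2
    dsimp only [queryAnswer]
    rw [if_neg (by omega), if_pos (by omega)]
    simp [kind, pred, GateKind.code, GateKind.label]
  · rw [gateEquiv_out] at hg ⊢
    dsimp only [queryAnswer]
    rw [if_neg (by omega), if_neg (by omega), if_pos (by omega)]
    simp only [kind, pred, GateKind.code, GateKind.label]
    rcases p with _ | p
    · simp [gateEquiv_node]
      ring
    · simp
  · rw [gateEquiv_node] at hg ⊢
    obtain ⟨h₁, h₂, h₃⟩ := T.node_query (p := p) τ a _ rfl
    dsimp only [queryAnswer]
    have hs : (finFunctionFinEquiv a : ℕ) + u n ^ K * τ < T.G * u n ^ K := by omega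
    rw [if_neg (by omega), if_neg (by omega), if_neg (by omega), if_pos (by omega), h₁]
    have hok := T.ok τ τ.2
    simp only [nodeAnswer, kind, pred, h₃, nodeGate, h₂]
    cases h : T.ins τ with
    | const c => simp [GateKind.code, GateKind.label]
    | inp pos =>
      rcases p with _ | p
      · simp [GateKind.code, GateKind.label, gateEquiv_inl]
      · simp [GateKind.code, GateKind.label]
    | sign j =>
      rw [h] at hok
      have e₁ := hok.1
      rcases p with _ | p
      · simp [GateKind.code, GateKind.label, gateEquiv_node, earlier_val e₁]
        ring
      · simp [GateKind.code, GateKind.label]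
    | bin m j₁ j₂ =>
      rw [h] at hok
      obtain ⟨e₁, e₂, -⟩ := hok
      have hcode : (((opKind m : GateKind n).code : ℕ) : ℝ) = opCode m ∧
        (opKind m : GateKind n).label = 0 := by
        cases m <;> simp [opKind, opCode, GateKind.code, GateKind.label]
      rcases p with _ | _ | p
      · simp [hcode, gateEquiv_node, earlier_val e₁]
        ring
      · simp [hcode, gateEquiv_node, earlier_val e₂]
        ring
      · simp [hcode]
    | big m k j =>
      rw [h] at hok
      obtain ⟨e₁, e₂, -⟩ := hok
      have hcode : (((opKind m : GateKind n).code : ℕ) : ℝ) = opCode m ∧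
        (opKind m : GateKind n).label = 0 := by
        cases m <;> simp [opKind, opCode, GateKind.code, GateKind.label]
      simp only [hcode]
      congr 2
      by_cases hp : p < u n
      · rw [if_pos (by omega), List.getElem?_map, List.getElem?_eq_getElem (by simpa using hp)]
        simp only [Option.map_some, Option.elim_some, gateEquiv_node, earlier_val e₁]
        have := finFunctionFinEquiv_setVar a e₂ ⟨p, hp⟩
        have : ((finFunctionFinEquiv (setVar a k ⟨p, hp⟩) : ℕ) : ℝ) + extend a k * (u n ^ k : ℕ) =
          (finFunctionFinEquiv a : ℕ) + p * (u n ^ k : ℕ) := by exact_mod_cast this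
        simp only [List.getElem_finRange, Fin.cast_mk]
        push_cast at this ⊢
        linarith
      · rw [if_neg (by omega), List.getElem?_eq_none (by simpa using hp), Option.elim_none]

theorem cmp_nodeNumber (huc : QCmp f fun x => (u x.1 : ℝ)) :
    QCmp f fun x => (T.nodeNumber x : ℝ) := by
  refine (Cmp.ite_le QCmp.v (Cmp.natAdd QCmp.n (Cmp.natAdd (Cmp.const (1 : ℕ))
    (Cmp.natMul (Cmp.const T.G) (huc.natPow K)))) (Cmp.natSub QCmp.v
    (Cmp.natAdd QCmp.n (Cmp.const (2 : ℕ)))) (Cmp.const (0 : ℕ))).congr fun x => ?_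
  rw [nodeNumber]
  split_ifs <;> rfl

theorem nodeIndex_lt (x : Query) : T.nodeNumber x / u x.1 ^ K < 2 ^ (T.G * (f x.1 + 1)) := by
  calc T.nodeNumber x / u x.1 ^ K ≤ T.G := by
        refine Nat.div_le_of_le_mul ?_
        rw [nodeNumber, mul_comm]
        split_ifs <;> omega
    _ < 2 ^ T.G := Nat.lt_two_pow_self
    _ ≤ 2 ^ (T.G * (f x.1 + 1)) :=
        Nat.pow_le_pow_right (by omega) (Nat.le_mul_of_pos_right _ (by omega))

include hu in
theorem cmp_nodeIndex (huc : QCmp f fun x => (u x.1 : ℝ)) :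
    QCmp f fun x => (T.nodeIndex x : ℝ) :=
  Cmp.div (T.cmp_nodeNumber huc) (huc.natPow K) (fun _ => pow_pos (hu _) _) T.G T.nodeIndex_lt

include hu in
theorem cmp_nodeCode (huc : QCmp f fun x => (u x.1 : ℝ)) :
    QCmp f fun x => (T.nodeCode x : ℝ) :=
  Cmp.mod (T.cmp_nodeNumber huc) (huc.natPow K) (fun _ => pow_pos (hu _) _) T.G T.nodeIndex_lt

include hu in
theorem nodeCode_lt (hlog : ∀ n : ℕ, Real.log (n : ℝ) ≤ (f n : ℝ)) (hun : ∀ n, u n ≤ n)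
    (x : Query) : T.nodeCode x < 2 ^ (2 * K * (f x.1 + 1)) := by
  calc T.nodeCode x < u x.1 ^ K := Nat.mod_lt _ (pow_pos (hu _) _)
    _ ≤ (2 ^ (2 * (f x.1 + 1))) ^ K :=
        Nat.pow_le_pow_left ((hun _).trans (lt_two_pow_of_log_le (hlog _)).le) _
    _ = _ := by rw [← pow_mul]; congr 1; ring

include hu in
theorem cmpAssign (hlog : ∀ n : ℕ, Real.log (n : ℝ) ≤ (f n : ℝ)) (hun : ∀ n, u n ≤ n)
    (huc : QCmp f fun x => (u x.1 : ℝ)) : CmpAssign f u T.nodeAssign := by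
  have hd : ∀ i, QCmp f fun x => ((T.nodeCode x / u x.1 ^ i : ℕ) : ℝ) := fun i =>
    Cmp.div (T.cmp_nodeCode hu huc) (huc.natPow i) (fun x => pow_pos (hu _) _) (2 * K)
      fun x => (Nat.div_le_self _ _).trans_lt (T.nodeCode_lt hu hlog hun x)
  refine ⟨fun i => ?_, fun x i => Nat.mod_lt _ (hu _)⟩
  exact Cmp.mod (hd i) huc (fun x => hu _) (2 * K) fun x => ((Nat.div_le_self _ _).trans
    (Nat.div_le_self _ _)).trans_lt (T.nodeCode_lt hu hlog hun x)

include hu in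
theorem cmp_nodeGate (huc : QCmp f fun x => (u x.1 : ℝ)) (j : ℕ) :
    QCmp f fun x => (T.nodeGate j x : ℝ) :=
  Cmp.natAdd (Cmp.natAdd QCmp.n (Cmp.const (2 : ℕ))) (Cmp.natAdd (T.cmp_nodeCode hu huc)
    (Cmp.natMul (huc.natPow K) (Cmp.const j)))

theorem _root_.RealAC0.QOut.triple {g₀ g₁ g₂ : Query → ℝ} (h₀ : QCmp f g₀) (h₁ : QCmp f g₁)
    (h₂ : QCmp f g₂) : QOut f fun x => ![g₀ x, g₁ x, g₂ x] :=
  Cmp.out fun i => by fin_cases i <;> assumption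

theorem _root_.RealAC0.QOut.zero : QOut f fun _ => 0 :=
  Cmp.out fun _ => Cmp.const 0

include hu in
theorem cmp_nodeAnswer (hlog : ∀ n : ℕ, Real.log (n : ℝ) ≤ (f n : ℝ)) (hun : ∀ n, u n ≤ n)
    (huc : QCmp f fun x => (u x.1 : ℝ)) {τ : ℕ} (hτ : τ < T.G) : QOut f (T.nodeAnswer τ) := by
  have hok := T.ok τ hτ
  have hs := T.cmpAssign hu hlog hun huc
  have hg := T.cmp_nodeGate hu huc
  have h0 : QCmp f fun _ => ((0 : ℕ) : ℝ) := Cmp.const _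
  have h1 : QCmp f fun _ => ((1 : ℕ) : ℝ) := Cmp.const _
  unfold nodeAnswer
  cases h : T.ins τ with
  | const c =>
    rw [h] at hok
    exact hok.1 _ hs
  | inp pos =>
    rw [h] at hok
    exact .triple (Cmp.const _) (Cmp.ite_le QCmp.p h0 ((hok.1 _ hs).add (Cmp.const 1))
      (Cmp.const 0)) (Cmp.const 0)
  | sign j =>
    exact .triple (Cmp.const _) (Cmp.ite_le QCmp.p h0 (hg j) (Cmp.const 0)) (Cmp.const 0)
  | bin m j₁ j₂ =>
    exact .triple (Cmp.const _) (Cmp.ite_le QCmp.p h0 (hg j₁)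
      (Cmp.ite_le QCmp.p h1 (hg j₂) (Cmp.const 0))) (Cmp.const 0)
  | big m k j =>
    exact .triple (Cmp.const _) (Cmp.ite_le (Cmp.natAdd QCmp.p h1) huc
      (((hg j).add (QCmp.p.mul (huc.natPow k))).sub ((hs.1 k).mul (huc.natPow k)))
      (Cmp.const 0)) (Cmp.const 0)

include hu in
theorem cmp_queryAnswer (hlog : ∀ n : ℕ, Real.log (n : ℝ) ≤ (f n : ℝ)) (hun : ∀ n, u n ≤ n)
    (huc : QCmp f fun x => (u x.1 : ℝ)) : QOut f (T.queryAnswer root) := by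
  have h0 : QCmp f fun _ => ((0 : ℕ) : ℝ) := Cmp.const _
  have h1 : QCmp f fun _ => ((1 : ℕ) : ℝ) := Cmp.const _
  have hswitch : ∀ j ≤ T.G, QOut f fun x =>
      if T.nodeIndex x + 1 ≤ j then T.nodeAnswer (T.nodeIndex x) x else 0 := by
    intro j
    induction j with
    | zero => exact fun _ => QOut.zero.congr fun x => by simp
    | succ j ih =>
      intro hj
      refine (CmpOut.ite_le (Cmp.const j) (T.cmp_nodeIndex hu huc) (CmpOut.ite_le
        (T.cmp_nodeIndex hu huc) (Cmp.const j) (T.cmp_nodeAnswer hu hlog hun huc hj) QOut.zero)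
        (ih (by omega))).congr fun x => ?_
      split_ifs <;> first | omega | rfl | skip
      rw [show j = T.nodeIndex x by omega]
  have hG : 0 < T.G := root.pos
  refine (CmpOut.ite_le QCmp.v h0 QOut.zero (CmpOut.ite_le QCmp.v QCmp.n
    (QOut.triple (Cmp.const 1) (Cmp.const 0) QCmp.v) (CmpOut.ite_le QCmp.v (Cmp.natAdd QCmp.n h1)
    (QOut.triple (Cmp.const 6) (Cmp.ite_le QCmp.p h0 (Cmp.natAdd (Cmp.natAdd QCmp.n
      (Cmp.const (2 : ℕ))) (Cmp.natMul (huc.natPow K) (Cmp.const (root : ℕ)))) (Cmp.const 0))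
      (Cmp.const 0)) (CmpOut.ite_le QCmp.v (Cmp.natAdd QCmp.n (Cmp.natAdd h1
    (Cmp.natMul (Cmp.const T.G) (huc.natPow K)))) (hswitch T.G le_rfl) QOut.zero)))).congr
    fun x => ?_
  have hlt : T.nodeIndex x < T.G := by
    have hW : 0 < u x.1 ^ K := pow_pos (hu _) _
    have := Nat.mul_pos hG hW
    rw [nodeIndex, Nat.div_lt_iff_lt_mul hW, nodeNumber]
    split_ifs <;> omega
  rw [queryAnswer, if_pos (show T.nodeIndex x + 1 ≤ T.G from hlt)]

theorem circuit_constructibleIn (hlog : ∀ n : ℕ, Real.log (n : ℝ) ≤ (f n : ℝ))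
    (hun : ∀ n, u n ≤ n) (huc : QCmp f fun x => (u x.1 : ℝ)) :
    CircuitFamily.ConstructibleIn (T.circuit root hu) f := by
  obtain ⟨M, c, h⟩ := (T.cmp_queryAnswer root hu hlog hun huc).computesWithin
  refine ⟨M, c, fun n v p hp => ?_⟩
  have := h (n, v, p - 1)
  rw [← T.answer_eq root hu] at this
  simpa only [Query.inp, Nat.sub_add_cancel hp] using this

theorem circuit_polySize (hun : ∀ n, u n ≤ n) :
    CircuitFamily.PolySize (T.circuit root hu) := by
  refine ⟨.X + (1 + .C T.G * .X ^ K), fun n => ?_⟩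
  change n + (1 + T.G * u n ^ K) ≤ _
  simp only [Polynomial.eval_add, Polynomial.eval_X, Polynomial.eval_one, Polynomial.eval_mul,
    Polynomial.eval_C, Polynomial.eval_pow]
  gcongr
  exact hun n

include hu in
/-- A set is decided by a uniform circuit family if a template computes its characteristic
function. -/
theorem mem_uniformAC0 (hlog : ∀ n : ℕ, Real.log (n : ℝ) ≤ (f n : ℝ))
    (hun : ∀ n, u n ≤ n) (huc : QCmp f fun x => (u x.1 : ℝ)) {S : Set RInf}
    (h₁ : ∀ x ∈ S, T.val root x.1 x.2 (fun _ => 0) = 1)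
    (h₀ : ∀ x ∉ S, T.val root x.1 x.2 (fun _ => 0) = 0) : S ∈ UniformAC0 f := by
  refine ⟨T.circuit root hu, T.circuit_polySize root hu hun, ⟨T.G + 1, T.circuit_depthLE root hu⟩,
    T.circuit_constructibleIn root hu hlog hun huc, fun x => ⟨fun hx => ?_, fun hx => ?_⟩⟩
  · rw [circuit_eval, h₁ x hx]
  · rw [circuit_eval, h₀ x hx]

end Template

/-! ### Families computed by templates -/

variable {f : ℕ → ℕ} {u : ℕ+ → ℕ} {K : ℕ}

theorem Instr.Ok.congr {val val' : ℕ → Fam} {τ : ℕ} {i : Instr} (h : ∀ j ≤ τ, val' j = val j)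
    (hi : i.Ok f u K val τ) : i.Ok f u K val' τ := by
  cases i with
  | const c => exact ⟨hi.1, (h τ le_rfl).trans hi.2⟩
  | inp pos => exact ⟨hi.1, (h τ le_rfl).trans hi.2⟩
  | sign j => exact ⟨hi.1, by rw [h τ le_rfl, h j hi.1.le]; exact hi.2⟩
  | bin m j₁ j₂ =>
    obtain ⟨h₁, h₂, h₃, h₄⟩ := hi
    exact ⟨h₁, h₂, h₃, by rw [h τ le_rfl, h j₁ h₁.le, h j₂ h₂.le]; exact h₄⟩
  | big m k j => exact ⟨hi.1, hi.2.1, by rw [h τ le_rfl, h j hi.1.le]; exact hi.2.2⟩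

namespace Template

def empty : Template f u K := ⟨0, fun _ => .sign 0, fun _ _ _ _ => 0, fun _ h => by omega⟩

/-- A template with one more instruction. -/
def snoc (T : Template f u K) (i : Instr) (F : Fam)
    (h : i.Ok f u K (Function.update T.val T.G F) T.G) : Template f u K where
  G := T.G + 1
  ins := Function.update T.ins T.G i
  val := Function.update T.val T.G F
  ok τ hτ := by
    rcases Nat.lt_succ_iff_lt_or_eq.1 hτ with h' | rfl
    · rw [Function.update_of_ne h'.ne]
      exact (T.ok τ h').congr fun j hj => Function.update_of_ne (by omega) _ _
    · rwa [Function.update_self]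

/-- The template `T'` continues `T`. -/
def Ext (T T' : Template f u K) : Prop := T.G ≤ T'.G ∧ ∀ i < T.G, T'.val i = T.val i

theorem Ext.trans {T₁ T₂ T₃ : Template f u K} (h₁ : T₁.Ext T₂) (h₂ : T₂.Ext T₃) : T₁.Ext T₃ :=
  ⟨h₁.1.trans h₂.1, fun i hi => (h₂.2 i (hi.trans_le h₁.1)).trans (h₁.2 i hi)⟩

theorem ext_snoc (T : Template f u K) (i : Instr) (F : Fam)
    (h : i.Ok f u K (Function.update T.val T.G F) T.G) : T.Ext (T.snoc i F h) :=
  ⟨Nat.le_succ _, fun _ hj => Function.update_of_ne hj.ne _ _⟩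

end Template

/-- Every template can be continued so that a new instruction computes `F`. -/
def TDef (f : ℕ → ℕ) (u : ℕ+ → ℕ) (K : ℕ) (F : Fam) : Prop :=
  ∀ T : Template f u K, ∃ T', T.Ext T' ∧ ∃ j, T.G ≤ j ∧ j < T'.G ∧ T'.val j = F

theorem TDef.of_instr {F : Fam} {T T' : Template f u K} (hT : T.Ext T') (i : Instr)
    (h : i.Ok f u K (Function.update T'.val T'.G F) T'.G) :
    ∃ T', T.Ext T' ∧ ∃ j, T.G ≤ j ∧ j < T'.G ∧ T'.val j = F :=
  ⟨_, hT.trans (T'.ext_snoc i F h), T'.G, hT.1, Nat.lt_succ_self _, Function.update_self _ _ _⟩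

theorem TDef.const {c : ℕ+ → (ℕ → ℕ) → ℝ} (h : ConstOk f u c) :
    TDef f u K fun n _ s => c n s := fun T =>
  TDef.of_instr (T := T) ⟨le_rfl, fun _ _ => rfl⟩ (.const c) ⟨h, Function.update_self _ _ _⟩

theorem TDef.inp {pos : (n : ℕ+) → (ℕ → ℕ) → Fin n} (h : PosOk f u pos) :
    TDef f u K fun n x s => x (pos n s) := fun T =>
  TDef.of_instr (T := T) ⟨le_rfl, fun _ _ => rfl⟩ (.inp pos) ⟨h, Function.update_self _ _ _⟩

theorem TDef.sign {F : Fam} (h : TDef f u K F) :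
    TDef f u K fun n x s => Real.sign (F n x s) := by
  intro T
  obtain ⟨T', hT, j, hj, hj', rfl⟩ := h T
  refine TDef.of_instr hT (.sign j) ⟨hj', ?_⟩
  rw [Function.update_self, Function.update_of_ne hj'.ne]

theorem TDef.bin (m : Bool) {F₁ F₂ : Fam} (h₁ : TDef f u K F₁) (h₂ : TDef f u K F₂) :
    TDef f u K fun n x s => opList m [F₁ n x s, F₂ n x s] := by
  intro T
  obtain ⟨T', hT, j, hj, hj', rfl⟩ := h₁ T
  obtain ⟨T'', hT', i, hi, hi', rfl⟩ := h₂ T'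
  have := hT'.1
  refine TDef.of_instr (hT.trans hT') (.bin m j i) ⟨by omega, hi', by omega, ?_⟩
  rw [Function.update_self, Function.update_of_ne hi'.ne, Function.update_of_ne (by omega),
    hT'.2 j hj']

theorem TDef.big (m : Bool) {k : ℕ} (hk : k < K) {F : Fam} (h : TDef f u K F) :
    TDef f u K fun n x s =>
      opList m ((List.range (u n)).map fun i => F n x (Function.update s k i)) := by
  intro T
  obtain ⟨T', hT, j, hj, hj', rfl⟩ := h T
  refine TDef.of_instr hT (.big m k j) ⟨hj', hk, ?_⟩
  rw [Function.update_self, Function.update_of_ne hj'.ne]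

theorem TDef.congr {F F' : Fam} (h : TDef f u K F) (e : ∀ n x s, F n x s = F' n x s) :
    TDef f u K F' := by
  rwa [← show F = F' from funext fun n => funext fun x => funext fun s => e n x s]

theorem TDef.add {F₁ F₂ : Fam} (h₁ : TDef f u K F₁) (h₂ : TDef f u K F₂) :
    TDef f u K fun n x s => F₁ n x s + F₂ n x s :=
  (TDef.bin false h₁ h₂).congr fun n x s => by simp [opList]

theorem TDef.mul {F₁ F₂ : Fam} (h₁ : TDef f u K F₁) (h₂ : TDef f u K F₂) :
    TDef f u K fun n x s => F₁ n x s * F₂ n x s :=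
  (TDef.bin true h₁ h₂).congr fun n x s => by simp [opList]

theorem TDef.cmp {c : ℕ+ → (ℕ → ℕ) → ℝ}
    (h : ∀ s, CmpAssign f u s → QCmp f fun x => c x.1 (s x)) : TDef f u K fun n _ s => c n s :=
  TDef.const fun s hs => .triple (Cmp.const 2) (Cmp.const 0) (h s hs)

theorem TDef.real (r : ℝ) : TDef f u K fun _ _ _ => r := TDef.cmp fun _ _ => Cmp.const r

theorem TDef.var (i : ℕ) : TDef f u K fun _ _ s => (s i : ℝ) := TDef.cmp fun _ hs => hs.1 i

theorem TDef.sub {F₁ F₂ : Fam} (h₁ : TDef f u K F₁) (h₂ : TDef f u K F₂) :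
    TDef f u K fun n x s => F₁ n x s - F₂ n x s :=
  (h₁.add ((TDef.real (-1)).mul h₂)).congr fun n x s => by ring

open Classical in
/-- The characteristic function of a proposition. -/
def ind (p : Prop) : ℝ := if p then 1 else 0

theorem ind_true {p : Prop} (h : p) : ind p = 1 := if_pos h

theorem ind_false {p : Prop} (h : ¬ p) : ind p = 0 := if_neg h

theorem ind_and (p q : Prop) : ind p * ind q = ind (p ∧ q) := by
  by_cases h : p <;> by_cases h' : q <;> simp [ind, h, h']

theorem ind_not (p : Prop) : 1 - ind p = ind (¬ p) := by
  by_cases h : p <;> simp [ind, h]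

theorem ind_list {α : Type} (l : List α) (p : α → Prop) :
    (l.map fun a => ind (p a)).prod = ind (∀ a ∈ l, p a) := by
  induction l with
  | nil => simp [ind]
  | cons a l ih => rw [List.map_cons, List.prod_cons, ih, ind_and, List.forall_mem_cons]

/-- Families of relations whose characteristic functions are computed by templates. -/
def PDef (f : ℕ → ℕ) (u : ℕ+ → ℕ) (K : ℕ) (R : (n : ℕ+) → (Fin n → ℝ) → (ℕ → ℕ) → Prop) : Prop :=
  TDef f u K fun n x s => ind (R n x s)

variable {R R₁ R₂ : (n : ℕ+) → (Fin n → ℝ) → (ℕ → ℕ) → Prop}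

theorem PDef.congr {R' : (n : ℕ+) → (Fin n → ℝ) → (ℕ → ℕ) → Prop} (h : PDef f u K R)
    (e : ∀ n x s, R n x s ↔ R' n x s) : PDef f u K R' :=
  TDef.congr h fun n x s => by rw [e]

theorem PDef.and (h₁ : PDef f u K R₁) (h₂ : PDef f u K R₂) :
    PDef f u K fun n x s => R₁ n x s ∧ R₂ n x s :=
  (TDef.mul h₁ h₂).congr fun _ _ _ => ind_and _ _

theorem PDef.not (h : PDef f u K R) : PDef f u K fun n x s => ¬ R n x s :=
  ((TDef.real 1).sub h).congr fun _ _ _ => ind_not _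

theorem PDef.or (h₁ : PDef f u K R₁) (h₂ : PDef f u K R₂) :
    PDef f u K fun n x s => R₁ n x s ∨ R₂ n x s :=
  (h₁.not.and h₂.not).not.congr fun n x s => by tauto

theorem PDef.imp (h₁ : PDef f u K R₁) (h₂ : PDef f u K R₂) :
    PDef f u K fun n x s => R₁ n x s → R₂ n x s :=
  (h₁.and h₂.not).not.congr fun n x s => by tauto

theorem PDef.iff (h₁ : PDef f u K R₁) (h₂ : PDef f u K R₂) :
    PDef f u K fun n x s => (R₁ n x s ↔ R₂ n x s) :=
  ((h₁.imp h₂).and (h₂.imp h₁)).congr fun n x s => by tauto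

theorem PDef.all {k : ℕ} (hk : k < K) (h : PDef f u K R) :
    PDef f u K fun n x s => ∀ i < u n, R n x (Function.update s k i) :=
  (TDef.big true hk h).congr fun n x s => by
    simp only [opList, if_true]
    rw [ind_list]
    simp only [List.mem_range]

theorem PDef.ex {k : ℕ} (hk : k < K) (h : PDef f u K R) :
    PDef f u K fun n x s => ∃ i < u n, R n x (Function.update s k i) :=
  (h.not.all hk).not.congr fun _ _ _ => by push Not; rfl

theorem PDef.true : PDef f u K fun _ _ _ => True :=
  (TDef.real 1).congr fun _ _ _ => (ind_true trivial).symm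

theorem PDef.listAll {α : Type} (l : List α)
    {R : α → (n : ℕ+) → (Fin n → ℝ) → (ℕ → ℕ) → Prop} (h : ∀ a ∈ l, PDef f u K (R a)) :
    PDef f u K fun n x s => ∀ a ∈ l, R a n x s := by
  induction l with
  | nil => exact PDef.true.congr fun n x s => by simp
  | cons a l ih =>
    exact ((h a (by simp)).and (ih fun b hb => h b (by simp [hb]))).congr fun n x s => by
      rw [List.forall_mem_cons]

theorem PDef.pos {F : Fam} (h : TDef f u K F) : PDef f u K fun n x s => 0 < F n x s :=
  (h.sign.mul (h.sign.add (TDef.real 1))).sign.congr fun n x s => by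
    rcases lt_trichotomy (F n x s) 0 with h | h | h
    · rw [Real.sign_of_neg h, ind_false (by linarith)]
      norm_num
    · rw [h, ind_false (by linarith)]
      norm_num
    · rw [Real.sign_of_pos h, ind_true h]
      exact Real.sign_of_pos (by norm_num)

theorem PDef.lt {F₁ F₂ : Fam} (h₁ : TDef f u K F₁) (h₂ : TDef f u K F₂) :
    PDef f u K fun n x s => F₁ n x s < F₂ n x s :=
  (PDef.pos (h₂.sub h₁)).congr fun _ _ _ => sub_pos

theorem PDef.eq {F₁ F₂ : Fam} (h₁ : TDef f u K F₁) (h₂ : TDef f u K F₂) :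
    PDef f u K fun n x s => F₁ n x s = F₂ n x s :=
  ((PDef.lt h₁ h₂).or (PDef.lt h₂ h₁)).not.congr fun n x s => by
    rw [lt_or_lt_iff_ne, not_not]

/-- A universally quantified block of variables. -/
theorem PDef.allBlock (r v : ℕ) (hK : v + r ≤ K) (h : PDef f u K R) :
    PDef f u K fun n x s => ∀ t : ℕ → ℕ, (∀ i, v ≤ i → i < v + r → t i < u n) →
      (∀ i, i < v ∨ v + r ≤ i → t i = s i) → R n x t := by
  induction r generalizing v with
  | zero =>
    refine h.congr fun n x s => ⟨fun h t _ ht => ?_, fun h => h s (fun i h₁ h₂ => by omega)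
      fun _ _ => rfl⟩
    rwa [funext fun i => ht i (by omega)]
  | succ r ih =>
    refine ((ih (v + 1) (by omega)).all (show v < K by omega)).congr fun n x s =>
      ⟨fun h t h₁ h₂ => ?_, fun h i hi t h₁ h₂ => ?_⟩
    · refine h (t v) (h₁ v le_rfl (by omega)) t (fun i _ _ => h₁ i (by omega) (by omega))
        fun i hi => ?_
      by_cases hv : i = v
      · rw [hv, Function.update_self]
      · rw [Function.update_of_ne hv]
        exact h₂ i (by omega)
    · refine h t (fun j _ _ => ?_) fun j hj => ?_
      · by_cases hv : j = v
        · rw [h₂ j (by omega), hv, Function.update_self]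
          exact hi
        · exact h₁ j (by omega) (by omega)
      · rw [h₂ j (by omega), Function.update_of_ne (by omega)]

/-- The value of `L` where the variable `v` has the value `H`. -/
def select (u : ℕ+ → ℕ) (v : ℕ) (H L : Fam) : Fam := fun n x s =>
  opList false ((List.range (u n)).map fun i =>
    ind (H n x (Function.update s v i) = (Function.update s v i v : ℕ)) *
      L n x (Function.update s v i))

theorem TDef.select {v : ℕ} (hv : v < K) {H L : Fam} (hH : TDef f u K H) (hL : TDef f u K L) :
    TDef f u K (select u v H L) :=
  TDef.big false hv (TDef.mul (PDef.eq hH (TDef.var v)) hL)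

theorem sum_map_range (n : ℕ) (g : ℕ → ℝ) :
    ((List.range n).map g).sum = ∑ i ∈ Finset.range n, g i := by
  induction n with
  | zero => rfl
  | succ n ih => simp [List.range_succ, Finset.sum_range_succ, ih]

theorem select_eq {v : ℕ} {H L : Fam} {n : ℕ+} {x : Fin n → ℝ} {s : ℕ → ℕ} {a : ℕ}
    (ha : a < u n) (h : ∀ i < u n, H n x (Function.update s v i) = a) :
    select u v H L n x s = L n x (Function.update s v a) := by
  rw [select, opList, if_neg (by simp), sum_map_range]
  rw [Finset.sum_eq_single a]
  · rw [h a ha, Function.update_self, ind_true rfl, one_mul]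
  · intro i hi hia
    rw [h i (Finset.mem_range.1 hi), Function.update_self, ind_false, zero_mul]
    exact_mod_cast hia.symm
  · intro h'
    exact absurd (Finset.mem_range.2 ha) h'

/-- The value of `L` where the variables `v, v + 1, …` have the values `H`. -/
def selectAll (u : ℕ+ → ℕ) : (r v : ℕ) → (Fin r → Fam) → Fam → Fam
  | 0, _, _, L => L
  | r + 1, v, H, L => select u v (H 0) (selectAll u r (v + 1) (Fin.tail H) L)

theorem TDef.selectAll {r v : ℕ} (hv : v + r ≤ K) {H : Fin r → Fam} {L : Fam}
    (hH : ∀ j, TDef f u K (H j)) (hL : TDef f u K L) : TDef f u K (selectAll u r v H L) := by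
  induction r generalizing v with
  | zero => exact hL
  | succ r ih => exact TDef.select (by omega) (hH 0) (ih (by omega) fun j => hH j.succ)

/-- The assignment `s` changed to `a` at the variables `v, v + 1, …`. -/
def setVars (v : ℕ) {r : ℕ} (a : Fin r → ℕ) (s : ℕ → ℕ) (i : ℕ) : ℕ :=
  if h : v ≤ i ∧ i < v + r then a ⟨i - v, by omega⟩ else s i

theorem setVars_apply (v : ℕ) {r : ℕ} (a : Fin r → ℕ) (s : ℕ → ℕ) (j : Fin r) :
    setVars v a s (v + j) = a j := by
  have := j.2
  rw [setVars, dif_pos ⟨by omega, by omega⟩]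
  congr 1
  ext
  simp

theorem selectAll_eq {r v : ℕ} {H : Fin r → Fam} {L : Fam} {n : ℕ+} {x : Fin n → ℝ} {s : ℕ → ℕ}
    {a : Fin r → ℕ} (ha : ∀ j, a j < u n) (hs : ∀ i, s i < u n)
    (h : ∀ j (s' : ℕ → ℕ), (∀ i, s' i < u n) → (∀ i < v, s' i = s i) → H j n x s' = a j) :
    selectAll u r v H L n x s = L n x (setVars v a s) := by
  induction r generalizing v s with
  | zero =>
    rw [selectAll]
    congr 1
    funext i
    rw [setVars, dif_neg (by omega)]
  | succ r ih =>
    have hup : ∀ i < u n, ∀ l, Function.update s v i l < u n := fun i hi l => by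
      by_cases hl : l = v
      · rw [hl, Function.update_self]; exact hi
      · rw [Function.update_of_ne hl]; exact hs l
    rw [selectAll, select_eq (ha 0) fun i hi => h 0 _ (hup i hi) fun l hl =>
      Function.update_of_ne hl.ne _ _, ih (a := Fin.tail a) (fun j => ha _) (hup _ (ha 0))]
    · congr 1
      funext i
      simp only [setVars]
      split_ifs with h₁ h₂ h₂
      · rw [Fin.tail]
        congr 1
        ext
        simp
        omega
      · omega
      · have : i = v := by omega
        subst this
        rw [Function.update_self]
        congr 1
        ext
        simp
      · rw [Function.update_of_ne (by omega)]
    · intro j s' hs' he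
      refine h _ s' hs' fun i hi => ?_
      rw [he i (by omega), Function.update_of_ne (by omega)]

/-! ### Positions in encodings -/

/-- The position of a tuple in the lexicographic order. -/
def lex (w : ℕ) : (k : ℕ) → (Fin k → ℕ) → ℕ
  | 0, _ => 0
  | k + 1, t => t 0 * w ^ k + lex w k (Fin.tail t)

theorem getElem?_flatten {α : Type} (L : List (List α)) (a j : ℕ) (ha : a < L.length)
    (hj : j < L[a].length) :
    L.flatten[((L.map List.length).take a).sum + j]? = L[a][j]? := by
  induction L generalizing a with
  | nil => simp at ha
  | cons l L ih =>
    rcases a with _ | a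
    · have : j < l.length := hj
      simp [List.getElem?_append_left this]
    · have h := ih a (by simpa using ha) (by simpa using hj)
      simp only [List.map_cons, List.take_succ_cons, List.sum_cons, List.flatten_cons,
        List.getElem_cons_succ, add_assoc]
      rw [List.getElem?_append_right (by omega), Nat.add_sub_cancel_left]
      exact h

theorem eq_flatten {α : Type} (L : List (List α)) (xs : List α)
    (hl : xs.length = (L.map List.length).sum)
    (h : ∀ a (ha : a < L.length) j, j < L[a].length →
      xs[((L.map List.length).take a).sum + j]? = L[a][j]?) : xs = L.flatten := by
  induction L generalizing xs with
  | nil => simpa using hl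
  | cons l L ih =>
    have h₀ : xs.take l.length = l := by
      refine List.ext_getElem? fun j => ?_
      by_cases hj : j < l.length
      · rw [List.getElem?_take_of_lt hj]
        have := h 0 (by simp) j hj
        rwa [List.take_zero, List.sum_nil, zero_add, List.getElem_cons_zero] at this
      · rw [List.getElem?_take_eq_none (by omega), List.getElem?_eq_none (by omega)]
    have h₁ : xs.drop l.length = L.flatten := by
      refine ih _ (by simp at hl ⊢; omega) fun a ha j hj => ?_
      have := h (a + 1) (by simpa using ha) j (by simpa using hj)
      simp only [List.map_cons, List.take_succ_cons, List.sum_cons, List.getElem_cons_succ,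
        add_assoc] at this
      rw [List.getElem?_drop, this]
    rw [List.flatten_cons, ← h₁]
    conv_lhs => rw [← List.take_append_drop l.length xs, h₀]

theorem length_tuples (w k : ℕ) : (tuples w k).length = w ^ k := by
  induction k with
  | zero => rfl
  | succ k ih =>
    simp [tuples, List.length_flatMap, ih, pow_succ, mul_comm]

theorem lex_lt {w k : ℕ} (t : Fin k → ℕ) (ht : ∀ j, t j < w) : lex w k t < w ^ k := by
  induction k with
  | zero => simp [lex]
  | succ k ih =>
    have h₁ := ih (Fin.tail t) fun j => ht _
    have h₂ := ht 0
    calc lex w (k + 1) t < t 0 * w ^ k + w ^ k := by rw [lex]; omega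
      _ = (t 0 + 1) * w ^ k := by ring
      _ ≤ w * w ^ k := Nat.mul_le_mul_right _ h₂
      _ = w ^ (k + 1) := by ring

theorem tuples_getElem? {w k : ℕ} (t : Fin k → Fin w) :
    (tuples w k)[lex w k fun j => t j]? = some t := by
  induction k with
  | zero =>
    simp only [tuples, lex, List.getElem?_cons_zero, Option.some.injEq]
    funext i
    exact i.elim0
  | succ k ih =>
    have hL : (((List.finRange w).map fun a => (tuples w k).map fun t =>
        (Fin.cons a t : Fin (k + 1) → Fin w)).map List.length) = List.replicate w (w ^ k) := by
      rw [List.map_map, List.eq_replicate_iff]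
      simp [length_tuples]
    have hlt := lex_lt (fun j => ((Fin.tail t j : Fin w) : ℕ)) fun j => (Fin.tail t j).2
    have h := getElem?_flatten ((List.finRange w).map fun a => (tuples w k).map fun t =>
        (Fin.cons a t : Fin (k + 1) → Fin w)) (t 0) (lex w k fun j => Fin.tail t j) (by simp)
        (by simpa [length_tuples] using hlt)
    rw [hL, List.take_replicate, min_eq_left (t 0).2.le, List.sum_replicate, smul_eq_mul] at h
    rw [tuples, List.flatMap_def, lex]
    refine h.trans ?_
    simp only [List.getElem_map, List.getElem_finRange, List.getElem?_map, ih]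
    simp

theorem exists_lex {w k j : ℕ} (hj : j < w ^ k) : ∃ t : Fin k → Fin w, lex w k (fun i => t i) = j := by
  induction k generalizing j with
  | zero => exact ⟨fun i => i.elim0, by simp at hj; simp [lex, hj]⟩
  | succ k ih =>
    have hw : 0 < w := by
      rcases Nat.eq_zero_or_pos w with rfl | h
      · simp at hj
      · exact h
    have hk : 0 < w ^ k := pow_pos hw _
    obtain ⟨t, ht⟩ := ih (Nat.mod_lt j hk)
    refine ⟨Fin.cons ⟨j / w ^ k, (Nat.div_lt_iff_lt_mul hk).2 (by rwa [pow_succ'] at hj)⟩ t, ?_⟩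
    rw [lex]
    have : (Fin.tail fun i => ((Fin.cons ⟨j / w ^ k, (Nat.div_lt_iff_lt_mul hk).2
      (by rwa [pow_succ'] at hj)⟩ t : Fin (k + 1) → Fin w) i : ℕ)) = fun i => (t i : ℕ) := by
      funext i
      simp [Fin.tail]
    rw [this, ht]
    simp only [Fin.cons_zero]
    exact Nat.div_add_mod' _ _

namespace Signature

variable (σ : Signature)

/-- The arities of the symbols whose values are encoded. -/
def syms : List ℕ := σ.idx ++ σ.num

/-- The position at which the table of the symbol number `a` starts. -/
def off (w a : ℕ) : ℕ := ((σ.syms.take a).map fun k => w ^ max k 1).sum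

/-- The length of the encodings of structures with `w` elements. -/
def encSize (w : ℕ) : ℕ := (σ.syms.map fun k => w ^ max k 1).sum

theorem encSize_mono : Monotone σ.encSize := fun _ _ h =>
  List.sum_le_sum fun _ _ => Nat.pow_le_pow_left h _

theorem encSize_strictMono (h : σ.syms ≠ []) : StrictMono σ.encSize := fun w w' hw =>
  List.sum_lt_sum_of_ne_nil h _ _ fun k _ => Nat.pow_lt_pow_left hw (by omega)

theorem le_encSize (h : σ.syms ≠ []) (w : ℕ) : w ≤ σ.encSize w :=
  (σ.encSize_strictMono h).le_apply

/-- The size of the universe of the structures with encodings of length `n`, if there are any. -/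
def univSize (n : ℕ+) : ℕ := max 1 (Nat.findGreatest (fun w => σ.encSize w ≤ n) n)

theorem univSize_pos (n : ℕ+) : 0 < σ.univSize n := by
  rw [univSize]; omega

theorem univSize_le (n : ℕ+) : σ.univSize n ≤ n :=
  max_le n.2 (Nat.findGreatest_le _)

theorem univSize_eq {n : ℕ+} {w : ℕ} (hw : 0 < w) (h : σ.encSize w = n) : σ.univSize n = w := by
  have hne : σ.syms ≠ [] := by
    intro h'
    rw [encSize, h'] at h
    exact n.ne_zero h.symm
  have : Nat.findGreatest (fun w => σ.encSize w ≤ n) n = w := by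
    have hwn := σ.le_encSize hne w
    rw [Nat.findGreatest_eq_iff]
    refine ⟨by omega, fun _ => h.le, fun m hm _ hle => ?_⟩
    have := (σ.encSize_strictMono hne hm).trans_le hle
    rw [h] at this
    exact this.false
  rw [univSize, this, max_eq_right hw]

theorem cmp_univSize {f : ℕ → ℕ} (hlog : ∀ n : ℕ, Real.log (n : ℝ) ≤ (f n : ℝ)) :
    QCmp f fun x => (σ.univSize x.1 : ℝ) := by
  have hs : QCmp f fun x =>
      ((Nat.findGreatest (fun w => σ.encSize w ≤ x.1) x.1 : ℕ) : ℝ) := by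
    refine Cmp.search (fun x w => if 0 ≤ ((x.1 : ℕ) : ℝ) - w then
      ((x.1 : ℕ) : ℝ) - (σ.syms.map fun k => w ^ max k 1).sum else -1) (fun e he => ?_) _
      (fun x w => ?_) 2 fun x => (Nat.findGreatest_le _).trans_lt (lt_two_pow_of_log_le (hlog _))
    · have hn : Cmp (loopBase queryBase) (fun _ => 0)
          fun y : Query × ℝ × ℝ => ((y.1.1 : ℕ) : ℝ) := Cmp.of_mem <| by
        refine List.mem_append_left _ (List.mem_map.2 ⟨fun x => Query.inp x 0, ?_, rfl⟩)
        exact (List.mem_ofFn' _ _).2 ⟨0, rfl⟩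
      have hp : ∀ l : List ℕ, Cmp (loopBase queryBase) (fun _ => 0)
          fun y : Query × ℝ × ℝ => (l.map fun k => e y ^ max k 1).sum := by
        intro l
        induction l with
        | nil => exact Cmp.const 0
        | cons k l ih => simpa only [List.map_cons, List.sum_cons] using (he.pow _).add ih
      exact (hn.sub he).ite (hn.sub (hp _)) (Cmp.const _)
    · have hcast : (σ.syms.map fun k => (w : ℝ) ^ max k 1).sum = (σ.encSize w : ℝ) := by
        rw [encSize, Nat.cast_list_sum, List.map_map]
        congr 1
        exact List.map_congr_left fun k _ => by simp
      rw [hcast]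
      constructor
      · intro h
        split_ifs at h with hw
        · rw [sub_nonneg, Nat.cast_le] at h hw
          exact Nat.le_findGreatest hw h
        · norm_num at h
      · intro h
        have hle := h.trans (Nat.findGreatest_le (P := fun w => σ.encSize w ≤ x.1) _)
        rw [if_pos (sub_nonneg.2 (Nat.cast_le.2 hle)), sub_nonneg, Nat.cast_le]
        rcases Nat.eq_zero_or_pos w with rfl | hw
        · have : σ.encSize 0 = 0 := by
            rw [encSize, List.sum_eq_zero_iff]
            simp
          omega
        · exact (σ.encSize_mono h).trans (Nat.findGreatest_of_ne_zero (P := fun w =>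
            σ.encSize w ≤ x.1) rfl (by omega))
  have h1 : QCmp f fun _ => ((1 : ℕ) : ℝ) := Cmp.const _
  refine (Cmp.ite_le h1 hs hs h1).congr fun x => ?_
  rw [univSize]
  split_ifs with h
  · rw [max_eq_right h]
  · rw [max_eq_left (by omega)]

end Signature

namespace RStructure

variable {σ : Signature} (D : RStructure σ)

/-- The tables of a structure. -/
def tabs : List (List ℝ) :=
  ((List.finRange σ.idx.length).map fun i =>
    D.table fun a => ((D.rank (D.idxFun i a) : ℕ) : ℝ)) ++
  ((List.finRange σ.num.length).map fun i => D.table (D.numFun i))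

theorem enc_eq : D.enc = D.tabs.flatten := by
  rw [enc, tabs, List.flatten_append, List.flatMap_def, List.flatMap_def]

theorem length_table {k : ℕ} (g : (Fin k → D.A) → ℝ) :
    (D.table g).length = (D.card : ℕ) ^ max k 1 := by
  rw [table, List.length_map, length_tuples]

theorem map_length_tabs :
    D.tabs.map List.length = σ.syms.map fun k => (D.card : ℕ) ^ max k 1 := by
  have h : ∀ l : List ℕ, (List.finRange l.length).map (fun i => (D.card : ℕ) ^ max (l.get i) 1) =
      l.map fun k => (D.card : ℕ) ^ max k 1 := fun l => by
    conv_rhs => rw [← List.map_get_finRange l, List.map_map]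
    rfl
  rw [tabs, Signature.syms, List.map_append, List.map_append, List.map_map, List.map_map,
    ← h, ← h]
  simp only [Function.comp_def, length_table]

theorem length_tabs : D.tabs.length = σ.syms.length := by
  simpa using congrArg List.length D.map_length_tabs

theorem length_enc : D.enc.length = σ.encSize D.card := by
  rw [enc_eq, List.length_flatten, map_length_tabs, Signature.encSize]

theorem off_eq (a : ℕ) : σ.off D.card a = ((D.tabs.map List.length).take a).sum := by
  rw [map_length_tabs, Signature.off, List.map_take]

theorem table_lex {k : ℕ} (g : (Fin k → D.A) → ℝ) (t : Fin (max k 1) → Fin D.card) :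
    (D.table g)[lex D.card _ fun j => t j]? =
      some (g fun j => D.rank.symm (t (Fin.castLE (le_max_left k 1) j))) := by
  rw [table, List.getElem?_map, tuples_getElem?]
  rfl

theorem tabs_idx (i : Fin σ.idx.length) (h : (i : ℕ) < D.tabs.length) :
    D.tabs[(i : ℕ)] = D.table fun a => ((D.rank (D.idxFun i a) : ℕ) : ℝ) := by
  simp only [tabs]
  rw [List.getElem_append_left (by simp), List.getElem_map]
  have key : ∀ i', i' = i → (D.table fun a => ((D.rank (D.idxFun i' a) : ℕ) : ℝ)) =
    D.table fun a => ((D.rank (D.idxFun i a) : ℕ) : ℝ) := by rintro _ rfl; rfl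
  exact key _ (Fin.ext (by simp))

theorem tabs_num (i : Fin σ.num.length) (h : σ.idx.length + i < D.tabs.length) :
    D.tabs[σ.idx.length + (i : ℕ)] = D.table (D.numFun i) := by
  simp only [tabs]
  rw [List.getElem_append_right (by simp), List.getElem_map]
  have key : ∀ i', i' = i → D.table (D.numFun i') = D.table (D.numFun i) := by rintro _ rfl; rfl
  exact key _ (Fin.ext (by simp))

theorem enc_idx (i : Fin σ.idx.length) (t : Fin (max (σ.idx.get i) 1) → Fin D.card) :
    D.enc[σ.off D.card i + lex D.card _ fun j => t j]? =
      some ((D.rank (D.idxFun i fun j => D.rank.symm (t (Fin.castLE (le_max_left _ 1) j))) : ℕ) :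
        ℝ) := by
  have hi : (i : ℕ) < D.tabs.length := by
    rw [length_tabs, Signature.syms, List.length_append]
    omega
  rw [enc_eq, off_eq, getElem?_flatten _ _ _ hi, D.tabs_idx i hi, table_lex]
  rw [D.tabs_idx i hi, length_table]
  exact lex_lt _ fun j => (t j).2

theorem enc_num (i : Fin σ.num.length) (t : Fin (max (σ.num.get i) 1) → Fin D.card) :
    D.enc[σ.off D.card (σ.idx.length + i) + lex D.card _ fun j => t j]? =
      some (D.numFun i fun j => D.rank.symm (t (Fin.castLE (le_max_left _ 1) j))) := by
  have hi : σ.idx.length + (i : ℕ) < D.tabs.length := by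
    rw [length_tabs, Signature.syms, List.length_append]
    omega
  rw [enc_eq, off_eq, getElem?_flatten _ _ _ hi, D.tabs_num i hi, table_lex]
  rw [D.tabs_num i hi, length_table]
  exact lex_lt _ fun j => (t j).2

/-- A list is the encoding of a structure if it has the right entries. -/
theorem enc_eq_of_forall (xs : List ℝ) (hl : xs.length = σ.encSize D.card)
    (h₁ : ∀ (i : Fin σ.idx.length) (t : Fin (max (σ.idx.get i) 1) → Fin D.card),
      xs[σ.off D.card i + lex D.card _ fun j => t j]? =
      some ((D.rank (D.idxFun i fun j => D.rank.symm (t (Fin.castLE (le_max_left _ 1) j))) : ℕ) :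
        ℝ))
    (h₂ : ∀ (i : Fin σ.num.length) (t : Fin (max (σ.num.get i) 1) → Fin D.card),
      xs[σ.off D.card (σ.idx.length + i) + lex D.card _ fun j => t j]? =
      some (D.numFun i fun j => D.rank.symm (t (Fin.castLE (le_max_left _ 1) j)))) :
    D.enc = xs := by
  rw [enc_eq]
  refine (eq_flatten _ _ (by rw [map_length_tabs, hl, Signature.encSize]) fun a ha j hj => ?_).symm
  rw [← off_eq]
  by_cases hai : a < σ.idx.length
  · rw [D.tabs_idx ⟨a, hai⟩ ha] at hj ⊢
    rw [length_table] at hj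
    obtain ⟨t, rfl⟩ := exists_lex hj
    rw [table_lex]
    exact h₁ ⟨a, hai⟩ t
  · obtain ⟨b, rfl⟩ := Nat.exists_eq_add_of_le (not_lt.1 hai)
    have hb : b < σ.num.length := by
      rw [length_tabs, Signature.syms, List.length_append] at ha
      omega
    rw [D.tabs_num ⟨b, hb⟩ ha] at hj ⊢
    rw [length_table] at hj
    obtain ⟨t, rfl⟩ := exists_lex hj
    rw [table_lex]
    exact h₂ ⟨b, hb⟩ t

end RStructure

/-! ### Circuits for formulas -/

/-- The position `p`, or the first position if `p` is too large. -/
def posAt (n : ℕ+) (p : ℕ) : Fin n := if h : p < n then ⟨p, h⟩ else ⟨0, n.pos⟩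

theorem ofFn_getElem? {n : ℕ+} (x : Fin n → ℝ) {p : ℕ} (h : p < n) :
    (List.ofFn x)[p]? = some (x (posAt n p)) := by
  rw [List.getElem?_eq_getElem (by simpa using h)]
  simp [posAt, h]

theorem apply_posAt {n : ℕ+} {x : Fin n → ℝ} {p : ℕ} {r : ℝ} (h : (List.ofFn x)[p]? = some r) :
    x (posAt n p) = r := by
  have hp : p < n := by
    obtain ⟨h', -⟩ := List.getElem?_eq_some_iff.1 h
    simpa using h'
  rw [ofFn_getElem? x hp] at h
  exact Option.some.inj h

theorem posOk_posAt {f : ℕ → ℕ} {u : ℕ+ → ℕ} {p : ℕ+ → (ℕ → ℕ) → ℕ}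
    (h : ∀ s, CmpAssign f u s → QCmp f fun x => (p x.1 (s x) : ℝ)) :
    PosOk f u fun n s => posAt n (p n s) := by
  intro s hs
  refine (Cmp.ite_le (Cmp.natAdd (h s hs) (Cmp.const (1 : ℕ))) QCmp.n (h s hs)
    (Cmp.const (0 : ℕ))).congr fun x => ?_
  by_cases hp : p x.1 (s x) < x.1
  · simp only [posAt]
    rw [dif_pos hp, if_pos (by omega)]
  · simp only [posAt]
    rw [dif_neg hp, if_neg (by omega)]

theorem cmp_lex {f : ℕ → ℕ} {u : ℕ+ → ℕ} (hu : QCmp f fun x => (u x.1 : ℝ)) {k : ℕ}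
    (t : Query → Fin k → ℕ) (ht : ∀ j, QCmp f fun x => (t x j : ℝ)) :
    QCmp f fun x => (lex (u x.1) k (t x) : ℝ) := by
  induction k with
  | zero => exact Cmp.const (0 : ℕ)
  | succ k ih =>
    exact Cmp.natAdd (Cmp.natMul (ht 0) (hu.natPow k)) (ih (fun x => Fin.tail (t x)) fun j => ht _)

theorem Signature.cmp_off {σ : Signature} {f : ℕ → ℕ} {u : ℕ+ → ℕ}
    (hu : QCmp f fun x => (u x.1 : ℝ)) (a : ℕ) : QCmp f fun x => (σ.off (u x.1) a : ℝ) := by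
  unfold Signature.off
  induction σ.syms.take a with
  | nil => exact Cmp.const (0 : ℕ)
  | cons k l ih =>
    simp only [List.map_cons, List.sum_cons]
    exact Cmp.natAdd (hu.natPow _) ih

theorem Signature.cmp_encSize {σ : Signature} {f : ℕ → ℕ} {u : ℕ+ → ℕ}
    (hu : QCmp f fun x => (u x.1 : ℝ)) : QCmp f fun x => (σ.encSize (u x.1) : ℝ) := by
  unfold Signature.encSize
  induction σ.syms with
  | nil => exact Cmp.const (0 : ℕ)
  | cons k l ih =>
    simp only [List.map_cons, List.sum_cons]
    exact Cmp.natAdd (hu.natPow _) ih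

/-- The arguments of an entry of the table of a `k`-ary function. -/
def tableArgs (k : ℕ) (t : Fin k → ℕ) (j : Fin (max k 1)) : ℕ :=
  if h : (j : ℕ) < k then t ⟨j, h⟩ else 0

section Rep

variable {σ : Signature} (I : Interpretation σ) {f : ℕ → ℕ} {K : ℕ}

/-- The position in the encoding of the entry with arguments `t` of the symbol number `a`. -/
def Signature.entry (σ : Signature) (n : ℕ+) (a : ℕ) {k : ℕ} (t : Fin k → ℕ) : Fin n :=
  posAt n (σ.off (σ.univSize n) a + lex (σ.univSize n) k t)

theorem TDef.entry (hlog : ∀ n : ℕ, Real.log (n : ℝ) ≤ (f n : ℝ)) (a : ℕ) {k : ℕ}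
    (t : (ℕ → ℕ) → Fin k → ℕ)
    (ht : ∀ s, CmpAssign f σ.univSize s → ∀ j, QCmp f fun x => (t (s x) j : ℝ)) :
    TDef f σ.univSize K fun n x s => x (σ.entry n a (t s)) :=
  TDef.inp (posOk_posAt fun s hs => Cmp.natAdd (Signature.cmp_off (σ.cmp_univSize hlog) a)
    (cmp_lex (σ.cmp_univSize hlog) _ (ht s hs)))

theorem univSize_eq_card {D : RStructure σ} {n : ℕ+} {x : Fin n → ℝ} (h : D.enc = List.ofFn x) :
    σ.univSize n = D.card := by
  refine σ.univSize_eq D.card.pos ?_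
  rw [← D.length_enc, h, List.length_ofFn]

theorem entry_idx {D : RStructure σ} {n : ℕ+} {x : Fin n → ℝ} (h : D.enc = List.ofFn x)
    (i : Fin σ.idx.length) (t : Fin (max (σ.idx.get i) 1) → Fin D.card) :
    x (σ.entry n i fun j => t j) =
      (D.rank (D.idxFun i fun j => D.rank.symm (t (Fin.castLE (le_max_left _ 1) j))) : ℕ) := by
  have := D.enc_idx i t
  rw [h] at this
  rw [Signature.entry, univSize_eq_card h]
  exact apply_posAt this

theorem entry_num {D : RStructure σ} {n : ℕ+} {x : Fin n → ℝ} (h : D.enc = List.ofFn x)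
    (i : Fin σ.num.length) (t : Fin (max (σ.num.get i) 1) → Fin D.card) :
    x (σ.entry n (σ.idx.length + i) fun j => t j) =
      D.numFun i fun j => D.rank.symm (t (Fin.castLE (le_max_left _ 1) j)) := by
  have := D.enc_num i t
  rw [h] at this
  rw [Signature.entry, univSize_eq_card h]
  exact apply_posAt this

/-- The ranks of the values of an assignment. -/
def RStructure.ranks (D : RStructure σ) (s : ℕ → D.A) (i : ℕ) : ℕ := D.rank (s i)

/-- `F` computes the rank of the value of an index term on encoded structures. -/
def RepIdx {m : ℕ} (h : IdxTerm σ m) (F : Fam) : Prop :=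
  ∀ (n : ℕ+) (x : Fin n → ℝ) (D : RStructure σ), D.enc = List.ofFn x → ∀ s : ℕ → D.A,
    F n x (D.ranks s) = (D.rank (h.eval I D fun i => s i) : ℕ)

def RepNum {m : ℕ} (t : NumTerm σ m) (F : Fam) : Prop :=
  ∀ (n : ℕ+) (x : Fin n → ℝ) (D : RStructure σ), D.enc = List.ofFn x → ∀ s : ℕ → D.A,
    F n x (D.ranks s) = t.eval I D fun i => s i

def RepFormula {m : ℕ} (φ : Formula σ m) (R : (n : ℕ+) → (Fin n → ℝ) → (ℕ → ℕ) → Prop) : Prop :=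
  ∀ (n : ℕ+) (x : Fin n → ℝ) (D : RStructure σ), D.enc = List.ofFn x → ∀ s : ℕ → D.A,
    R n x (D.ranks s) ↔ φ.Holds I D fun i => s i

theorem RepIdx.selectAll {m k : ℕ} {h : Fin k → IdxTerm σ m} {H : Fin k → Fam}
    (hH : ∀ j, RepIdx I (h j) (H j)) (L : Fam) {n : ℕ+} {x : Fin n → ℝ} {D : RStructure σ}
    (hD : D.enc = List.ofFn x) (s : ℕ → D.A) :
    selectAll σ.univSize k m H L n x (D.ranks s) = L n x
      (setVars m (fun j => (D.rank ((h j).eval I D fun i => s i) : ℕ)) (D.ranks s)) := by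
  have hc := univSize_eq_card hD
  refine selectAll_eq (fun j => by rw [hc]; exact (D.rank _).2) (fun i => by
    rw [hc]; exact (D.rank _).2) fun j s' hs' he => ?_
  let s'' : ℕ → D.A := fun i => D.rank.symm ⟨s' i, hc ▸ hs' i⟩
  have h₁ : s' = D.ranks s'' := by
    funext i
    simp [RStructure.ranks, s'']
  have h₂ : ∀ i : Fin m, s'' i = s i := fun i => by
    simp only [s'']
    rw [Equiv.symm_apply_eq]
    exact Fin.ext (he i i.2)
  rw [h₁, hH j n x D hD]
  simp only [h₂]

theorem tableArgs_setVars {D : RStructure σ} {m k : ℕ} (a : Fin k → D.A) (s : ℕ → D.A) :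
    ∃ t : Fin (max k 1) → Fin D.card,
      (tableArgs k fun j => setVars m (fun j => (D.rank (a j) : ℕ)) (D.ranks s) (m + j)) =
        (fun j => (t j : ℕ)) ∧
      (fun j => D.rank.symm (t (Fin.castLE (le_max_left k 1) j))) = a := by
  refine ⟨fun j => if h : (j : ℕ) < k then D.rank (a ⟨j, h⟩) else ⟨0, D.card.pos⟩, ?_, ?_⟩
  · funext j
    simp only [tableArgs]
    split_ifs with h
    · exact setVars_apply m _ _ ⟨j, h⟩
    · rfl
  · funext j
    simp

theorem cmp_tableArgs {u : ℕ+ → ℕ} {s : Query → ℕ → ℕ} (hs : CmpAssign f u s) (m k : ℕ)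
    (j : Fin (max k 1)) : QCmp f fun x => (tableArgs k (fun j => s x (m + j)) j : ℝ) := by
  unfold tableArgs
  split_ifs
  · exact hs.1 _
  · exact Cmp.const (0 : ℕ)

/-- A family of functions, extended to all natural numbers as arguments. -/
def NumFamily.extend {k : ℕ} (F : NumFamily k) (N : ℕ+) (a : Fin k → ℕ) : ℝ :=
  if h : ∀ j, a j < N then F N fun j => ⟨a j, h j⟩ else 0

theorem NumFamily.extend_apply {k : ℕ} (F : NumFamily k) (N : ℕ+) (a : Fin k → Fin N) :
    F.extend N (fun j => a j) = F N a := dif_pos fun j => (a j).2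

theorem TDef.ext (hmono : Monotone f) {u : ℕ+ → ℕ} (hu : ∀ n, 0 < u n) (hun : ∀ n, u n ≤ n)
    (huc : QCmp f fun x => (u x.1 : ℝ)) {k : ℕ} {F : NumFamily k} (hF : F ∈ (FTIME f).num k)
    (m : ℕ) : TDef f u K fun n _ s => F.extend ⟨u n, hu n⟩ fun j => s (m + j) := by
  refine TDef.const fun s hs => ?_
  obtain ⟨M, c, hM⟩ := hF
  refine (Cmp.call (args := fun x => Fin.cons (u x.1 : ℝ) fun j : Fin k => (s x (m + j) : ℝ))
    (y := fun x => ![F ⟨u x.1, hu x.1⟩ fun j => ⟨s x (m + j), hs.2 _ _⟩]) (fun i => ?_) M c (fun x => ?_)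
    ![.C 2, .C 0, .X 0]).congr fun x => ?_
  · refine Fin.cases ?_ (fun j => ?_) i
    · exact huc
    · exact hs.1 _
  · have h := hM ⟨u x.1, hu x.1⟩ fun j => ⟨s x (m + j), hs.2 _ _⟩
    obtain ⟨t, T, ht, h⟩ := h
    exact ⟨t, T, ht.trans (Nat.mul_le_mul_left _ (Nat.succ_le_succ (hmono (hun _)))), h⟩
  · have e := F.extend_apply ⟨u x.1, hu x.1⟩ fun j => ⟨s x (m + j), hs.2 _ _⟩
    dsimp only at e ⊢
    rw [e]
    funext i
    fin_cases i <;> simp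

theorem extend_setVars {D : RStructure σ} {n : ℕ+} {x : Fin n → ℝ} (hD : D.enc = List.ofFn x)
    {m k : ℕ} (F : NumFamily k) (a : Fin k → D.A) (s : ℕ → D.A) :
    (F.extend ⟨σ.univSize n, σ.univSize_pos n⟩ fun j =>
      setVars m (fun j => (D.rank (a j) : ℕ)) (D.ranks s) (m + j)) =
        F D.card fun j => D.rank (a j) := by
  have : (⟨σ.univSize n, σ.univSize_pos n⟩ : ℕ+) = D.card := PNat.eq (univSize_eq_card hD)
  rw [this]
  simp only [setVars_apply]
  exact F.extend_apply D.card fun j => D.rank (a j)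

theorem exists_bound {k : ℕ} {P : Fin k → ℕ → Prop} (h : ∀ j, ∃ K₀, ∀ K ≥ K₀, P j K) :
    ∃ K₀, ∀ K ≥ K₀, ∀ j, P j K := by
  choose g hg using h
  exact ⟨Finset.univ.sup g, fun K hK j => hg j K ((Finset.le_sup (Finset.mem_univ j)).trans hK)⟩

theorem snoc_eq_update {A : Type} (m : ℕ) (s : ℕ → A) (a : A) :
    (Fin.snoc (fun i : Fin m => s i) a : Fin (m + 1) → A) =
      fun i : Fin (m + 1) => Function.update s m a (i : ℕ) := by
  funext i
  refine Fin.lastCases ?_ (fun i => ?_) i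
  · simp
  · have := i.2
    rw [Fin.snoc_castSucc, Function.update_of_ne (by simp; omega)]
    simp

theorem opList_ranks {D : RStructure σ} {n : ℕ+} {x : Fin n → ℝ} (hD : D.enc = List.ofFn x)
    (m : Bool) (F : Fam) (k : ℕ) (s : ℕ → D.A) :
    opList m ((List.range (σ.univSize n)).map fun i => F n x (Function.update (D.ranks s) k i)) =
      opList m ((List.finRange D.card).map fun a =>
        F n x (D.ranks (Function.update s k (D.rank.symm a)))) := by
  rw [univSize_eq_card hD, ← List.map_coe_finRange_eq_range, List.map_map]
  congr 2
  funext a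
  simp only [Function.comp_apply]
  congr 1
  funext i
  by_cases h : i = k
  · simp [h, RStructure.ranks]
  · simp [h, RStructure.ranks]

theorem exists_repFormula_bin {m : ℕ} {φ ψ : Formula σ m}
    (h₁ : ∃ K₀, ∀ K ≥ K₀, ∃ R, PDef f σ.univSize K R ∧ RepFormula I φ R)
    (h₂ : ∃ K₀, ∀ K ≥ K₀, ∃ R, PDef f σ.univSize K R ∧ RepFormula I ψ R) :
    ∃ K₀, ∀ K ≥ K₀, ∃ R₁ R₂, (PDef f σ.univSize K R₁ ∧ RepFormula I φ R₁) ∧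
      PDef f σ.univSize K R₂ ∧ RepFormula I ψ R₂ := by
  obtain ⟨K₁, h₁⟩ := h₁
  obtain ⟨K₂, h₂⟩ := h₂
  refine ⟨max K₁ K₂, fun K hK => ?_⟩
  obtain ⟨R₁, h₁⟩ := h₁ K ((le_max_left _ _).trans hK)
  obtain ⟨R₂, h₂⟩ := h₂ K ((le_max_right _ _).trans hK)
  exact ⟨R₁, R₂, h₁, h₂⟩

theorem ranks_update {D : RStructure σ} (s : ℕ → D.A) (m : ℕ) (a : D.A) :
    D.ranks (Function.update s m a) = Function.update (D.ranks s) m (D.rank a : ℕ) := by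
  funext i
  by_cases h : i = m
  · subst h
    simp [RStructure.ranks]
  · simp [RStructure.ranks, h]

theorem RepFormula.holds_snoc {m : ℕ} {φ : Formula σ (m + 1)}
    {R : (n : ℕ+) → (Fin n → ℝ) → (ℕ → ℕ) → Prop} (hR : RepFormula I φ R) {n : ℕ+}
    {x : Fin n → ℝ} {D : RStructure σ} (hD : D.enc = List.ofFn x) (s : ℕ → D.A) (a : D.A) :
    R n x (Function.update (D.ranks s) m (D.rank a : ℕ)) ↔
      φ.Holds I D (Fin.snoc (fun i : Fin m => s i) a : Fin (m + 1) → D.A) := by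
  rw [← ranks_update, hR n x D hD, snoc_eq_update]

variable (hlog : ∀ n : ℕ, Real.log (n : ℝ) ≤ (f n : ℝ)) (hmono : Monotone f)
  (hidx : ∀ i, I.idx i ∈ (FTIME f).idx (σ.extIdx.get i))
  (hnum : ∀ i, I.num i ∈ (FTIME f).num (σ.extNum.get i))

include hlog hmono hidx

theorem exists_repIdx {m : ℕ} (h : IdxTerm σ m) :
    ∃ K₀, ∀ K ≥ K₀, ∃ F, TDef f σ.univSize K F ∧ RepIdx I h F := by
  induction h with
  | var i => exact ⟨0, fun K _ => ⟨_, TDef.var i, fun n x D _ s => rfl⟩⟩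
  | app i h ih =>
    obtain ⟨K₀, hK₀⟩ := exists_bound ih
    refine ⟨max K₀ (m + σ.idx.get i), fun K hK => ?_⟩
    choose H hH hr using hK₀ K ((le_max_left _ _).trans hK)
    refine ⟨_, TDef.selectAll ((le_max_right _ _).trans hK) hH
      (TDef.entry (σ := σ) hlog i (fun s => tableArgs (σ.idx.get i) fun j => s (m + j))
        fun s hs j => cmp_tableArgs hs _ _ _), fun n x D hD s => ?_⟩
    rw [RepIdx.selectAll I hr _ hD]
    obtain ⟨t, ht, ha⟩ := tableArgs_setVars (m := m) (fun j => (h j).eval I D fun i => s i) s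
    rw [ht, entry_idx hD, ha]
    rfl
  | ext i h ih =>
    obtain ⟨K₀, hK₀⟩ := exists_bound ih
    refine ⟨max K₀ (m + σ.extIdx.get i), fun K hK => ?_⟩
    choose H hH hr using hK₀ K ((le_max_left _ _).trans hK)
    refine ⟨_, TDef.selectAll ((le_max_right _ _).trans hK) hH
      (TDef.ext hmono σ.univSize_pos σ.univSize_le (σ.cmp_univSize hlog)
        (F := fun N a => (I.idx i N a : ℕ)) (hidx i) m), fun n x D hD s => ?_⟩
    rw [RepIdx.selectAll I hr _ hD, extend_setVars hD]
    simp only [IdxTerm.eval, Equiv.apply_symm_apply]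

include hnum in
theorem exists_repNum {m : ℕ} (t : NumTerm σ m) :
    ∃ K₀, ∀ K ≥ K₀, ∃ F, TDef f σ.univSize K F ∧ RepNum I t F := by
  induction t with
  | const c => exact ⟨0, fun K _ => ⟨_, TDef.real c, fun n x D _ s => rfl⟩⟩
  | @app m i h =>
    obtain ⟨K₀, hK₀⟩ := exists_bound fun j => exists_repIdx I hlog hmono hidx (h j)
    refine ⟨max K₀ (m + σ.num.get i), fun K hK => ?_⟩
    choose H hH hr using hK₀ K ((le_max_left _ _).trans hK)
    refine ⟨_, TDef.selectAll ((le_max_right _ _).trans hK) hH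
      (TDef.entry (σ := σ) hlog (σ.idx.length + i)
        (fun s => tableArgs (σ.num.get i) fun j => s (m + j))
        fun s hs j => cmp_tableArgs hs _ _ _), fun n x D hD s => ?_⟩
    rw [RepIdx.selectAll I hr _ hD]
    obtain ⟨t, ht, ha⟩ := tableArgs_setVars (m := m) (fun j => (h j).eval I D fun i => s i) s
    rw [ht, entry_num hD, ha]
    rfl
  | @ext m i h =>
    obtain ⟨K₀, hK₀⟩ := exists_bound fun j => exists_repIdx I hlog hmono hidx (h j)
    refine ⟨max K₀ (m + σ.extNum.get i), fun K hK => ?_⟩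
    choose H hH hr using hK₀ K ((le_max_left _ _).trans hK)
    refine ⟨_, TDef.selectAll ((le_max_right _ _).trans hK) hH
      (TDef.ext hmono σ.univSize_pos σ.univSize_le (σ.cmp_univSize hlog) (hnum i) m),
      fun n x D hD s => ?_⟩
    rw [RepIdx.selectAll I hr _ hD, extend_setVars hD]
    rfl
  | add t₁ t₂ ih₁ ih₂ =>
    obtain ⟨K₁, h₁⟩ := ih₁
    obtain ⟨K₂, h₂⟩ := ih₂
    refine ⟨max K₁ K₂, fun K hK => ?_⟩
    obtain ⟨F₁, hF₁, hr₁⟩ := h₁ K ((le_max_left _ _).trans hK)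
    obtain ⟨F₂, hF₂, hr₂⟩ := h₂ K ((le_max_right _ _).trans hK)
    exact ⟨_, hF₁.add hF₂, fun n x D hD s => by rw [hr₁ n x D hD, hr₂ n x D hD]; rfl⟩
  | mul t₁ t₂ ih₁ ih₂ =>
    obtain ⟨K₁, h₁⟩ := ih₁
    obtain ⟨K₂, h₂⟩ := ih₂
    refine ⟨max K₁ K₂, fun K hK => ?_⟩
    obtain ⟨F₁, hF₁, hr₁⟩ := h₁ K ((le_max_left _ _).trans hK)
    obtain ⟨F₂, hF₂, hr₂⟩ := h₂ K ((le_max_right _ _).trans hK)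
    exact ⟨_, hF₁.mul hF₂, fun n x D hD s => by rw [hr₁ n x D hD, hr₂ n x D hD]; rfl⟩
  | sign t ih =>
    obtain ⟨K₁, h₁⟩ := ih
    refine ⟨K₁, fun K hK => ?_⟩
    obtain ⟨F₁, hF₁, hr₁⟩ := h₁ K hK
    exact ⟨_, hF₁.sign, fun n x D hD s => by rw [hr₁ n x D hD]; rfl⟩
  | @sum m t ih =>
    obtain ⟨K₁, h₁⟩ := ih
    refine ⟨max K₁ (m + 1), fun K hK => ?_⟩
    obtain ⟨F₁, hF₁, hr₁⟩ := h₁ K ((le_max_left _ _).trans hK)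
    refine ⟨_, hF₁.big false ((le_max_right _ _).trans hK), fun n x D hD s => ?_⟩
    rw [opList_ranks hD, NumTerm.eval, Fin.sum_univ_def]
    simp [hr₁ n x D hD, snoc_eq_update, opList]
  | @prod m t ih =>
    obtain ⟨K₁, h₁⟩ := ih
    refine ⟨max K₁ (m + 1), fun K hK => ?_⟩
    obtain ⟨F₁, hF₁, hr₁⟩ := h₁ K ((le_max_left _ _).trans hK)
    refine ⟨_, hF₁.big true ((le_max_right _ _).trans hK), fun n x D hD s => ?_⟩
    rw [opList_ranks hD, NumTerm.eval, Fin.prod_univ_def]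
    simp [hr₁ n x D hD, snoc_eq_update, opList]

include hnum in
theorem exists_repFormula {m : ℕ} (φ : Formula σ m) :
    ∃ K₀, ∀ K ≥ K₀, ∃ R, PDef f σ.univSize K R ∧ RepFormula I φ R := by
  induction φ with
  | idxEq h₁ h₂ =>
    obtain ⟨K₁, hK₁⟩ := exists_repIdx I hlog hmono hidx h₁
    obtain ⟨K₂, hK₂⟩ := exists_repIdx I hlog hmono hidx h₂
    refine ⟨max K₁ K₂, fun K hK => ?_⟩
    obtain ⟨F₁, hF₁, hr₁⟩ := hK₁ K ((le_max_left _ _).trans hK)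
    obtain ⟨F₂, hF₂, hr₂⟩ := hK₂ K ((le_max_right _ _).trans hK)
    refine ⟨_, PDef.eq hF₁ hF₂, fun n x D hD s => ?_⟩
    rw [hr₁ n x D hD, hr₂ n x D hD, Nat.cast_inj, ← Fin.ext_iff, D.rank.apply_eq_iff_eq]
    rfl
  | numEq t₁ t₂ =>
    obtain ⟨K₁, hK₁⟩ := exists_repNum I hlog hmono hidx hnum t₁
    obtain ⟨K₂, hK₂⟩ := exists_repNum I hlog hmono hidx hnum t₂
    refine ⟨max K₁ K₂, fun K hK => ?_⟩
    obtain ⟨F₁, hF₁, hr₁⟩ := hK₁ K ((le_max_left _ _).trans hK)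
    obtain ⟨F₂, hF₂, hr₂⟩ := hK₂ K ((le_max_right _ _).trans hK)
    refine ⟨_, PDef.eq hF₁ hF₂, fun n x D hD s => ?_⟩
    rw [hr₁ n x D hD, hr₂ n x D hD]
    rfl
  | numLt t₁ t₂ =>
    obtain ⟨K₁, hK₁⟩ := exists_repNum I hlog hmono hidx hnum t₁
    obtain ⟨K₂, hK₂⟩ := exists_repNum I hlog hmono hidx hnum t₂
    refine ⟨max K₁ K₂, fun K hK => ?_⟩
    obtain ⟨F₁, hF₁, hr₁⟩ := hK₁ K ((le_max_left _ _).trans hK)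
    obtain ⟨F₂, hF₂, hr₂⟩ := hK₂ K ((le_max_right _ _).trans hK)
    refine ⟨_, PDef.lt hF₁ hF₂, fun n x D hD s => ?_⟩
    rw [hr₁ n x D hD, hr₂ n x D hD]
    rfl
  | and φ ψ ih₁ ih₂ =>
    obtain ⟨K₀, h⟩ := exists_repFormula_bin I ih₁ ih₂
    refine ⟨K₀, fun K hK => ?_⟩
    obtain ⟨R₁, R₂, ⟨d₁, r₁⟩, d₂, r₂⟩ := h K hK
    exact ⟨_, d₁.and d₂, fun n x D hD s => and_congr (r₁ n x D hD s) (r₂ n x D hD s)⟩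
  | or φ ψ ih₁ ih₂ =>
    obtain ⟨K₀, h⟩ := exists_repFormula_bin I ih₁ ih₂
    refine ⟨K₀, fun K hK => ?_⟩
    obtain ⟨R₁, R₂, ⟨d₁, r₁⟩, d₂, r₂⟩ := h K hK
    exact ⟨_, d₁.or d₂, fun n x D hD s => or_congr (r₁ n x D hD s) (r₂ n x D hD s)⟩
  | imp φ ψ ih₁ ih₂ =>
    obtain ⟨K₀, h⟩ := exists_repFormula_bin I ih₁ ih₂
    refine ⟨K₀, fun K hK => ?_⟩
    obtain ⟨R₁, R₂, ⟨d₁, r₁⟩, d₂, r₂⟩ := h K hK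
    exact ⟨_, d₁.imp d₂, fun n x D hD s => imp_congr (r₁ n x D hD s) (r₂ n x D hD s)⟩
  | iff φ ψ ih₁ ih₂ =>
    obtain ⟨K₀, h⟩ := exists_repFormula_bin I ih₁ ih₂
    refine ⟨K₀, fun K hK => ?_⟩
    obtain ⟨R₁, R₂, ⟨d₁, r₁⟩, d₂, r₂⟩ := h K hK
    exact ⟨_, d₁.iff d₂, fun n x D hD s => iff_congr (r₁ n x D hD s) (r₂ n x D hD s)⟩
  | not φ ih =>
    obtain ⟨K₀, h⟩ := ih
    refine ⟨K₀, fun K hK => ?_⟩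
    obtain ⟨R, d, r⟩ := h K hK
    exact ⟨_, d.not, fun n x D hD s => not_congr (r n x D hD s)⟩
  | @ex m φ ih =>
    obtain ⟨K₀, h⟩ := ih
    refine ⟨max K₀ (m + 1), fun K hK => ?_⟩
    obtain ⟨R, d, r⟩ := h K ((le_max_left _ _).trans hK)
    refine ⟨_, d.ex ((le_max_right _ _).trans hK), fun n x D hD s => ?_⟩
    rw [univSize_eq_card hD, Formula.Holds]
    constructor
    · rintro ⟨i, hi, h⟩
      refine ⟨D.rank.symm ⟨i, hi⟩, (r.holds_snoc I hD s _).1 ?_⟩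
      rwa [Equiv.apply_symm_apply]
    · rintro ⟨a, ha⟩
      exact ⟨_, (D.rank a).2, (r.holds_snoc I hD s a).2 ha⟩
  | @all m φ ih =>
    obtain ⟨K₀, h⟩ := ih
    refine ⟨max K₀ (m + 1), fun K hK => ?_⟩
    obtain ⟨R, d, r⟩ := h K ((le_max_left _ _).trans hK)
    refine ⟨_, d.all ((le_max_right _ _).trans hK), fun n x D hD s => ?_⟩
    rw [univSize_eq_card hD, Formula.Holds]
    constructor
    · exact fun h a => (r.holds_snoc I hD s a).1 (h _ (D.rank a).2)
    · intro h i hi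
      have := (r.holds_snoc I hD s _).2 (h (D.rank.symm ⟨i, hi⟩))
      rwa [Equiv.apply_symm_apply] at this

omit hmono hidx

/-- The entries with arguments `t` of the symbol number `a`, of arity `k`, are consistent. -/
def EntryOk (σ : Signature) (isIdx : Prop) (a k : ℕ) (n : ℕ+) (x : Fin n → ℝ)
    (t : Fin (max k 1) → ℕ) : Prop :=
  x (σ.entry n a t) = x (σ.entry n a (tableArgs k fun j => t (Fin.castLE (le_max_left k 1) j))) ∧
    (isIdx → ∃ b < σ.univSize n, x (σ.entry n a t) = b)

/-- The conditions for an input to be the encoding of a structure. -/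
def IsEnc (σ : Signature) (n : ℕ+) (x : Fin n → ℝ) : Prop :=
  σ.encSize (σ.univSize n) = n ∧
  (∀ (i : Fin σ.idx.length) (t : Fin (max (σ.idx.get i) 1) → Fin (σ.univSize n)),
    EntryOk σ True i (σ.idx.get i) n x fun j => t j) ∧
  (∀ (i : Fin σ.num.length) (t : Fin (max (σ.num.get i) 1) → Fin (σ.univSize n)),
    EntryOk σ False (σ.idx.length + i) (σ.num.get i) n x fun j => t j)

theorem pdef_entryOk (isIdx : Prop) (a k : ℕ) (hK : max k 1 + 1 ≤ K) :
    PDef f σ.univSize K fun n x _ => ∀ t : Fin (max k 1) → Fin (σ.univSize n),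
      EntryOk σ isIdx a k n x fun j => t j := by
  have d₁ : TDef f σ.univSize K fun n x s => x (σ.entry n a fun j : Fin (max k 1) => s j) :=
    TDef.entry hlog a (fun s j => s j) fun s hs j => hs.1 _
  have d₂ : TDef f σ.univSize K fun n x s => x (σ.entry n a (tableArgs k fun j => s j)) :=
    TDef.entry hlog a (fun s => tableArgs k fun j => s j) fun s hs j => by
      simpa only [zero_add] using cmp_tableArgs hs 0 k j
  have d₃ : PDef f σ.univSize K fun n x s => x (σ.entry n a fun j : Fin (max k 1) => s j) =
      x (σ.entry n a (tableArgs k fun j => s j)) ∧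
      (isIdx → ∃ b < σ.univSize n, x (σ.entry n a fun j : Fin (max k 1) => s j) = b) := by
    refine (PDef.eq d₁ d₂).and ?_
    by_cases h : isIdx
    · refine ((PDef.eq d₁ (TDef.var (max k 1))).ex (show max k 1 < K by omega)).congr
        fun n x s => ?_
      simp only [h, true_imp_iff, Function.update_self]
      have : ∀ i, (fun j : Fin (max k 1) => Function.update s (max k 1) i (j : ℕ)) =
          fun j : Fin (max k 1) => s j := fun i => by
        funext j
        exact Function.update_of_ne j.2.ne _ _
      simp only [this]
    · exact PDef.true.congr fun n x s => by simp [h]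
  refine (d₃.allBlock (max k 1) 0 (by omega)).congr fun n x s => ⟨fun h t => ?_, fun h t ht _ => ?_⟩
  · have := h (setVars 0 (fun j => (t j : ℕ)) s) (fun i _ hi => ?_) (fun i hi => ?_)
    · have e : ∀ j : Fin (max k 1), setVars 0 (fun j => (t j : ℕ)) s j = t j := fun j => by
        simpa using setVars_apply 0 (fun j => (t j : ℕ)) s j
      have e' : ∀ j : Fin k, setVars 0 (fun j => (t j : ℕ)) s j =
        t (Fin.castLE (le_max_left k 1) j) := fun j => e (Fin.castLE (le_max_left k 1) j)
      simp only [e, e'] at this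
      exact this
    · rw [setVars, dif_pos ⟨Nat.zero_le _, hi⟩]
      exact (t _).2
    · rw [setVars, dif_neg (by omega)]
  · exact h fun j => ⟨t j, ht j (Nat.zero_le _) (by omega)⟩

theorem exists_pdef_isEnc : ∃ K₀, ∀ K ≥ K₀, PDef f σ.univSize K fun n x _ => IsEnc σ n x := by
  obtain ⟨K₁, h₁⟩ := exists_bound (P := fun (i : Fin σ.idx.length) K =>
    PDef f σ.univSize K fun n x _ => ∀ t : Fin (max (σ.idx.get i) 1) → Fin (σ.univSize n),
      EntryOk σ True i (σ.idx.get i) n x fun j => t j)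
    fun i => ⟨_, fun K hK => pdef_entryOk hlog _ _ _ hK⟩
  obtain ⟨K₂, h₂⟩ := exists_bound (P := fun (i : Fin σ.num.length) K =>
    PDef f σ.univSize K fun n x _ => ∀ t : Fin (max (σ.num.get i) 1) → Fin (σ.univSize n),
      EntryOk σ False (σ.idx.length + i) (σ.num.get i) n x fun j => t j)
    fun i => ⟨_, fun K hK => pdef_entryOk hlog _ _ _ hK⟩
  refine ⟨max K₁ K₂, fun K hK => ?_⟩
  have d₀ : PDef f σ.univSize K fun n x s =>
      (σ.encSize (σ.univSize n) : ℝ) = ((n : ℕ) : ℝ) :=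
    PDef.eq (TDef.cmp (c := fun n _ => (σ.encSize (σ.univSize n) : ℝ)) fun _ _ =>
      Signature.cmp_encSize (σ.cmp_univSize hlog)) (TDef.cmp (c := fun n _ => ((n : ℕ) : ℝ))
        fun _ _ => QCmp.n)
  refine (d₀.and ((PDef.listAll (List.finRange _) fun i _ =>
    h₁ K ((le_max_left _ _).trans hK) i).and (PDef.listAll (List.finRange _) fun i _ =>
    h₂ K ((le_max_right _ _).trans hK) i))).congr fun n x s => ?_
  simp only [Nat.cast_inj, List.mem_finRange, true_imp_iff]
  rfl

omit hlog

theorem isEnc_of_enc {D : RStructure σ} {n : ℕ+} {x : Fin n → ℝ} (hD : D.enc = List.ofFn x) :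
    IsEnc σ n x := by
  have hc := univSize_eq_card hD
  have hcanon : ∀ {k : ℕ} (t : Fin (max k 1) → Fin D.card), ∃ t' : Fin (max k 1) → Fin D.card,
      (tableArgs k fun j => (t (Fin.castLE (le_max_left k 1) j) : ℕ)) = (fun j => (t' j : ℕ)) ∧
      ∀ j, t' (Fin.castLE (le_max_left k 1) j) = t (Fin.castLE (le_max_left k 1) j) := by
    intro k t
    refine ⟨fun j => if (j : ℕ) < k then t j else ⟨0, D.card.pos⟩, ?_, fun j => by simp⟩
    funext j
    simp only [tableArgs]
    split_ifs <;> rfl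
  refine ⟨by rw [hc, ← D.length_enc, hD, List.length_ofFn], fun i t => ?_, fun i t => ?_⟩
  · have e : (fun j => (t j : ℕ)) = fun j => ((Fin.cast hc (t j) : Fin D.card) : ℕ) := rfl
    obtain ⟨t', h₁, h₂⟩ := hcanon fun j => Fin.cast hc (t j)
    rw [e, EntryOk, h₁, entry_idx hD, entry_idx hD]
    simp only [h₂, true_and, true_imp_iff]
    exact ⟨_, (D.rank _).2.trans_eq hc.symm, rfl⟩
  · have e : (fun j => (t j : ℕ)) = fun j => ((Fin.cast hc (t j) : Fin D.card) : ℕ) := rfl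
    obtain ⟨t', h₁, h₂⟩ := hcanon fun j => Fin.cast hc (t j)
    rw [e, EntryOk, h₁, entry_num hD, entry_num hD]
    simp only [h₂, true_and, false_imp_iff]

theorem exists_enc {n : ℕ+} {x : Fin n → ℝ} (h : IsEnc σ n x) :
    ∃ D : RStructure σ, D.enc = List.ofFn x := by
  obtain ⟨h₀, h₁, h₂⟩ := h
  let D : RStructure σ :=
    { A := Fin (σ.univSize n)
      card := ⟨σ.univSize n, σ.univSize_pos n⟩
      rank := Equiv.refl _
      idxFun := fun i a => ⟨⌊x (σ.entry n i (tableArgs _ fun j => (a j : ℕ)))⌋₊ % σ.univSize n,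
        Nat.mod_lt _ (σ.univSize_pos n)⟩
      numFun := fun i a => x (σ.entry n (σ.idx.length + i) (tableArgs _ fun j => (a j : ℕ))) }
  have hlen : D.enc.length = n := by rw [D.length_enc]; exact h₀
  refine ⟨D, D.enc_eq_of_forall _ (by rw [← D.length_enc, hlen, List.length_ofFn])
    (fun i t => ?_) (fun i t => ?_)⟩
  · have hlt := (List.getElem?_eq_some_iff.1 (D.enc_idx i t)).1
    rw [hlen] at hlt
    rw [ofFn_getElem? x hlt]
    obtain ⟨e₁, e₂⟩ := h₁ i t
    obtain ⟨b, hb, e₂⟩ := e₂ trivial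
    change some (x (σ.entry n i fun j => t j)) = some ((⌊x (σ.entry n i (tableArgs _ fun j =>
      (t (Fin.castLE (le_max_left _ 1) j) : ℕ)))⌋₊ % σ.univSize n : ℕ) : ℝ)
    rw [← e₁, e₂, Nat.floor_natCast, Nat.mod_eq_of_lt hb]
  · have hlt := (List.getElem?_eq_some_iff.1 (D.enc_num i t)).1
    rw [hlen] at hlt
    rw [ofFn_getElem? x hlt]
    exact congrArg some (h₂ i t).1

end Rep

theorem fOSumProd_subset {f : ℕ → ℕ} (hmono : Monotone f)
    (hlog : ∀ n : ℕ, Real.log (n : ℝ) ≤ (f n : ℝ)) : FOSumProd (FTIME f) ⊆ UniformAC0 f := by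
  rintro S ⟨σ, φ, I, hidx, hnum, hS⟩
  obtain ⟨K₁, h₁⟩ := exists_repFormula I hlog hmono hidx hnum φ
  obtain ⟨K₂, h₂⟩ := exists_pdef_isEnc (σ := σ) hlog
  obtain ⟨R, d, r⟩ := h₁ _ (le_max_left K₁ K₂)
  obtain ⟨T, -, j, -, hj, hv⟩ := (h₂ _ (le_max_right K₁ K₂)).and d Template.empty
  have key : ∀ x : RInf, x ∈ S ↔ IsEnc σ x.1 x.2 ∧ R x.1 x.2 fun _ => 0 := by
    intro x
    rw [hS]
    have hR : ∀ D : RStructure σ, D.enc = List.ofFn x.2 →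
        (R x.1 x.2 (fun _ => 0) ↔ φ.Satisfied I D) := by
      intro D hD
      have := r x.1 x.2 D hD fun _ => D.rank.symm ⟨0, D.card.pos⟩
      have e : (D.ranks fun _ => D.rank.symm ⟨0, D.card.pos⟩) = fun _ => 0 := by
        funext i
        simp [RStructure.ranks]
      rw [e] at this
      rw [this, Formula.Satisfied]
      congr!
    constructor
    · rintro ⟨D, hD, hφ⟩
      exact ⟨isEnc_of_enc hD, (hR D hD).2 hφ⟩
    · rintro ⟨hE, hφ⟩
      obtain ⟨D, hD⟩ := exists_enc hE
      exact ⟨D, hD, (hR D hD).1 hφ⟩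
  refine T.mem_uniformAC0 ⟨j, hj⟩ σ.univSize_pos hlog σ.univSize_le (σ.cmp_univSize hlog)
    (fun x hx => ?_) fun x hx => ?_
  · rw [hv]
    exact ind_true ((key x).1 hx)
  · rw [hv]
    exact ind_false (mt (key x).2 hx)

/-! ### Functions defined by number terms -/

section NDef

variable {σ : Signature} {I : Interpretation σ}

/-- `G` is the value of a number term. -/
def NDef (I : Interpretation σ) (m : ℕ) (G : (D : RStructure σ) → (Fin m → D.A) → ℝ) : Prop :=
  ∃ t : NumTerm σ m, ∀ D s, t.eval I D s = G D s

variable {m : ℕ} {G G₁ G₂ : (D : RStructure σ) → (Fin m → D.A) → ℝ}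

theorem NDef.congr {G' : (D : RStructure σ) → (Fin m → D.A) → ℝ} (h : NDef I m G)
    (e : ∀ D s, G D s = G' D s) : NDef I m G' :=
  let ⟨t, ht⟩ := h
  ⟨t, fun D s => (ht D s).trans (e D s)⟩

theorem NDef.const (c : ℝ) : NDef I m fun _ _ => c := ⟨.const c, fun _ _ => rfl⟩

theorem NDef.add (h₁ : NDef I m G₁) (h₂ : NDef I m G₂) : NDef I m fun D s => G₁ D s + G₂ D s :=
  let ⟨t₁, h₁⟩ := h₁
  let ⟨t₂, h₂⟩ := h₂
  ⟨.add t₁ t₂, fun D s => by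
    dsimp only
    rw [← h₁, ← h₂]
    rfl⟩

theorem NDef.mul (h₁ : NDef I m G₁) (h₂ : NDef I m G₂) : NDef I m fun D s => G₁ D s * G₂ D s :=
  let ⟨t₁, h₁⟩ := h₁
  let ⟨t₂, h₂⟩ := h₂
  ⟨.mul t₁ t₂, fun D s => by
    dsimp only
    rw [← h₁, ← h₂]
    rfl⟩

theorem NDef.sign (h : NDef I m G) : NDef I m fun D s => Real.sign (G D s) :=
  let ⟨t, h⟩ := h
  ⟨.sign t, fun D s => by
    dsimp only
    rw [← h]
    rfl⟩

theorem NDef.eq (h₁ : NDef I m G₁) (h₂ : NDef I m G₂) :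
    NDef I m fun D s => ind (G₁ D s = G₂ D s) := by
  have hs := (h₁.add ((NDef.const (-1)).mul h₂)).sign
  refine ((NDef.const 1).add ((NDef.const (-1)).mul (hs.mul hs))).congr fun D s => ?_
  rcases lt_trichotomy (G₁ D s) (G₂ D s) with h | h | h
  · rw [Real.sign_of_neg (by linarith), ind_false h.ne]
    norm_num
  · rw [h, ind_true rfl]
    norm_num
  · rw [Real.sign_of_pos (by linarith), ind_false h.ne']
    norm_num

/-- A sum or product over a finite type. -/
def bigOp (b : Bool) {α : Type} [Fintype α] (g : α → ℝ) : ℝ := if b then ∏ a, g a else ∑ a, g a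

theorem bigOp_snoc (b : Bool) {α : Type} [Fintype α] [DecidableEq α] {k : ℕ}
    (g : (Fin (k + 1) → α) → ℝ) :
    bigOp b g = bigOp b fun t : Fin k → α => bigOp b fun a => g (Fin.snoc t a) := by
  cases b
  · simp only [bigOp, Bool.false_eq_true, if_false]
    rw [← (Fin.snocEquiv fun _ => α).sum_comp, Fintype.sum_prod_type_right]
    rfl
  · simp only [bigOp, if_true]
    rw [← (Fin.snocEquiv fun _ => α).prod_comp, Fintype.prod_prod_type_right]
    rfl

theorem NDef.bigOp (b : Bool) {G : (D : RStructure σ) → (Fin (m + 1) → D.A) → ℝ}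
    (h : NDef I (m + 1) G) :
    NDef I m fun D s => bigOp b fun a => G D (Fin.snoc s (D.rank.symm a) : Fin (m + 1) → D.A) := by
  obtain ⟨t, ht⟩ := h
  cases b
  · refine ⟨.sum t, fun D s => ?_⟩
    simp only [NumTerm.eval, ht, RealAC0.bigOp, Bool.false_eq_true, if_false]
  · refine ⟨.prod t, fun D s => ?_⟩
    simp only [NumTerm.eval, ht, RealAC0.bigOp, if_true]

theorem NDef.bigOpTuple (b : Bool) {k : ℕ}
    (G : (D : RStructure σ) → (Fin m → D.A) → (Fin k → D.A) → ℝ)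
    (h : NDef I (m + k) fun D s => G D (fun i => s (Fin.castAdd k i)) fun j => s (Fin.natAdd m j)) :
    NDef I m fun D s => RealAC0.bigOp b fun t : Fin k → Fin D.card =>
      G D s fun j => D.rank.symm (t j) := by
  induction k with
  | zero =>
    refine h.congr fun D s => ?_
    cases b
    · simp only [RealAC0.bigOp, Bool.false_eq_true, if_false, Finset.univ_unique,
        Finset.sum_singleton]
      congr 1
      funext j
      exact j.elim0
    · simp only [RealAC0.bigOp, if_true, Finset.univ_unique, Finset.prod_singleton]
      congr 1
      funext j
      exact j.elim0
  | succ k ih =>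
    refine (ih (fun D s t => RealAC0.bigOp b fun a : Fin D.card =>
      G D s (Fin.snoc t (D.rank.symm a))) ?_).congr fun D s => ?_
    · refine (NDef.bigOp b (m := m + k) h).congr fun D s => ?_
      congr 1
      funext a
      congr 1
      · funext i
        exact Fin.snoc_castSucc (α := fun _ => D.A) (D.rank.symm a) s (Fin.castAdd k i)
      · funext j
        refine Fin.lastCases ?_ (fun j => ?_) j
        · rw [Fin.snoc_last]
          exact Fin.snoc_last (α := fun _ => D.A) (D.rank.symm a) s
        · rw [Fin.snoc_castSucc]
          exact Fin.snoc_castSucc (α := fun _ => D.A) (D.rank.symm a) s (Fin.natAdd m j)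
    · rw [bigOp_snoc]
      congr 1
      funext t
      congr 1
      funext a
      congr 1
      funext j
      refine Fin.lastCases ?_ (fun j => ?_) j <;> simp

/-- Sums and products over tuples of ranks. -/
theorem NDef.bigOpRanks (b : Bool) {k : ℕ}
    (G : (D : RStructure σ) → (Fin m → D.A) → (Fin k → Fin D.card) → ℝ)
    (h : NDef I (m + k) fun D s =>
      G D (fun i => s (Fin.castAdd k i)) fun j => D.rank (s (Fin.natAdd m j))) :
    NDef I m fun D s => RealAC0.bigOp b fun t : Fin k → Fin D.card => G D s t :=
  (NDef.bigOpTuple b (fun D s t => G D s fun j => D.rank (t j)) h).congr fun D s => by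
    simp only [Equiv.apply_symm_apply]

theorem NDef.ext (i : Fin σ.extNum.length) (e : Fin (σ.extNum.get i) → Fin m) :
    NDef I m fun D s => I.num i D.card fun j => D.rank (s (e j)) :=
  ⟨.ext i fun j => .var (e j), fun _ _ => rfl⟩

theorem NDef.app (i : Fin σ.num.length) (e : Fin (σ.num.get i) → Fin m) :
    NDef I m fun D s => D.numFun i fun j => s (e j) :=
  ⟨.app i fun j => .var (e j), fun _ _ => rfl⟩

theorem NDef.listSum {α : Type} (l : List α) {F : α → (D : RStructure σ) → (Fin m → D.A) → ℝ}
    (h : ∀ a ∈ l, NDef I m (F a)) : NDef I m fun D s => (l.map fun a => F a D s).sum := by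
  induction l with
  | nil => exact NDef.const 0
  | cons a l ih =>
    simpa only [List.map_cons, List.sum_cons] using
      (h a (by simp)).add (ih fun b hb => h b (by simp [hb]))

theorem NDef.listProd {α : Type} (l : List α) {F : α → (D : RStructure σ) → (Fin m → D.A) → ℝ}
    (h : ∀ a ∈ l, NDef I m (F a)) : NDef I m fun D s => (l.map fun a => F a D s).prod := by
  induction l with
  | nil => exact NDef.const 1
  | cons a l ih =>
    simpa only [List.map_cons, List.prod_cons] using
      (h a (by simp)).mul (ih fun b hb => h b (by simp [hb]))

/-- The value of a gate of a fixed circuit with definable inputs. -/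
theorem NDef.circuit {n : ℕ} (C : Circuit n)
    (X : (D : RStructure σ) → (Fin m → D.A) → Fin n → ℝ) (hX : ∀ i, NDef I m fun D s => X D s i)
    (g : Fin C.size) : NDef I m fun D s => C.val (X D s) g := by
  induction g using C.acyclic.induction with
  | _ g ih =>
    have hsum : NDef I m fun D s => ((C.pred g).map fun w => C.val (X D s) w).sum :=
      NDef.listSum (C.pred g) (F := fun w D s => C.val (X D s) w) ih
    have hprod : NDef I m fun D s => ((C.pred g).map fun w => C.val (X D s) w).prod :=
      NDef.listProd (C.pred g) (F := fun w D s => C.val (X D s) w) ih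
    simp only [C.val_eq _ g]
    cases C.kind g with
    | input i => exact hX i
    | const c => exact NDef.const c
    | add => exact hsum
    | mul => exact hprod
    | sign => exact hsum.sign
    | output => exact hsum

end NDef

/-! ### The evaluation of uniform circuits by number terms -/

theorem exists_eval_le_pow (p : Polynomial ℕ) : ∃ k, ∀ n ≥ 2, p.eval n ≤ n ^ k := by
  induction p using Polynomial.induction_on' with
  | add p q hp hq =>
    obtain ⟨k, hk⟩ := hp
    obtain ⟨l, hl⟩ := hq
    refine ⟨max k l + 1, fun n hn => ?_⟩
    rw [Polynomial.eval_add, pow_succ]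
    have h₁ := (hk n hn).trans (Nat.pow_le_pow_right (by omega) (le_max_left k l))
    have h₂ := (hl n hn).trans (Nat.pow_le_pow_right (by omega) (le_max_right k l))
    nlinarith [Nat.mul_le_mul_left (n ^ max k l) hn]
  | monomial m a =>
    refine ⟨a + m, fun n hn => ?_⟩
    rw [Polynomial.eval_monomial, pow_add]
    refine Nat.mul_le_mul_right _ ?_
    exact Nat.lt_two_pow_self.le.trans (Nat.pow_le_pow_left hn a)

/-- The number of a gate given by a tuple. -/
def gateNr {n k : ℕ} (a : Fin k → Fin n) : ℕ := (finFunctionFinEquiv a : ℕ) + 1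

section Families

variable (C : CircuitFamily) (k : ℕ)

/-- Components of the answers about the gates given by `k`-tuples, for predecessors given by
`k`-tuples. -/
def gateType : NumFamily k := fun n a => (C n).answer (gateNr a) 1 0

def gateLabel : NumFamily k := fun n a => (C n).answer (gateNr a) 1 2

def gatePred : NumFamily (k + k) := fun n a => (C n).answer
  (gateNr fun j => a (Fin.castAdd k j)) (gateNr fun j => a (Fin.natAdd k j)) 1

def gateNrFam : NumFamily k := fun _ a => gateNr a

variable {k C}

/-- The input of a machine for a family of functions. -/
def famInp (x : Σ n : ℕ+, (Fin k → Fin n)) : Fin (k + 1) → ℝ :=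
  Fin.cons ((x.1 : ℕ) : ℝ) fun j => ((x.2 j : ℕ) : ℝ)

theorem mem_fTIME {f : ℕ → ℕ} {F : NumFamily k}
    (h : CmpOut (List.ofFn fun i x => famInp x i) (fun x : Σ n : ℕ+, (Fin k → Fin n) => f x.1)
      fun x => ![F x.1 x.2]) : F ∈ (FTIME f).num k := by
  obtain ⟨M, c, hM⟩ := h.computesWithin
  exact ⟨M, c, fun n a => hM ⟨n, a⟩⟩

theorem cmp_famN {b : (Σ n : ℕ+, (Fin k → Fin n)) → ℕ} :
    Cmp (List.ofFn fun i x => famInp x i) b fun x => ((x.1 : ℕ) : ℝ) :=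
  Cmp.of_mem ((List.mem_ofFn' _ _).2 ⟨0, rfl⟩)

theorem cmp_gateNr {b : (Σ n : ℕ+, (Fin k → Fin n)) → ℕ} {l : ℕ} (e : Fin l → Fin k) :
    Cmp (List.ofFn fun i x => famInp x i) b fun x => (gateNr fun j => x.2 (e j) : ℝ) := by
  refine (Cmp.add (Cmp.sum Finset.univ fun j (_ : j ∈ Finset.univ) => Cmp.mul (Cmp.of_mem
    ((List.mem_ofFn' _ _).2 ⟨(e j).succ, rfl⟩)) (cmp_famN.pow (j : ℕ))) (Cmp.const 1)).congr
    fun x => ?_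
  simp [gateNr, famInp]

theorem gateNrFam_mem {f : ℕ → ℕ} : gateNrFam k ∈ (FTIME f).num k :=
  mem_fTIME (Cmp.out fun i => by fin_cases i; exact cmp_gateNr id)

theorem answer_mem {f : ℕ → ℕ} (h : C.ConstructibleIn f)
    {v p : (Σ n : ℕ+, (Fin k → Fin n)) → ℕ}
    (hv : Cmp (List.ofFn fun i x => famInp x i) (fun x => f x.1) fun x => (v x : ℝ))
    (hp : Cmp (List.ofFn fun i x => famInp x i) (fun x => f x.1) fun x => (p x : ℝ))
    (h1 : ∀ x, 1 ≤ p x) (i : Fin 3) :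
    (fun n a => (C n).answer (v ⟨n, a⟩) (p ⟨n, a⟩) i : NumFamily k) ∈ (FTIME f).num k := by
  obtain ⟨M, c, hM⟩ := h
  have ha : ∀ j : Fin 3, Cmp (List.ofFn fun i x => famInp x i)
      (fun x : Σ n : ℕ+, (Fin k → Fin n) => f x.1)
      fun x => (![((x.1 : ℕ) : ℝ), (v x : ℝ), (p x : ℝ)] : Fin 3 → ℝ) j :=
    Fin.forall_fin_succ.2 ⟨cmp_famN, Fin.forall_fin_succ.2 ⟨hv, Fin.forall_fin_succ.2
      ⟨hp, fun j => j.elim0⟩⟩⟩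
  have := Cmp.call ha (y := fun x => (C x.1).answer (v x) (p x)) M c
    (fun x => hM x.1 (v x) (p x) (h1 x)) (fun _ : Fin 1 => MvPolynomial.X i)
  refine mem_fTIME (this.congr fun x => ?_)
  funext j
  simp

variable (C k)

/-- The signature of the inputs as structures, with symbols for the circuit family. -/
def circuitSig : Signature := ⟨[], [1], [], [k, k, k + k, k, 1]⟩

def circuitInterp : Interpretation (circuitSig k) where
  idx i := i.elim0
  num
    | ⟨0, _⟩ => gateType C k
    | ⟨1, _⟩ => gateLabel C k
    | ⟨2, _⟩ => gatePred C k
    | ⟨3, _⟩ => gateNrFam k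
    | ⟨4, _⟩ => gateNrFam 1

theorem circuitInterp_mem {f : ℕ → ℕ} (h : C.ConstructibleIn f) (i) :
    (circuitInterp C k).num i ∈ (FTIME f).num ((circuitSig k).extNum.get i) := by
  revert i
  change ∀ i : Fin 5, _
  refine Fin.forall_fin_succ.2 ⟨?_, Fin.forall_fin_succ.2 ⟨?_, Fin.forall_fin_succ.2 ⟨?_,
    Fin.forall_fin_succ.2 ⟨gateNrFam_mem, Fin.forall_fin_succ.2 ⟨gateNrFam_mem, nofun⟩⟩⟩⟩⟩
  · exact answer_mem h (cmp_gateNr id) (p := fun _ => 1) (Cmp.const _) (fun _ => le_rfl) 0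
  · exact answer_mem h (cmp_gateNr id) (p := fun _ => 1) (Cmp.const _) (fun _ => le_rfl) 2
  · exact answer_mem h (cmp_gateNr (Fin.castAdd k)) (cmp_gateNr (Fin.natAdd k))
      (fun _ => Nat.le_add_left _ _) 1

/-- The value of the predecessor number `p` of the gate `a`, where `W` gives the values of gates. -/
def predVal {n : ℕ+} (W : (Fin k → Fin n) → ℝ) (a p : Fin k → Fin n) : ℝ :=
  bigOp false fun w : Fin k → Fin n =>
    ind (gatePred C k n (Fin.addCases a p) = gateNrFam k n w) * W w

/-- The value of a gate from the values of all gates. -/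
def gateStep {n : ℕ+} (x : Fin n → ℝ) (W : (Fin k → Fin n) → ℝ) (a : Fin k → Fin n) : ℝ :=
  ind (gateType C k n a = 1) * bigOp false (fun i : Fin 1 → Fin n =>
      ind (gateLabel C k n a = gateNrFam 1 n i) * x (i 0)) +
    ind (gateType C k n a = 2) * gateLabel C k n a +
    ind (gateType C k n a = 3) * bigOp false (predVal C k W a) +
    ind (gateType C k n a = 4) * bigOp true (fun p => predVal C k W a p +
      ind (gatePred C k n (Fin.addCases a p) = 0)) +
    ind (gateType C k n a = 5) * Real.sign (bigOp false (predVal C k W a)) +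
    ind (gateType C k n a = 6) * bigOp false (predVal C k W a)

/-- The values of the gates of height less than `d`. -/
def gateVal {n : ℕ+} (x : Fin n → ℝ) : ℕ → (Fin k → Fin n) → ℝ
  | 0 => fun _ => 0
  | d + 1 => gateStep C k x (gateVal x d)

/-- The input given by a structure. -/
def structInp (D : RStructure (circuitSig k)) (i : Fin D.card) : ℝ :=
  D.numFun ⟨0, Nat.one_pos⟩ fun _ => D.rank.symm i

theorem ndef_pred {m : ℕ} (ea ep : Fin k → Fin m) :
    NDef (circuitInterp C k) m fun D s => gatePred C k D.card
      (Fin.addCases (fun j => D.rank (s (ea j))) fun j => D.rank (s (ep j))) := by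
  refine (NDef.ext (σ := circuitSig k) (I := circuitInterp C k) ⟨2, by simp [circuitSig]⟩
    (Fin.addCases ea ep)).congr fun D s => ?_
  change gatePred C k D.card (fun j : Fin (k + k) => D.rank (s (Fin.addCases ea ep j))) = _
  refine congrArg (gatePred C k D.card) ?_
  funext j
  refine Fin.addCases (fun j => ?_) (fun j => ?_) j
  · simp only [Fin.addCases_left]
  · simp only [Fin.addCases_right]

theorem ndef_gateVal (d m : ℕ) (e : Fin k → Fin m) :
    NDef (circuitInterp C k) m fun D s =>
      gateVal C k (structInp k D) d fun j => D.rank (s (e j)) := by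
  induction d generalizing m with
  | zero => exact NDef.const 0
  | succ d ih =>
    have ht : NDef (circuitInterp C k) m fun D s => gateType C k D.card fun j => D.rank (s (e j)) :=
      NDef.ext (σ := circuitSig k) (I := circuitInterp C k) ⟨0, by simp [circuitSig]⟩ e
    have hl : ∀ {m} (e : Fin k → Fin m), NDef (circuitInterp C k) m fun D s =>
        gateLabel C k D.card fun j => D.rank (s (e j)) :=
      fun e => NDef.ext (σ := circuitSig k) (I := circuitInterp C k) ⟨1, by simp [circuitSig]⟩ e
    have hn : ∀ {m} (e : Fin k → Fin m), NDef (circuitInterp C k) m fun D s =>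
        gateNrFam k D.card fun j => D.rank (s (e j)) :=
      fun e => NDef.ext (σ := circuitSig k) (I := circuitInterp C k) ⟨3, by simp [circuitSig]⟩ e
    have hr : ∀ {m} (e : Fin 1 → Fin m), NDef (circuitInterp C k) m fun D s =>
        gateNrFam 1 D.card fun j => D.rank (s (e j)) :=
      fun e => NDef.ext (σ := circuitSig k) (I := circuitInterp C k) ⟨4, by simp [circuitSig]⟩ e
    have hp : NDef (circuitInterp C k) (m + k) fun D s =>
        predVal C k (gateVal C k (structInp k D) d)
          (fun j => D.rank (s (Fin.castAdd k (e j)))) fun j => D.rank (s (Fin.natAdd m j)) :=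
      NDef.bigOpRanks false (fun D s w => ind (gatePred C k D.card (Fin.addCases
        (fun j => D.rank (s (Fin.castAdd k (e j)))) fun j => D.rank (s (Fin.natAdd m j))) =
          gateNrFam k D.card w) * gateVal C k (structInp k D) d w)
        ((NDef.eq (ndef_pred C k (fun j => Fin.castAdd k (Fin.castAdd k (e j)))
          fun j => Fin.castAdd k (Fin.natAdd m j)) (hn _)).mul (ih _ _))
    have hsum : NDef (circuitInterp C k) m fun D s => bigOp false
        (predVal C k (gateVal C k (structInp k D) d) fun j => D.rank (s (e j))) :=
      NDef.bigOpRanks false (fun D s p => predVal C k (gateVal C k (structInp k D) d)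
        (fun j => D.rank (s (e j))) p) hp
    have hprod : NDef (circuitInterp C k) m fun D s => bigOp true fun p =>
        predVal C k (gateVal C k (structInp k D) d) (fun j => D.rank (s (e j))) p +
        ind (gatePred C k D.card (Fin.addCases (fun j => D.rank (s (e j))) p) = 0) :=
      NDef.bigOpRanks true (fun D s p => predVal C k (gateVal C k (structInp k D) d)
        (fun j => D.rank (s (e j))) p +
        ind (gatePred C k D.card (Fin.addCases (fun j => D.rank (s (e j))) p) = 0))
        (hp.add (NDef.eq (ndef_pred C k _ _) (NDef.const 0)))
    have hinp : NDef (circuitInterp C k) m fun D s => bigOp false fun i : Fin 1 → Fin D.card =>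
        ind (gateLabel C k D.card (fun j => D.rank (s (e j))) = gateNrFam 1 D.card i) *
          structInp k D (i 0) :=
      NDef.bigOpRanks false (fun D s i => ind (gateLabel C k D.card (fun j => D.rank (s (e j))) =
        gateNrFam 1 D.card i) * structInp k D (i 0))
        ((NDef.eq (hl _) (hr _)).mul ((NDef.app (σ := circuitSig k) ⟨0, Nat.one_pos⟩
          (fun _ => Fin.natAdd m (0 : Fin 1))).congr fun D s => by simp [structInp]))
    exact ((((((ht.eq (NDef.const 1)).mul hinp).add ((ht.eq (NDef.const 2)).mul (hl e))).add
      ((ht.eq (NDef.const 3)).mul hsum)).add ((ht.eq (NDef.const 4)).mul hprod)).add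
      ((ht.eq (NDef.const 5)).mul hsum.sign)).add ((ht.eq (NDef.const 6)).mul hsum)

/-! ### Correctness of the evaluation -/

@[to_additive]
theorem prod_getElem?_elim {α M : Type} [CommMonoid M] (F : α → M) (l : List α) {N : ℕ}
    (h : l.length ≤ N) : ∏ i : Fin N, (l[(i : ℕ)]?).elim 1 F = (l.map F).prod := by
  induction l generalizing N with
  | nil => simp
  | cons a l ih =>
    obtain _ | N := N
    · simp at h
    · rw [Fin.prod_univ_succ, List.map_cons, List.prod_cons, ← ih (by simpa using h)]
      simp

theorem Circuit.Path.snoc {n : ℕ} {C : Circuit n} {l : ℕ} {u w v : Fin C.size}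
    (h : C.Path l u w) (hw : w ∈ C.pred v) : C.Path (l + 1) u v := by
  induction h with
  | nil => exact .cons hw (.nil v)
  | cons h _ ih => exact .cons h (ih hw)

theorem gateNr_injective {n k : ℕ} : Function.Injective (gateNr : (Fin k → Fin n) → ℕ) :=
  fun _ _ h => finFunctionFinEquiv.injective (Fin.ext (Nat.succ_injective h))

variable {C k} {n : ℕ+} {x : Fin n → ℝ}

theorem exists_gateNr_eq (hk : (C n).size ≤ n ^ k) (g : Fin (C n).size) :
    ∃ a : Fin k → Fin n, gateNr a = (g : ℕ) + 1 :=
  ⟨finFunctionFinEquiv.symm (Fin.castLE hk g), by simp [gateNr]⟩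

section

variable {a : Fin k → Fin n} {g : Fin (C n).size} (ha : gateNr a = (g : ℕ) + 1)

include ha

theorem gateType_eq : gateType C k n a = ((C n).kind g).code := by
  rw [gateType, ha, Circuit.answer_succ (C n) g 0]
  rfl

theorem gateLabel_eq : gateLabel C k n a = ((C n).kind g).label := by
  rw [gateLabel, ha, Circuit.answer_succ (C n) g 0]
  rfl

theorem gatePred_eq (p : Fin k → Fin n) : gatePred C k n (Fin.addCases a p) =
    (((C n).pred g)[(finFunctionFinEquiv p : ℕ)]?).elim 0 fun w => ((w : ℕ) : ℝ) + 1 := by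
  simp only [gatePred, Fin.addCases_left, Fin.addCases_right]
  rw [ha, gateNr, Circuit.answer_succ (C n) g]
  rfl

theorem predVal_eq (hk : (C n).size ≤ n ^ k) {W : (Fin k → Fin n) → ℝ} {V : Fin (C n).size → ℝ}
    (hW : ∀ w ∈ (C n).pred g, ∀ b, gateNr b = (w : ℕ) + 1 → W b = V w) (p : Fin k → Fin n) :
    predVal C k W a p = (((C n).pred g)[(finFunctionFinEquiv p : ℕ)]?).elim 0 V := by
  simp only [predVal, bigOp, Bool.false_eq_true, if_false, gatePred_eq ha, gateNrFam]
  rcases hw : ((C n).pred g)[(finFunctionFinEquiv p : ℕ)]? with _ | w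
  · refine Finset.sum_eq_zero fun b _ => ?_
    rw [ind_false, zero_mul]
    exact (Nat.cast_ne_zero.2 (Nat.succ_ne_zero _)).symm
  · obtain ⟨b, hb⟩ := exists_gateNr_eq hk w
    simp only [Option.elim_some]
    rw [Finset.sum_eq_single b, ind_true (by rw [hb]; push_cast; rfl), one_mul,
      hW w (List.mem_of_getElem? hw) b hb]
    · intro b' _ hb'
      rw [ind_false, zero_mul]
      intro h
      exact hb' (gateNr_injective (by rw [hb]; exact_mod_cast h.symm))
    · simp

theorem gateStep_eq (hk : (C n).size ≤ n ^ k) {W : (Fin k → Fin n) → ℝ}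
    (hW : ∀ w ∈ (C n).pred g, ∀ b, gateNr b = (w : ℕ) + 1 → W b = (C n).val x w) :
    gateStep C k x W a = (C n).val x g := by
  have hl : ((C n).pred g).length ≤ n ^ k := by
    refine le_trans ?_ hk
    simpa using ((C n).pred_nodup g).length_le_card
  have hsum : bigOp false (predVal C k W a) = (((C n).pred g).map ((C n).val x)).sum := by
    simp only [bigOp, Bool.false_eq_true, if_false, predVal_eq ha hk hW]
    rw [← sum_getElem?_elim _ _ hl]
    exact finFunctionFinEquiv.sum_comp fun i : Fin ((n : ℕ) ^ k) =>
      (((C n).pred g)[(i : ℕ)]?).elim 0 ((C n).val x)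
  have hprod : (bigOp true fun p => predVal C k W a p +
      ind (gatePred C k n (Fin.addCases a p) = 0)) =
        (((C n).pred g).map ((C n).val x)).prod := by
    simp only [bigOp, if_true, predVal_eq ha hk hW, gatePred_eq ha]
    rw [← prod_getElem?_elim _ _ hl, ← finFunctionFinEquiv.prod_comp]
    refine Finset.prod_congr rfl fun p _ => ?_
    rcases ((C n).pred g)[(finFunctionFinEquiv p : ℕ)]? with _ | w
    · simp [ind]
    · have : ((w : ℕ) : ℝ) + 1 ≠ 0 := by positivity
      simp [ind, this]
  rw [gateStep, hsum, hprod, gateType_eq ha, gateLabel_eq ha, Circuit.val_eq]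
  rcases (C n).kind g with i | c | _ | _ | _ | _
  · have : (bigOp false fun j : Fin 1 → Fin n =>
        ind (((i : ℕ) : ℝ) + 1 = gateNrFam 1 n j) * x (j 0)) = x i := by
      simp only [bigOp, Bool.false_eq_true, if_false, gateNrFam, gateNr]
      rw [Finset.sum_eq_single fun _ => i]
      · simp [ind]
      · intro j _ hj
        rw [ind_false, zero_mul]
        intro h
        refine hj (funext fun l => Fin.ext ?_)
        rw [Subsingleton.elim l 0]
        simpa using h.symm
      · simp
    simp only [GateKind.code, GateKind.label, GateKind.apply, this]
    simp [ind]
  all_goals simp [GateKind.code, GateKind.label, GateKind.apply, ind]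

end

theorem gateVal_eq (hk : (C n).size ≤ n ^ k) {d : ℕ} {g : Fin (C n).size}
    (hd : ∀ l u, (C n).Path l u g → l < d) {a : Fin k → Fin n} (ha : gateNr a = (g : ℕ) + 1) :
    gateVal C k x d a = (C n).val x g := by
  induction d generalizing g a with
  | zero => exact absurd (hd 0 g (.nil g)) (lt_irrefl _)
  | succ d ih =>
    exact gateStep_eq ha hk fun w hw b hb =>
      ih (fun l u h => Nat.lt_of_succ_lt_succ (hd _ u (h.snoc hw))) hb

theorem bigOp_out_eq (hk : (C n).size ≤ n ^ k) {d : ℕ} (hd : (C n).DepthLE d) :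
    (bigOp false fun a : Fin k → Fin n => ind (gateType C k n a = 6) * gateVal C k x (d + 1) a) =
      (C n).eval x := by
  obtain ⟨b, hb⟩ := exists_gateNr_eq hk (C n).out
  simp only [bigOp, Bool.false_eq_true, if_false]
  rw [Finset.sum_eq_single b]
  · rw [gateVal_eq hk (fun l u h => Nat.lt_succ_of_le (hd l u h)) hb, gateType_eq hb,
      ((C n).kind_eq_output _).2 rfl, ind_true (by simp [GateKind.code]), one_mul]
    rfl
  · intro a _ hab
    rw [ind_false, zero_mul]
    intro h
    by_cases hs : gateNr a ≤ (C n).size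
    · have ha : gateNr a = ((⟨gateNr a - 1, by unfold gateNr at *; omega⟩ : Fin (C n).size) : ℕ)
          + 1 := by
        unfold gateNr
        simp
      rw [gateType_eq ha] at h
      refine hab (gateNr_injective (ha.trans ?_))
      rw [hb, ← ((C n).kind_eq_output _).1]
      revert h
      rcases (C n).kind _ with i | c | _ | _ | _ | _ <;> norm_num [GateKind.code]
    · rw [gateType, Circuit.answer_of_lt (.inr (not_le.1 hs))] at h
      norm_num at h
  · simp

theorem eval_of_eq_one (C : CircuitFamily) {n : ℕ+} (h : n = 1) (x : Fin n → ℝ) :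
    (C 1).val (fun _ => bigOp false fun i : Fin 1 → Fin n => x (i 0)) (C 1).out = (C n).eval x := by
  subst h
  refine congrArg ((C 1).eval ·) (funext fun i => ?_)
  rw [bigOp, if_neg Bool.false_ne_true]
  exact (Fintype.sum_eq_single (α := Fin 1 → Fin 1) (fun _ => i)
    fun j hj => absurd (Subsingleton.elim _ _) hj).trans rfl

theorem ndef_eval {d : ℕ} (hk : ∀ n : ℕ+, 2 ≤ (n : ℕ) → (C n).size ≤ n ^ k)
    (hd : ∀ n, (C n).DepthLE d) :
    NDef (circuitInterp C k) 0 fun D _ => (C D.card).eval (structInp k D) := by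
  have hx : NDef (circuitInterp C k) 0 fun D _ =>
      bigOp false fun i : Fin 1 → Fin D.card => structInp k D (i 0) :=
    NDef.bigOpRanks false (fun D _ i => structInp k D (i 0))
      ((NDef.app (σ := circuitSig k) ⟨0, Nat.one_pos⟩
        (fun _ => Fin.natAdd 0 (0 : Fin 1))).congr fun D s => by simp [structInp])
  have h1 := NDef.circuit (C 1) (fun D _ _ => bigOp false fun i : Fin 1 → Fin D.card =>
    structInp k D (i 0)) (fun _ => hx) (C 1).out
  have h2 : NDef (circuitInterp C k) 0 fun D _ => bigOp false fun a : Fin k → Fin D.card =>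
      ind (gateType C k D.card a = 6) * gateVal C k (structInp k D) (d + 1) a :=
    NDef.bigOpRanks false (fun D _ a => ind (gateType C k D.card a = 6) *
      gateVal C k (structInp k D) (d + 1) a)
      (((NDef.ext (σ := circuitSig k) (I := circuitInterp C k) ⟨0, by simp [circuitSig]⟩
        (fun j : Fin k => Fin.natAdd 0 j)).eq (NDef.const 6)).mul (ndef_gateVal C k _ _ _))
  have hc : NDef (circuitInterp C k) 0 fun D _ => ind (((D.card : ℕ) : ℝ) = 1) :=
    ((NDef.bigOpRanks false (fun D _ (_ : Fin 1 → Fin D.card) => 1) (NDef.const 1)).eq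
      (NDef.const 1)).congr fun D _ => by simp [bigOp]
  refine ((hc.mul h1).add (((NDef.const 1).add ((NDef.const (-1)).mul hc)).mul h2)).congr
    fun D _ => ?_
  by_cases h : D.card = 1
  · rw [ind_true (by simp [h]), eval_of_eq_one C h]
    ring
  · have h' : (D.card : ℕ) ≠ 1 := fun e => h (PNat.coe_inj.1 e)
    have := D.card.pos
    rw [ind_false (by exact_mod_cast h'), bigOp_out_eq (hk _ (by omega)) (hd _)]
    ring

theorem enc_circuitSig (D : RStructure (circuitSig k)) : D.enc = List.ofFn (structInp k D) := by
  change [] ++ (D.table (k := 1) (D.numFun ⟨0, Nat.one_pos⟩) ++ []) = _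
  rw [List.nil_append, List.append_nil]
  change (tuples D.card 1).map (fun t => D.numFun ⟨0, Nat.one_pos⟩ fun j => D.rank.symm (t j)) = _
  simp only [tuples, List.map_singleton, List.ofFn_eq_map, List.map_map,
    ← List.map_eq_flatMap]
  refine List.map_congr_left fun i _ => congrArg (D.numFun ⟨0, Nat.one_pos⟩) (funext fun j => ?_)
  exact congrArg D.rank.symm (congrArg (Fin.cons i _) (Subsingleton.elim (α := Fin 1) j 0))

/-- The structure of an input. -/
def inpStructure (k : ℕ) (x : RInf) : RStructure (circuitSig k) where
  A := Fin x.1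
  card := x.1
  rank := Equiv.refl _
  idxFun i := i.elim0
  numFun := Fin.cons (fun a : Fin 1 → Fin x.1 => x.2 (a 0)) fun i => i.elim0

end Families

theorem eval_congr (C : CircuitFamily) {n m : ℕ+} {x : Fin n → ℝ} {y : Fin m → ℝ}
    (h : List.ofFn x = List.ofFn y) : (C n).eval x = (C m).eval y := by
  obtain rfl : n = m := PNat.coe_inj.1 (by simpa using congrArg List.length h)
  rw [List.ofFn_injective h]

theorem uniformAC0_subset {f : ℕ → ℕ} : UniformAC0 f ⊆ FOSumProd (FTIME f) := by
  rintro S ⟨C, ⟨p, hp⟩, ⟨d, hd⟩, hC, hS⟩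
  obtain ⟨k, hk⟩ := exists_eval_le_pow p
  obtain ⟨t, ht⟩ := ndef_eval (C := C) (k := k) (fun n hn => (hp n).trans (hk n hn)) hd
  refine ⟨circuitSig k, .numEq t (.const 1), circuitInterp C k, fun i => i.elim0,
    circuitInterp_mem C k hC, fun x => ?_⟩
  have hx : x ∈ S ↔ (C x.1).eval x.2 = 1 := by
    refine ⟨(hS x).1, fun h => ?_⟩
    by_contra hxS
    rw [(hS x).2 hxS] at h
    exact zero_ne_one h
  rw [hx]
  constructor
  · intro h
    have e : (inpStructure k x).enc = List.ofFn x.2 := enc_circuitSig _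
    exact ⟨_, e, (ht _ _).trans ((eval_congr C ((enc_circuitSig _).symm.trans e)).trans h)⟩
  · rintro ⟨D, e, h⟩
    exact (eval_congr C ((enc_circuitSig D).symm.trans e)).symm.trans ((ht _ _).symm.trans h)

end RealAC0

end

theorem mainTheorem4 (f : ℕ → ℕ) (hmono : Monotone f)
    (hlog : ∀ n : ℕ, Real.log (n : ℝ) ≤ (f n : ℝ)) :
    RealAC0.UniformAC0 f = RealAC0.FOSumProd (RealAC0.FTIME f) :=
  Set.Subset.antisymm RealAC0.uniformAC0_subset (RealAC0.fOSumProd_subset hmono hlog)
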